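/- Let $X$ be a compact symplectic manifold with symplectic form $\omega$ and a smooth Hamiltonian action of $S^1$ with moment map $\mu:X\to i\mathbb R$. Let $I$ be an $S^1$-invariant almost complex structure such that $g=\omega(\cdot,I\cdot)$ is a Riemannian metric, with distance $d$. Put $H=-i\mu$, so that $dH=\iota_{\mathcal X}\omega$, where $\mathcal X$ is the vector field generated by $i\in i\mathbb R=\operatorname{Lie}S^1$. Let $V=-\nabla H$, let $\xi_t$ be the flow of $V$, let $F$ be the fixed point set of the action, and for $\delta>0$ let $X^\delta$ be the set of points at distance $>\delta$ from $F$. A *chain of gradient segments* is either a point $x\in X$ (a degenerate chain) or a list $((x_1,T_1),\dots,(x_k,T_k))$, $k\ge 1$, with $x_j\in X\setminus F$ and $T_j\subset\mathbb R$ a closed, possibly unbounded, interval of positive length, such that $\inf T_j=-\infty$ for $j>1$, $\sup T_j=+\infty$ for $j<k$, and $\lim_{t\to\infty}\xi_t(x_j)=\lim_{t\to-\infty}\xi_t(x_{j+1})$ (both limits existing) for $1\le j<k$. Let $f_u:S_u\to X$ be a sequence of smooth maps on compact intervals. It *converges to a nondegenerate chain* $((x_j,T_j))_{j\le k}$ if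 the connected components of $F$ meeting the closure of $\bigcup_j\xi_{T_j}(x_j)$ can be labelled $F_1,\dots,F_l$ with $H(F_1)>\dots>H(F_l)$ and, for each small $\delta>0$ and each $u$ large enough (depending on $\delta$), one can write $$S_u=T^\delta_{u,1}\cup\dots\cup T^\delta_{u,k}\cup E^\delta_{u,1}\cup\dots\cup E^\delta_{u,l}$$ with nonempty compact intervals satisfying $\sup T^\delta_{u,j-1}\le\inf T^\delta_{u,j}$ and $\sup E^\delta_{u,j-1}<\inf E^\delta_{u,j}$, in such a way that * for each small $\delta$ and each $j$, $\lim_{u\to\infty}\sup_{t_0,t\in T^\delta_{u,j}}d\big(\xi_{t-t_0}(f_u(t_0)),f_u(t)\big)=0$; * for each $j$, $\lim_{\delta\to0}\lim_{u\to\infty}D\big(f_u(T^\delta_{u,j}),\,\xi_{T_j}(x_j)\cap X^\delta\big)=0$, where $D$ is the Hausdorff distance; * for each $j$, $\lim_{\delta\to0}\limsup_{u\to\infty}\operatorname{diam}f_u(E^\delta_{u,j})=\lim_{\delta\to0}\limsup_{u\to\infty}d(f_u(E^\delta_{u,j}),F_j)=0$. It *converges to a degenerate chain* $x$ if $f_u(S_u)\to\{x\}$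 in the Hausdorff distance and, in case $x\notin F$, also $\sup_{t_0,t\in S_u}d(\xi_{t-t_0}(f_u(t_0)),f_u(t))\to0$. **Theorem.** Let $\sigma>0$. For $u\in\mathbb N$ let $T_u\subset\mathbb R$ be a compact interval of positive length $|T_u|$, $\psi_u:T_u\to X$ a smooth map, $l_u$ a nonzero real number and $G_u>0$, such that $$|\psi_u'(t)-l_uV(\psi_u(t))|=|\psi_u'(t)+l_u\nabla H(\psi_u(t))|\le G_u\,e^{-\sigma d(t,\partial T_u)}\qquad\text{for all }t\in T_u,$$ and suppose that $G_u\to0$ and $l_u\to0$. Then some subsequence of $l_u|T_u|$ converges in $\mathbb R\cup\{\pm\infty\}$, and the following holds. 1. If $l_u|T_u|\to0$, then $\operatorname{diam}\psi_u(T_u)\to0$. 2. If $l_u|T_u|$ does not tend to $0$ (in particular if it tends to a nonzero limit in $\mathbb R\cup\{\pm\infty\}$), put $S_u=l_uT_u$ and $f_u(t)=\psi_u(t/l_u)$ for $t\in S_u$. Then a subsequence of $(f_u,S_u)$ converges to a chain of gradient segments (possibly a degenerate one). -/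

import Mathlib

open Set Filter Topology Bundle
open scoped Manifold ContDiff ENNReal Pointwise

noncomputable section

/-- The coefficient `Ω(v, w)` of a field of bilinear forms `Ω`, read in the chart at `x₀`: it is
evaluated at the point with coordinates `y` on the vectors whose coordinates are `v` and `w`. -/
def bilinInChart {E X : Type*} [NormedAddCommGroup E] [NormedSpace ℝ E]
    [TopologicalSpace X] [ChartedSpace E X]
    (Ω : ∀ x : X, TangentSpace 𝓘(ℝ, E) x →L[ℝ] TangentSpace 𝓘(ℝ, E) x →L[ℝ] ℝ)
    (x₀ : X) (v w : E) (y : E) : ℝ :=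
  Ω ((chartAt E x₀).symm y)
    (mfderiv 𝓘(ℝ, E) 𝓘(ℝ, E) (chartAt E x₀).symm y v)
    (mfderiv 𝓘(ℝ, E) 𝓘(ℝ, E) (chartAt E x₀).symm y w)

/-- The 2-form `Ω` is closed: in every chart,
`dΩ(v₁, v₂, v₃) = ∂_{v₁} Ω(v₂, v₃) + ∂_{v₂} Ω(v₃, v₁) + ∂_{v₃} Ω(v₁, v₂)` vanishes
for constant vectors `v₁, v₂, v₃`. -/
def IsClosedTwoForm {E X : Type*} [NormedAddCommGroup E] [NormedSpace ℝ E]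
    [TopologicalSpace X] [ChartedSpace E X]
    (Ω : ∀ x : X, TangentSpace 𝓘(ℝ, E) x →L[ℝ] TangentSpace 𝓘(ℝ, E) x →L[ℝ] ℝ) : Prop :=
  ∀ x₀ : X, ∀ y ∈ (chartAt E x₀).target, ∀ v₁ v₂ v₃ : E,
    fderiv ℝ (bilinInChart Ω x₀ v₂ v₃) y v₁ + fderiv ℝ (bilinInChart Ω x₀ v₃ v₁) y v₂
      + fderiv ℝ (bilinInChart Ω x₀ v₁ v₂) y v₃ = 0

/-- The differential at `x` of the action of `θ ∈ S¹` on `X`. -/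
def actionDeriv (E : Type*) {X : Type*} [NormedAddCommGroup E] [NormedSpace ℝ E]
    [TopologicalSpace X] [ChartedSpace E X] [MulAction Circle X] (θ : Circle) (x : X) :
    TangentSpace 𝓘(ℝ, E) x →L[ℝ] TangentSpace 𝓘(ℝ, E) (θ • x) :=
  mfderiv 𝓘(ℝ, E) 𝓘(ℝ, E) (fun y : X => θ • y) x

/-- The vector field generated by the infinitesimal action of `i ∈ iℝ = Lie S¹`:
its value at `x` is the velocity at `t = 0` of `t ↦ exp(i t) • x`. -/
def generatingField (E : Type*) {X : Type*} [NormedAddCommGroup E] [NormedSpace ℝ E]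
    [TopologicalSpace X] [ChartedSpace E X] [MulAction Circle X] (x : X) :
    TangentSpace 𝓘(ℝ, E) x :=
  mfderiv 𝓘(ℝ, ℝ) 𝓘(ℝ, E) (fun t : ℝ => Circle.exp t • x) (0 : ℝ) (1 : ℝ)

/-- On a manifold `X` with a Riemannian metric `g` and a smooth action of `S¹`: an invariant
symplectic form `Ω`, an invariant almost complex structure `J` with `g = Ω(·, J ·)`, and a
moment map `μ : X → iℝ`. -/
structure HamiltonianCircleData (E X : Type*) [NormedAddCommGroup E] [NormedSpace ℝ E]
    [TopologicalSpace X] [ChartedSpace E X] [IsManifold 𝓘(ℝ, E) ∞ X]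
    [RiemannianBundle (fun x : X => TangentSpace 𝓘(ℝ, E) x)]
    [MulAction Circle X] where
  /-- the symplectic form -/
  Ω : ∀ x : X, TangentSpace 𝓘(ℝ, E) x →L[ℝ] TangentSpace 𝓘(ℝ, E) x →L[ℝ] ℝ
  Ω_smooth : ContMDiff 𝓘(ℝ, E) (𝓘(ℝ, E).prod 𝓘(ℝ, E →L[ℝ] E →L[ℝ] ℝ)) ∞
    (fun x => TotalSpace.mk' (E →L[ℝ] E →L[ℝ] ℝ)
      (E := fun x : X => TangentSpace 𝓘(ℝ, E) x →L[ℝ] TangentSpace 𝓘(ℝ, E) x →L[ℝ] ℝ) x (Ω x))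
  Ω_alt : ∀ x v, Ω x v v = 0
  Ω_nondegenerate : ∀ x v, (∀ w, Ω x v w = 0) → v = 0
  Ω_closed : IsClosedTwoForm Ω
  Ω_invariant : ∀ (θ : Circle) x v w,
    Ω (θ • x) (actionDeriv E θ x v) (actionDeriv E θ x w) = Ω x v w
  /-- the almost complex structure -/
  J : ∀ x : X, TangentSpace 𝓘(ℝ, E) x →L[ℝ] TangentSpace 𝓘(ℝ, E) x
  J_smooth : ContMDiff 𝓘(ℝ, E) (𝓘(ℝ, E).prod 𝓘(ℝ, E →L[ℝ] E)) ∞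
    (fun x => TotalSpace.mk' (E →L[ℝ] E)
      (E := fun x : X => TangentSpace 𝓘(ℝ, E) x →L[ℝ] TangentSpace 𝓘(ℝ, E) x) x (J x))
  J_sq : ∀ x v, J x (J x v) = -v
  J_invariant : ∀ (θ : Circle) x v,
    J (θ • x) (actionDeriv E θ x v) = actionDeriv E θ x (J x v)
  /-- the given Riemannian metric is `g = Ω(·, J ·)` -/
  compatible : ∀ (x : X) (v w : TangentSpace 𝓘(ℝ, E) x), inner ℝ v w = Ω x v (J x w)
  /-- the moment map, with values in the imaginary line `iℝ ⊂ ℂ` -/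
  μ : X → ℂ
  μ_smooth : ContMDiff 𝓘(ℝ, E) 𝓘(ℝ, ℂ) ∞ μ
  μ_imaginary : ∀ x, (μ x).re = 0
  μ_invariant : ∀ (θ : Circle) x, μ (θ • x) = μ x
  /-- `dH = ι_𝒳 Ω` for `H = -i μ` and `𝒳` the generating vector field -/
  μ_moment : ∀ (x : X) (v : TangentSpace 𝓘(ℝ, E) x),
    mfderiv 𝓘(ℝ, E) 𝓘(ℝ, ℝ) (fun y => (-Complex.I * μ y).re) x v = Ω x (generatingField E x) v

namespace HamiltonianCircleData

section Flow

variable {E X : Type*} [NormedAddCommGroup E] [NormedSpace ℝ E] [FiniteDimensional ℝ E]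
  [TopologicalSpace X] [ChartedSpace E X] [IsManifold 𝓘(ℝ, E) ∞ X]
  [RiemannianBundle (fun x : X => TangentSpace 𝓘(ℝ, E) x)]
  [MulAction Circle X] (M : HamiltonianCircleData E X)

/-- The function `H = -i μ`; it is real because `μ` takes values in `iℝ`. -/
def H (x : X) : ℝ := (-Complex.I * M.μ x).re

/-- The gradient `∇H` with respect to the Riemannian metric, i.e. the vector representing the
differential of `H`. -/
def gradH (x : X) : TangentSpace 𝓘(ℝ, E) x :=
  haveI : FiniteDimensional ℝ (TangentSpace 𝓘(ℝ, E) x) := inferInstanceAs (FiniteDimensional ℝ E)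
  haveI : CompleteSpace (TangentSpace 𝓘(ℝ, E) x) := FiniteDimensional.complete ℝ _
  (InnerProductSpace.toDual ℝ (TangentSpace 𝓘(ℝ, E) x)).symm
    (mfderiv 𝓘(ℝ, E) 𝓘(ℝ, ℝ) M.H x)

/-- The downward gradient field `V = -∇H`. -/
def V (x : X) : TangentSpace 𝓘(ℝ, E) x := -M.gradH x

/-- The downward gradient flow `ξ_t(x)` of `H`: the value at time `t` of the integral curve
`ℝ → X` of `-∇H` which starts at `x` (it exists and is unique when `X` is compact). -/
def ξ (t : ℝ) (x : X) : X :=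
  @Classical.epsilon (ℝ → X) ⟨fun _ => x⟩
    (fun γ => γ 0 = x ∧ IsMIntegralCurve (I := 𝓘(ℝ, E)) γ M.V) t

/-- The set of points fixed by the action of `S¹`. -/
def F (_M : HamiltonianCircleData E X) : Set X := MulAction.fixedPoints Circle X

/-- The connected components of the fixed point set. -/
def fixedComponents : Set (Set X) := {C | ∃ x ∈ M.F, C = connectedComponentIn M.F x}

/-- A pointed gradient segment: a pair `(x, T)` with `x` not fixed and `T ⊆ ℝ` a closed interval,
possibly unbounded, of positive measure. -/
structure PointedSegment where
  x : X
  T : Set ℝ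
  not_fixed : x ∉ M.F
  isClosed : IsClosed T
  ordConnected : T.OrdConnected
  pos : 0 < MeasureTheory.volume T

/-- The set `ξ_T(x)`. -/
def PointedSegment.image {M : HamiltonianCircleData E X} (s : M.PointedSegment) : Set X :=
  (fun t => M.ξ t s.x) '' s.T

/-- A chain of gradient segments, given by a list of pointed gradient segments, or a degenerate
chain, which is just a point. -/
inductive Chain where
  | degenerate (x : X) : Chain
  | segments (k : ℕ) (k_pos : 0 < k) (seg : Fin k → M.PointedSegment)
      (unbounded_below : ∀ j : Fin k, 0 < (j : ℕ) → ¬ BddBelow (seg j).T)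
      (unbounded_above : ∀ j : Fin k, (j : ℕ) + 1 < k → ¬ BddAbove (seg j).T)
      (meet : ∀ i j : Fin k, (j : ℕ) = i + 1 → ∃ p : X,
        Tendsto (fun t => M.ξ t (seg i).x) atTop (𝓝 p) ∧
        Tendsto (fun t => M.ξ t (seg j).x) atBot (𝓝 p)) : Chain

end Flow

section Convergence

variable {E X : Type*} [NormedAddCommGroup E] [NormedSpace ℝ E] [FiniteDimensional ℝ E]
  [EMetricSpace X] [ChartedSpace E X] [IsManifold 𝓘(ℝ, E) ∞ X]
  [RiemannianBundle (fun x : X => TangentSpace 𝓘(ℝ, E) x)]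
  [MulAction Circle X] (M : HamiltonianCircleData E X)

/-- The set `X^δ` of points at distance more than `δ` from the fixed point set. -/
def away (δ : ℝ) : Set X := (Metric.cthickening δ M.F)ᶜ

/-- How far `f`, restricted to `T`, is from being a downward gradient line: the supremum over
`t₀, t ∈ T` of the distance from `ξ_{t - t₀}(f(t₀))` to `f(t)`. -/
def gradientDefect (f : ℝ → X) (T : Set ℝ) : ℝ≥0∞ :=
  ⨆ t₀ ∈ T, ⨆ t ∈ T, edist (M.ξ (t - t₀) (f t₀)) (f t)

/-- Convergence of the lines `f_u : S_u → X` to the nondegenerate chain `ξ_{T_1}(x_1), …,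
ξ_{T_k}(x_k)`. Here `C_1, …, C_l` are the components of the fixed point set which meet the closure
of the chain, in the order of decreasing `H`; for small `δ` and large `u` the interval `S_u` is the
union of `T_{u,j} = [tlo δ u j, thi δ u j]`, `j < k`, and `E_{u,j} = [elo δ u j, ehi δ u j]`,
`j < l`. -/
def ConvergesToSegments (f : ℕ → ℝ → X) (S : ℕ → Set ℝ) {k : ℕ}
    (seg : Fin k → M.PointedSegment) : Prop :=
  ∃ (l : ℕ) (C : Fin l → Set X),
    range C = {A ∈ M.fixedComponents | (A ∩ closure (⋃ j, (seg j).image)).Nonempty} ∧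
    (∀ i j, i < j → ∀ x ∈ C i, ∀ y ∈ C j, M.H y < M.H x) ∧
    ∃ (tlo thi : ℝ → ℕ → Fin k → ℝ) (elo ehi : ℝ → ℕ → Fin l → ℝ),
      (∀ᶠ δ in 𝓝[>] (0 : ℝ), ∀ᶠ u in atTop,
        S u = (⋃ j, Icc (tlo δ u j) (thi δ u j)) ∪ (⋃ j, Icc (elo δ u j) (ehi δ u j)) ∧
        (∀ j, tlo δ u j ≤ thi δ u j) ∧ (∀ j, elo δ u j ≤ ehi δ u j) ∧
        (∀ i j, i < j → thi δ u i ≤ tlo δ u j) ∧ (∀ i j, i < j → ehi δ u i < elo δ u j)) ∧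
      (∀ᶠ δ in 𝓝[>] (0 : ℝ), ∀ j,
        Tendsto (fun u => M.gradientDefect (f u) (Icc (tlo δ u j) (thi δ u j))) atTop (𝓝 0)) ∧
      (∀ j, ∃ D : ℝ → ℝ≥0∞,
        (∀ᶠ δ in 𝓝[>] (0 : ℝ), Tendsto (fun u => Metric.hausdorffEDist
            (f u '' Icc (tlo δ u j) (thi δ u j)) ((seg j).image ∩ M.away δ)) atTop (𝓝 (D δ))) ∧
        Tendsto D (𝓝[>] 0) (𝓝 0)) ∧
      (∀ j, Tendsto (fun δ => limsup (fun u =>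
          Metric.ediam (f u '' Icc (elo δ u j) (ehi δ u j))) atTop) (𝓝[>] 0) (𝓝 0)) ∧
      (∀ j, Tendsto (fun δ => limsup (fun u =>
          ⨅ x ∈ f u '' Icc (elo δ u j) (ehi δ u j), Metric.infEDist x (C j)) atTop)
        (𝓝[>] 0) (𝓝 0))

/-- Convergence of the lines `f_u : S_u → X` to a point `x` (a degenerate chain): the images
`f_u(S_u)` tend to `{x}` in the Hausdorff distance and, unless `x` is fixed, the lines approximate
gradient lines. -/
def ConvergesToPoint (f : ℕ → ℝ → X) (S : ℕ → Set ℝ) (x : X) : Prop :=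
  Tendsto (fun u => Metric.hausdorffEDist (f u '' S u) {x}) atTop (𝓝 0) ∧
    (x ∉ M.F → Tendsto (fun u => M.gradientDefect (f u) (S u)) atTop (𝓝 0))

/-- Convergence of the lines `f_u : S_u → X` to a chain of gradient segments. -/
def Converges (f : ℕ → ℝ → X) (S : ℕ → Set ℝ) : M.Chain → Prop
  | .degenerate x => M.ConvergesToPoint f S x
  | .segments _ _ seg _ _ _ => M.ConvergesToSegments f S seg

end Convergence

end HamiltonianCircleData

end

set_option linter.unusedSectionVars false

/-! In the rescaled time, `f_u(t) = ψ_u(t / l_u)` is a gradient line up to an error bounded by `(G_u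
/ |l_u|) exp(-(σ / |l_u|) d(t, ∂S_u))`. This is dominated by `G_u / σ` times a kernel of mass at
most `2`, so the total error tends to `0` however long `S_u` is (`isApproxLine_rescale`). Grönwall's
inequality then shows that `f_u` follows the flow for bounded times, and `H` almost decreases along
`f_u`. What remains is to control `f_u` near the fixed points, where it may spend unbounded time.

The tool for this is a Łojasiewicz inequality `|H - c| ≤ C ‖V‖²`, with `c` in a finite set
(`exists_lojasiewicz`). Since `∇H = J𝒳`, the fields `V` and `𝒳` have equal length, and `𝒳` has
`2π`-periodic orbits. Near a fixed point, the average of a short closed orbit is a zero of `𝒳` up to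
an error quadratic in the speed; minimizing a penalized length turns this into a true zero at
distance `O(‖𝒳‖)` (`exists_zero_near`). As `dH = 0` at zeros, `H` changes only quadratically from a
zero to a nearby point. Repeated bisection between two zeros shows that `H` is locally constant on
`F` (`exists_ball_eq_of_zeros`), and the inequality follows.

The inequality bounds the length of an approximate gradient line by the square root of its energy
drop, plus terms vanishing with the error (`norm_sub_le_sqrt_energy`). The three properties
(following the flow, almost decreasing `H`, length controlled by energy) are recorded in
`IsAsymptoticLine`, and the compactness argument uses only these.

For compactness, mark times in `S_u` that move infinitely far apart and at which `f_u` converges to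
non-fixed points. Each marked limit lies on a gradient line joining two fixed points, and these
lines occupy successive ranges of `H`, so the number of marks is bounded (`IsMarking.le_card`). Take
a maximal marking. Far from its marks the curve must be close to `F`, so `H` is close to finitely
many values; by continuity it then drops very little, and the length estimate makes the gap small
(`IsMarking.exists_eventually_edist_lt`). Windows of radius `δ⁻¹` around the marks serve as the
intervals `T`, and the gaps as the intervals `E`. Without any mark the whole curve shrinks to a
fixed point. -/

theorem smulRight_one_apply_one {E : Type*} [NormedAddCommGroup E] [NormedSpace ℝ E]
    (L : ℝ →L[ℝ] E) : (1 : ℝ →L[ℝ] ℝ).smulRight (L 1) = L := by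
  ext; simp

theorem IsContMDiffRiemannianBundle.isContinuousRiemannianBundle {E X : Type*}
    [NormedAddCommGroup E] [NormedSpace ℝ E] [TopologicalSpace X] [ChartedSpace E X]
    [IsManifold 𝓘(ℝ, E) ∞ X] [RiemannianBundle (fun x : X => TangentSpace 𝓘(ℝ, E) x)]
    (h : IsContMDiffRiemannianBundle 𝓘(ℝ, E) ∞ E (fun x : X => TangentSpace 𝓘(ℝ, E) x)) :
    IsContinuousRiemannianBundle E (fun x : X => TangentSpace 𝓘(ℝ, E) x) :=
  let ⟨g, hg, hg'⟩ := h.exists_contMDiff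
  ⟨g, hg.continuous, hg'⟩

namespace HamiltonianCircleData

/-! ### The circle action and its generating field -/

section Geometry

variable {E X : Type*} [NormedAddCommGroup E] [NormedSpace ℝ E]
  [TopologicalSpace X] [ChartedSpace E X] [IsManifold 𝓘(ℝ, E) ∞ X]
  [MulAction Circle X] [ContMDiffSMul (𝓡 1) 𝓘(ℝ, E) ∞ Circle X]

/-- The action of `ℝ` obtained from the circle action is smooth. -/
theorem contMDiff_exp_smul :
    ContMDiff (𝓘(ℝ, ℝ).prod 𝓘(ℝ, E)) 𝓘(ℝ, E) ∞ (fun p : ℝ × X => Circle.exp p.1 • p.2) := by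
  have h : ContMDiff ((𝓡 1).prod 𝓘(ℝ, E)) 𝓘(ℝ, E) ∞ (fun p : Circle × X => p.1 • p.2) :=
    ContMDiffSMul.contMDiff_smul
  exact h.comp ((contMDiff_circleExp.comp contMDiff_fst).prodMk contMDiff_snd)

theorem contMDiff_exp_smul_right (x : X) :
    ContMDiff 𝓘(ℝ, ℝ) 𝓘(ℝ, E) ∞ (fun t : ℝ => Circle.exp t • x) :=
  contMDiff_exp_smul.comp (contMDiff_id.prodMk contMDiff_const)

/-- The orbits of the action are integral curves of the generating vector field. -/
theorem isMIntegralCurve_exp_smul (x : X) :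
    IsMIntegralCurve (I := 𝓘(ℝ, E)) (fun t : ℝ => Circle.exp t • x) (generatingField E) := by
  intro t
  have h0 : HasMFDerivAt 𝓘(ℝ, ℝ) 𝓘(ℝ, E) (fun s : ℝ => Circle.exp s • (Circle.exp t • x)) (t - t)
      ((1 : ℝ →L[ℝ] ℝ).smulRight (generatingField E (Circle.exp t • x) : E)) := by
    have := ((contMDiff_exp_smul_right (E := E) (Circle.exp t • x)).mdifferentiable
      (by simp) (t - t)).hasMFDerivAt
    refine this.congr_mfderiv ?_
    rw [generatingField, sub_self]
    exact (smulRight_one_apply_one (E := E) _).symm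
  have h1 : HasMFDerivAt 𝓘(ℝ, ℝ) 𝓘(ℝ, ℝ) (fun s : ℝ => s - t) t (1 : ℝ →L[ℝ] ℝ) :=
    ((hasFDerivAt_id t).sub_const t).hasMFDerivAt
  have h2 := HasMFDerivAt.comp (f := fun s : ℝ => s - t) t h0 h1
  have h3 : (fun s : ℝ => Circle.exp s • (Circle.exp t • x)) ∘ (fun s : ℝ => s - t) =
      fun s : ℝ => Circle.exp s • x := by
    ext s
    simp only [Function.comp_apply, smul_smul, ← Circle.exp_add, sub_add_cancel]
  rw [h3] at h2
  exact h2

/-- The field is the tangent map of `(t, x) ↦ exp(it) x` evaluated along the smooth section `x ↦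
((0, 1), (x, 0))` of the tangent bundle of `ℝ × X`. -/
theorem contMDiff_generatingField :
    ContMDiff 𝓘(ℝ, E) 𝓘(ℝ, E).tangent ∞
      (fun x : X => (⟨x, generatingField E x⟩ : TangentBundle 𝓘(ℝ, E) X)) := by
  have h1 : ContMDiff 𝓘(ℝ, E) (𝓘(ℝ, ℝ).prod 𝓘(ℝ, E)).tangent ∞
      (fun x : X => (equivTangentBundleProd 𝓘(ℝ, ℝ) ℝ 𝓘(ℝ, E) X).symm
        ((⟨0, (1 : ℝ)⟩ : TangentBundle 𝓘(ℝ, ℝ) ℝ), zeroSection E (TangentSpace 𝓘(ℝ, E)) x)) :=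
    contMDiff_equivTangentBundleProd_symm.comp
      (contMDiff_const.prodMk (contMDiff_zeroSection ℝ (TangentSpace 𝓘(ℝ, E))))
  have h2 := ((contMDiff_exp_smul (E := E) (X := X)).contMDiff_tangentMap
    (m := ∞) (by simp)).comp h1
  have key : ∀ x : X, tangentMap (𝓘(ℝ, ℝ).prod 𝓘(ℝ, E)) 𝓘(ℝ, E)
      (fun p : ℝ × X => Circle.exp p.1 • p.2) ((equivTangentBundleProd 𝓘(ℝ, ℝ) ℝ 𝓘(ℝ, E) X).symm
        ((⟨0, (1 : ℝ)⟩ : TangentBundle 𝓘(ℝ, ℝ) ℝ), zeroSection E (TangentSpace 𝓘(ℝ, E)) x)) =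
      (⟨Circle.exp 0 • x, mfderiv 𝓘(ℝ, ℝ) 𝓘(ℝ, E) (fun t : ℝ => Circle.exp t • x) (0 : ℝ) (1 : ℝ)⟩ :
        TangentBundle 𝓘(ℝ, E) X) := by
    intro x
    have hd : MDifferentiableAt (𝓘(ℝ, ℝ).prod 𝓘(ℝ, E)) 𝓘(ℝ, E)
      (fun p : ℝ × X => Circle.exp p.1 • p.2) (0, x) :=
      (contMDiff_exp_smul (E := E) (X := X)).mdifferentiable (by simp) _
    have hc : MDifferentiableAt 𝓘(ℝ, ℝ) (𝓘(ℝ, ℝ).prod 𝓘(ℝ, E)) (fun t : ℝ => (t, x)) 0 :=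
      mdifferentiableAt_id.prodMk mdifferentiableAt_const
    have := mfderiv_comp (0 : ℝ) hd hc
    rw [mfderiv_prod_left] at this
    have h4 : mfderiv 𝓘(ℝ, ℝ) 𝓘(ℝ, E) (fun t : ℝ => Circle.exp t • x) (0 : ℝ) (1 : ℝ) =
      mfderiv (𝓘(ℝ, ℝ).prod 𝓘(ℝ, E)) 𝓘(ℝ, E)
        (fun p : ℝ × X => Circle.exp p.1 • p.2) (0, x) ((1 : ℝ), (0 : E)) :=
      DFunLike.congr_fun this (1 : ℝ)
    rw [h4]
    rfl
  have h5 : (fun x : X => (⟨x, generatingField E x⟩ : TangentBundle 𝓘(ℝ, E) X)) =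
      fun x => (⟨Circle.exp 0 • x,
        mfderiv 𝓘(ℝ, ℝ) 𝓘(ℝ, E) (fun t : ℝ => Circle.exp t • x) (0 : ℝ) (1 : ℝ)⟩ :
        TangentBundle 𝓘(ℝ, E) X) := by
    ext x
    · simp
    · rfl
  rw [h5]
  exact h2.congr fun x => (key x).symm

/-- If the field vanishes at `x`, the orbit of `x` and the constant curve are integral curves with
the same initial value, so they coincide. -/
theorem generatingField_eq_zero_iff [T2Space X] (x : X) :
    generatingField E x = 0 ↔ x ∈ MulAction.fixedPoints Circle X := by
  constructor
  · intro h θ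
    obtain ⟨t, rfl⟩ := Circle.exp_surjective θ
    have := isMIntegralCurve_Ioo_eq_of_contMDiff_boundaryless (t₀ := 0)
      (contMDiff_generatingField.of_le (by simp)) (isMIntegralCurve_exp_smul (E := E) x)
      (isMIntegralCurve_const h) (by simp)
    exact congrFun this t
  · intro h
    have : (fun t : ℝ => Circle.exp t • x) = fun _ => x := funext fun t => h _
    rw [generatingField, this, mfderiv_const]
    rfl

end Geometry
-- The gradient field and the fixed point set
section Gradient

variable {E X : Type*} [NormedAddCommGroup E] [NormedSpace ℝ E] [FiniteDimensional ℝ E]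
  [TopologicalSpace X] [T2Space X] [ChartedSpace E X] [IsManifold 𝓘(ℝ, E) ∞ X]
  [RiemannianBundle (fun x : X => TangentSpace 𝓘(ℝ, E) x)]
  [MulAction Circle X] [ContMDiffSMul (𝓡 1) 𝓘(ℝ, E) ∞ Circle X] (M : HamiltonianCircleData E X)

theorem inner_gradH (x : X) (w : TangentSpace 𝓘(ℝ, E) x) :
    inner ℝ (M.gradH x) w = mfderiv 𝓘(ℝ, E) 𝓘(ℝ, ℝ) M.H x w := by
  have : FiniteDimensional ℝ (TangentSpace 𝓘(ℝ, E) x) := inferInstanceAs (FiniteDimensional ℝ E)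
  have : CompleteSpace (TangentSpace 𝓘(ℝ, E) x) := FiniteDimensional.complete ℝ _
  exact InnerProductSpace.toDual_symm_apply (𝕜 := ℝ) (E := TangentSpace 𝓘(ℝ, E) x)

theorem inner_J_J (x : X) (v w : TangentSpace 𝓘(ℝ, E) x) :
    inner ℝ (M.J x v) (M.J x w) = inner ℝ v w := by
  have h : ∀ a b, M.Ω x a b = -M.Ω x b a := by
    intro a b
    have := M.Ω_alt x (a + b)
    simp only [map_add, add_apply, M.Ω_alt] at this
    linarith
  rw [M.compatible, M.J_sq, map_neg, h, neg_neg, ← M.compatible, real_inner_comm]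

/-- With `𝒳` the generating field, `dH(w) = Ω(𝒳, w) = g(𝒳, -Jw) = g(J𝒳, w)`, because `J` is an
isometry with `J² = -1`. -/
theorem gradH_eq (x : X) : M.gradH x = M.J x (generatingField E x) := by
  refine ext_inner_right ℝ fun w => ?_
  rw [inner_gradH]
  have h := M.μ_moment x w
  have h2 : M.Ω x (generatingField E x) w = inner ℝ (generatingField E x) (-M.J x w) := by
    rw [M.compatible, map_neg, M.J_sq, neg_neg]
  rw [← M.inner_J_J x _ (-M.J x w), map_neg, M.J_sq, neg_neg] at h2
  rw [← h2]
  exact h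

/-- This is the bridge that turns estimates for the periodic field `𝒳` into estimates for the
gradient. -/
theorem norm_V (x : X) : ‖M.V x‖ = ‖generatingField E x‖ := by
  rw [V, norm_neg, gradH_eq, ← sq_eq_sq₀ (norm_nonneg _) (norm_nonneg _),
    ← real_inner_self_eq_norm_sq, ← real_inner_self_eq_norm_sq, inner_J_J]

theorem V_eq_zero_iff (x : X) : M.V x = 0 ↔ x ∈ M.F := by
  rw [← norm_eq_zero, norm_V, norm_eq_zero, generatingField_eq_zero_iff]
  rfl

theorem contMDiff_V : ContMDiff 𝓘(ℝ, E) 𝓘(ℝ, E).tangent ∞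
    (fun x : X => (⟨x, M.V x⟩ : TangentBundle 𝓘(ℝ, E) X)) := by
  have h := (ContMDiff.clm_bundle_apply (b := id) M.J_smooth
    (contMDiff_generatingField (E := E) (X := X))).neg_section
  convert h using 3 with x
  exact congrArg Neg.neg (M.gradH_eq x)

theorem mfderiv_H_apply (x : X) (w : TangentSpace 𝓘(ℝ, E) x) :
    mfderiv 𝓘(ℝ, E) 𝓘(ℝ, ℝ) M.H x w = -inner ℝ (M.V x) w := by
  rw [V, inner_neg_left, neg_neg, inner_gradH]

theorem contMDiff_H : ContMDiff 𝓘(ℝ, E) 𝓘(ℝ, ℝ) ∞ M.H := by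
  have h : ContDiff ℝ ∞ (fun z : ℂ => (-Complex.I * z).re) :=
    Complex.reCLM.contDiff.comp (contDiff_const.mul contDiff_id)
  exact h.contMDiff.comp M.μ_smooth

theorem continuous_H : Continuous M.H := M.contMDiff_H.continuous

theorem isClosed_F : IsClosed M.F := by
  have : M.F = ⋂ θ : Circle, {x : X | θ • x = x} := by
    ext x; simp [F, MulAction.mem_fixedPoints]
  rw [this]
  refine isClosed_iInter fun θ => isClosed_eq ?_ continuous_id
  have h : ContMDiff ((𝓡 1).prod 𝓘(ℝ, E)) 𝓘(ℝ, E) ∞ (fun p : Circle × X => p.1 • p.2) :=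
    ContMDiffSMul.contMDiff_smul
  exact h.continuous.comp (continuous_const.prodMk continuous_id)

variable [h : IsContMDiffRiemannianBundle 𝓘(ℝ, E) ∞ E (fun x : X => TangentSpace 𝓘(ℝ, E) x)]

theorem continuous_norm_V : Continuous fun x => ‖M.V x‖ := by
  have := h.isContinuousRiemannianBundle
  have h0 : Continuous (fun x => (⟨x, M.V x⟩ :
    TotalSpace E (fun x : X => TangentSpace 𝓘(ℝ, E) x))) := M.contMDiff_V.continuous
  have h : Continuous fun x => inner ℝ (M.V x) (M.V x) :=
    Continuous.inner_bundle (F := E) (E := fun x : X => TangentSpace 𝓘(ℝ, E) x)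
      (b := fun x : X => x) (v := fun x => M.V x) (w := fun x => M.V x) h0 h0
  simpa only [real_inner_self_eq_norm_sq, Real.sqrt_sq (norm_nonneg _)] using h.sqrt

theorem exists_norm_V_le [CompactSpace X] : ∃ C > 0, ∀ x, ‖M.V x‖ ≤ C := by
  obtain ⟨C, hC⟩ := isCompact_univ.exists_bound_of_continuousOn M.continuous_norm_V.continuousOn
  refine ⟨|C| + 1, by positivity, fun x => ?_⟩
  have := hC x (mem_univ _)
  rw [norm_norm] at this
  linarith [le_abs_self C]

theorem exists_eventually_le_norm_V {x₀ : X} (hx₀ : x₀ ∉ M.F) :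
    ∃ c > 0, ∀ᶠ x in 𝓝 x₀, c ≤ ‖M.V x‖ := by
  have hpos : 0 < ‖M.V x₀‖ := norm_pos_iff.2 fun h => hx₀ ((M.V_eq_zero_iff x₀).1 h)
  refine ⟨‖M.V x₀‖ / 2, by positivity, ?_⟩
  filter_upwards [M.continuous_norm_V.continuousAt.eventually (lt_mem_nhds (half_lt_self hpos))]
    with x hx using hx.le

end Gradient
end HamiltonianCircleData

/-! ### Vector fields in charts and global integral curves -/

section ChartField

variable {E X : Type*} [NormedAddCommGroup E] [NormedSpace ℝ E]
  [TopologicalSpace X] [ChartedSpace E X] [IsManifold 𝓘(ℝ, E) ∞ X]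

/-- The differential of a map into a vector space, with values in that vector space. -/
noncomputable def vderiv {F : Type*} [NormedAddCommGroup F] [NormedSpace ℝ F] (e : X → F) (x : X) :
    TangentSpace 𝓘(ℝ, E) x →L[ℝ] F :=
  mfderiv 𝓘(ℝ, E) 𝓘(ℝ, F) e x

/-- A vector field read in the chart at `x₀`. -/
noncomputable def chartField (Z : ∀ x : X, TangentSpace 𝓘(ℝ, E) x) (x₀ : X) (y : E) : E :=
  vderiv (extChartAt 𝓘(ℝ, E) x₀) ((extChartAt 𝓘(ℝ, E) x₀).symm y)
    (Z ((extChartAt 𝓘(ℝ, E) x₀).symm y))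

theorem contDiffAt_chartField {Z : ∀ x : X, TangentSpace 𝓘(ℝ, E) x}
    (hZ : ContMDiff 𝓘(ℝ, E) 𝓘(ℝ, E).tangent ∞
      (fun x : X => (⟨x, Z x⟩ : TangentBundle 𝓘(ℝ, E) X))) (x₀ : X) :
    ContDiffAt ℝ ∞ (chartField Z x₀) (extChartAt 𝓘(ℝ, E) x₀ x₀) := by
  have h := (contMDiffAt_section x₀).1 (hZ x₀)
  have h2 := (contMDiffAt_iff.1 h).2
  simp only [modelWithCornersSelf_coe, range_id, contDiffWithinAt_univ] at h2
  refine h2.congr_of_eventuallyEq ?_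
  filter_upwards [extChartAt_target_mem_nhds (I := 𝓘(ℝ, E)) x₀] with y hy
  have hy' : (extChartAt 𝓘(ℝ, E) x₀).symm y ∈ (chartAt E x₀).source := by
    simpa using (extChartAt 𝓘(ℝ, E) x₀).map_target hy
  have k1 : chartField Z x₀ y = (trivializationAt E (TangentSpace 𝓘(ℝ, E)) x₀).continuousLinearMapAt
      ℝ ((extChartAt 𝓘(ℝ, E) x₀).symm y) (Z ((extChartAt 𝓘(ℝ, E) x₀).symm y)) :=
    DFunLike.congr_fun
      (TangentBundle.continuousLinearMapAt_trivializationAt (I := 𝓘(ℝ, E)) hy').symm _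
  rw [k1, Trivialization.continuousLinearMapAt_apply, Trivialization.linearMapAt_apply, if_pos]
  · rfl
  · simpa using hy'

theorem HasMFDerivWithinAt.hasDerivWithinAt_comp {F : Type*} [NormedAddCommGroup F]
    [NormedSpace ℝ F] {f : ℝ → X} {s : Set ℝ} {t : ℝ} {v : TangentSpace 𝓘(ℝ, E) (f t)}
    (hf : HasMFDerivWithinAt 𝓘(ℝ, ℝ) 𝓘(ℝ, E) f s t ((1 : ℝ →L[ℝ] ℝ).smulRight v))
    {e : X → F} (he : MDifferentiableAt 𝓘(ℝ, E) 𝓘(ℝ, F) e (f t)) :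
    HasDerivWithinAt (fun r => e (f r)) (vderiv e (f t) v) s t := by
  have h := he.hasMFDerivAt.comp_hasMFDerivWithinAt t hf
  have h2 := (hasMFDerivWithinAt_iff_hasFDerivWithinAt (E' := F)).1 h
  have h3 : (ContinuousLinearMap.toSpanSingleton ℝ (vderiv e (f t) v)) =
      (vderiv e (f t)).comp ((1 : ℝ →L[ℝ] ℝ).smulRight v) := by
    refine ContinuousLinearMap.ext fun r : ℝ => ?_
    exact ((vderiv e (f t)).map_smul r v).symm
  exact hasDerivWithinAt_iff_hasFDerivWithinAt.2 (h2.congr_fderiv h3.symm)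

/-- Carries solutions of the differential equation in the chart back to the manifold. -/
theorem hasMFDerivAt_extChartAt_symm_comp {x₀ : X} {c : ℝ → E} {t : ℝ}
    (hc : c t ∈ (extChartAt 𝓘(ℝ, E) x₀).target)
    {v : TangentSpace 𝓘(ℝ, E) ((extChartAt 𝓘(ℝ, E) x₀).symm (c t))}
    (h : HasDerivAt c (vderiv (extChartAt 𝓘(ℝ, E) x₀)
      ((extChartAt 𝓘(ℝ, E) x₀).symm (c t)) v) t) :
    HasMFDerivAt 𝓘(ℝ, ℝ) 𝓘(ℝ, E) (fun r => (extChartAt 𝓘(ℝ, E) x₀).symm (c r)) t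
      ((1 : ℝ →L[ℝ] ℝ).smulRight v) := by
  have h1 := h.hasFDerivAt.hasMFDerivAt
  have h2 := (mdifferentiableWithinAt_extChartAt_symm (I := 𝓘(ℝ, E)) hc).hasMFDerivWithinAt
  have h4 := mfderivWithin_extChartAt_symm_comp_mfderiv_extChartAt (I := 𝓘(ℝ, E)) (x := x₀) hc
  have h3 := HasMFDerivWithinAt.comp t h2 (h1.hasMFDerivWithinAt (s := univ)) (by simp)
  refine (hasMFDerivWithinAt_univ.1 h3).congr_mfderiv ?_
  refine ContinuousLinearMap.ext fun r : ℝ => ?_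
  have h5 := DFunLike.congr_fun h4 (r • v)
  have h6 : r • vderiv (extChartAt 𝓘(ℝ, E) x₀) ((extChartAt 𝓘(ℝ, E) x₀).symm (c t)) v =
    vderiv (extChartAt 𝓘(ℝ, E) x₀) ((extChartAt 𝓘(ℝ, E) x₀).symm (c t)) (r • v) :=
      (map_smul _ r v).symm
  refine Eq.trans ?_ h5
  exact congrArg
    (mfderivWithin 𝓘(ℝ, E) 𝓘(ℝ, E) (extChartAt 𝓘(ℝ, E) x₀).symm (range 𝓘(ℝ, E)) (c t)) h6

/-- A smooth vector field on a compact manifold has global integral curves. -/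
theorem exists_isMIntegralCurve_of_compactSpace [CompactSpace X] [T2Space X] [CompleteSpace E]
    {Z : ∀ x : X, TangentSpace 𝓘(ℝ, E) x}
    (hZ : ContMDiff 𝓘(ℝ, E) 𝓘(ℝ, E).tangent ∞
      (fun x : X => (⟨x, Z x⟩ : TangentBundle 𝓘(ℝ, E) X))) (x : X) :
    ∃ γ : ℝ → X, γ 0 = x ∧ IsMIntegralCurve (I := 𝓘(ℝ, E)) γ Z := by
  have hloc : ∀ x₀ : X, ∃ ε > 0, ∀ᶠ x in 𝓝 x₀, ∃ γ : ℝ → X, γ 0 = x ∧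
      IsMIntegralCurveOn (I := 𝓘(ℝ, E)) γ Z (Ioo (-ε) ε) := by
    intro x₀
    set φ := extChartAt 𝓘(ℝ, E) x₀ with hφ
    obtain ⟨ε, hε, a, r, Lc, Kc, hr, hpl⟩ := IsPicardLindelof.of_contDiffAt_one
      ((contDiffAt_chartField hZ x₀).of_le (by simp))
    obtain ⟨α, hα, hαc⟩ :=
      (hpl 0).exists_forall_mem_closedBall_eq_hasDerivWithinAt_continuousOn
    have hmem : Metric.closedBall (φ x₀) r ×ˢ Icc (0 - ε) (0 + ε) ∈ 𝓝 (φ x₀, (0 : ℝ)) :=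
      prod_mem_nhds (Metric.closedBall_mem_nhds _ (by exact_mod_cast hr))
        (Icc_mem_nhds (by linarith) (by linarith))
    have hα0 : α (φ x₀, 0) = φ x₀ := (hα _ (Metric.mem_closedBall_self r.2)).1
    -- Joint continuity in the starting point and the time keeps the local solutions inside the
    -- chart, for all nearby starting points on one common time interval.
    have h1 : ∀ᶠ q in 𝓝 (φ x₀, (0 : ℝ)), α q ∈ φ.target := by
      refine (hαc.continuousAt hmem).eventually_mem ?_
      rw [hα0]
      exact extChartAt_target_mem_nhds x₀
    have h2 := h1.and (eventually_mem_nhds_iff.2 hmem)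
    rw [nhds_prod_eq] at h2
    obtain ⟨pa, hpa, pb, hpb, hab⟩ := eventually_prod_iff.1 h2
    obtain ⟨ε', hε', hball⟩ := Metric.eventually_nhds_iff_ball.1 hpb
    refine ⟨ε', hε', ?_⟩
    filter_upwards [(continuousAt_extChartAt (I := 𝓘(ℝ, E)) x₀).eventually hpa,
      extChartAt_source_mem_nhds (I := 𝓘(ℝ, E)) x₀] with x hx hxs
    have h0b : pb 0 := hball 0 (Metric.mem_ball_self hε')
    have hxr : φ x ∈ Metric.closedBall (φ x₀) r := (mem_of_mem_nhds (hab hx h0b).2).1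
    refine ⟨fun t => φ.symm (α (φ x, t)), ?_, fun t ht => ?_⟩
    · change φ.symm (α (φ x, 0)) = x
      rw [(hα _ hxr).1]
      exact φ.left_inv hxs
    · have htb : pb t := hball t (by
        rw [Metric.mem_ball, Real.dist_eq, sub_zero, abs_lt]; exact ht)
      obtain ⟨ht1, ht2⟩ := hab hx htb
      have ht3 : Icc (0 - ε) (0 + ε) ∈ 𝓝 t :=
        (prod_mem_nhds_iff.1 ht2).2
      refine HasMFDerivAt.hasMFDerivWithinAt ?_
      exact hasMFDerivAt_extChartAt_symm_comp ht1
        (((hα _ hxr).2 t (mem_of_mem_nhds ht3)).hasDerivAt ht3)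
  choose ε hε h using hloc
  -- By compactness the existence time can be taken uniform over `X`, and a uniform existence time
  -- allows indefinite continuation.
  obtain ⟨s, hs⟩ := isCompact_univ.elim_nhds_subcover (fun x₀ => {x | ∃ γ : ℝ → X, γ 0 = x ∧
      IsMIntegralCurveOn (I := 𝓘(ℝ, E)) γ Z (Ioo (-(ε x₀)) (ε x₀))}) (fun x₀ _ => h x₀)
  have hne : s.Nonempty := by
    obtain ⟨i, hi, -⟩ := mem_iUnion₂.1 (hs.2 (mem_univ x))
    exact ⟨i, hi⟩
  refine exists_isMIntegralCurve_of_isMIntegralCurveOn (hZ.of_le (by simp))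
    (ε := s.inf' hne ε) ((Finset.lt_inf'_iff hne).2 fun i _ => hε i) (fun y => ?_) x
  obtain ⟨i, hi, γ, hγ0, hγ⟩ := mem_iUnion₂.1 (hs.2 (mem_univ y))
  have := Finset.inf'_le ε hi
  exact ⟨γ, hγ0, hγ.mono (Ioo_subset_Ioo (by linarith) this)⟩

end ChartField

/-! ### Embedding into Euclidean space -/

section Immersion

variable {E X : Type*} [NormedAddCommGroup E] [NormedSpace ℝ E]
  [TopologicalSpace X] [ChartedSpace E X] [IsManifold 𝓘(ℝ, E) ∞ X]
  {F : Type*} [NormedAddCommGroup F] [NormedSpace ℝ F]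
  {F' : Type*} [NormedAddCommGroup F'] [NormedSpace ℝ F']

theorem ContMDiff.contDiffAt_comp_extChartAt_symm {e : X → F} (he : ContMDiff 𝓘(ℝ, E) 𝓘(ℝ, F) ∞ e)
    (x₀ : X) : ContDiffAt ℝ ∞ (fun y => e ((extChartAt 𝓘(ℝ, E) x₀).symm y))
      (extChartAt 𝓘(ℝ, E) x₀ x₀) := by
  have h2 := (contMDiffAt_iff.1 (he x₀)).2
  simp only [modelWithCornersSelf_coe, range_id, contDiffWithinAt_univ] at h2
  exact h2

/-- Near `x₀` the differential of `e` is the differential of `e` read in the chart, composed with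
the differential of the chart. -/
theorem vderiv_eq_fderiv_comp {e : X → F} (he : ContMDiff 𝓘(ℝ, E) 𝓘(ℝ, F) ∞ e) {x₀ x : X}
    (hx : x ∈ (extChartAt 𝓘(ℝ, E) x₀).source) (v : TangentSpace 𝓘(ℝ, E) x) :
    vderiv e x v = fderiv ℝ (fun y => e ((extChartAt 𝓘(ℝ, E) x₀).symm y))
      (extChartAt 𝓘(ℝ, E) x₀ x) (vderiv (extChartAt 𝓘(ℝ, E) x₀) x v) := by
  set φ := extChartAt 𝓘(ℝ, E) x₀ with hφ
  have hx' : x ∈ (chartAt E x₀).source := by simpa [hφ] using hx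
  have h1 : MDifferentiableAt 𝓘(ℝ, E) 𝓘(ℝ, E) φ x := mdifferentiableAt_extChartAt hx'
  have h2 : MDifferentiableAt 𝓘(ℝ, E) 𝓘(ℝ, F) (fun y => e (φ.symm y)) (φ x) := by
    have h3 : MDifferentiableWithinAt 𝓘(ℝ, E) 𝓘(ℝ, E) φ.symm (range 𝓘(ℝ, E)) (φ x) :=
      mdifferentiableWithinAt_extChartAt_symm (φ.map_source hx)
    rw [modelWithCornersSelf_coe, range_id, mdifferentiableWithinAt_univ] at h3
    exact (he.mdifferentiable (by simp) _).comp _ h3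
  have h4 := mfderiv_comp x h2 h1
  have h5 : (fun y => e (φ.symm y)) ∘ φ =ᶠ[𝓝 x] e := by
    filter_upwards [extChartAt_source_mem_nhds' (I := 𝓘(ℝ, E)) hx] with y hy
    simp only [Function.comp_apply]
    rw [φ.left_inv hy]
  rw [h5.mfderiv_eq, mfderiv_eq_fderiv] at h4
  exact DFunLike.congr_fun h4 v

section Riemannian

variable [RiemannianBundle (fun x : X => TangentSpace 𝓘(ℝ, E) x)]
  [h : IsContMDiffRiemannianBundle 𝓘(ℝ, E) ∞ E (fun x : X => TangentSpace 𝓘(ℝ, E) x)]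

theorem exists_eventually_norm_vderiv_extChartAt_le (x₀ : X) :
    ∃ C > 0, ∀ᶠ x in 𝓝 x₀, ∀ v : TangentSpace 𝓘(ℝ, E) x,
      ‖vderiv (extChartAt 𝓘(ℝ, E) x₀) x v‖ ≤ C * ‖v‖ := by
  have := h.isContinuousRiemannianBundle
  obtain ⟨C, hC, h1⟩ := eventually_norm_mfderiv_extChartAt_lt 𝓘(ℝ, E) x₀
  refine ⟨C, hC, ?_⟩
  filter_upwards [h1] with x hx v
  exact (ContinuousLinearMap.le_opNorm (E := TangentSpace 𝓘(ℝ, E) x) (F := E)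
    (vderiv (extChartAt 𝓘(ℝ, E) x₀) x) v).trans
      (mul_le_mul_of_nonneg_right hx.le (norm_nonneg _))

theorem exists_norm_vderiv_le [CompactSpace X]
    {e : X → F} (he : ContMDiff 𝓘(ℝ, E) 𝓘(ℝ, F) ∞ e) :
    ∃ C > 0, ∀ (x : X) (v : TangentSpace 𝓘(ℝ, E) x), ‖vderiv e x v‖ ≤ C * ‖v‖ := by
  suffices H : ∃ C > 0, ∀ x ∈ (univ : Set X), ∀ (v : TangentSpace 𝓘(ℝ, E) x),
    ‖vderiv e x v‖ ≤ C * ‖v‖ by simpa using H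
  refine isCompact_univ.induction_on ⟨1, one_pos, by simp⟩ ?_ ?_ ?_
  · rintro s t hst ⟨C, hC, h⟩
    exact ⟨C, hC, fun x hx => h x (hst hx)⟩
  · rintro s t ⟨C, hC, h⟩ ⟨C', hC', h'⟩
    refine ⟨max C C', lt_max_of_lt_left hC, ?_⟩
    rintro x (hx | hx) v
    · exact (h x hx v).trans (by gcongr; exact le_max_left _ _)
    · exact (h' x hx v).trans (by gcongr; exact le_max_right _ _)
  · intro x₀ _
    obtain ⟨C, hC, h1⟩ := exists_eventually_norm_vderiv_extChartAt_le (E := E) x₀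
    have h2 := ((he.contDiffAt_comp_extChartAt_symm x₀).fderiv_right
      (m := 0) (by simp)).continuousAt.norm
    have h3 := (h2.comp (continuousAt_extChartAt (I := 𝓘(ℝ, E)) x₀)).eventually
      (gt_mem_nhds (lt_add_one _))
    refine ⟨{x | _}, mem_nhdsWithin_of_mem_nhds (h1.and (h3.and
      (extChartAt_source_mem_nhds (I := 𝓘(ℝ, E)) x₀))), ?_⟩
    refine ⟨(‖fderiv ℝ (fun y => e ((extChartAt 𝓘(ℝ, E) x₀).symm y))
      (extChartAt 𝓘(ℝ, E) x₀ x₀)‖ + 1) * C, by positivity, ?_⟩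
    rintro x ⟨hx1, hx2, hx3⟩ v
    rw [vderiv_eq_fderiv_comp he hx3]
    refine (ContinuousLinearMap.le_opNorm _ _).trans ?_
    rw [mul_assoc]
    have hx2' := hx2.le
    simp only [Function.comp_apply] at hx2'
    exact mul_le_mul hx2' (hx1 v) (norm_nonneg _) (by positivity)

end Riemannian

/-- On a compact manifold, a smooth map is Lipschitz with respect to the distance induced by an
injective immersion. -/
theorem exists_norm_sub_le_of_injective_immersion [CompactSpace X] [FiniteDimensional ℝ E]
    {e : X → F} (he : ContMDiff 𝓘(ℝ, E) 𝓘(ℝ, F) ∞ e) (hinj : Function.Injective e)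
    (hder : ∀ x, Function.Injective (vderiv (E := E) e x))
    {W : X → F'} (hW : ContMDiff 𝓘(ℝ, E) 𝓘(ℝ, F') ∞ W) :
    ∃ L > 0, ∀ x y, ‖W x - W y‖ ≤ L * ‖e x - e y‖ := by
  suffices H : ∃ L > 0, ∀ p ∈ (univ : Set (X × X)), ‖W p.1 - W p.2‖ ≤ L * ‖e p.1 - e p.2‖ by
    obtain ⟨L, hL, H⟩ := H
    exact ⟨L, hL, fun x y => H (x, y) (mem_univ _)⟩
  refine isCompact_univ.induction_on ⟨1, one_pos, by simp⟩ ?_ ?_ ?_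
  · rintro s t hst ⟨C, hC, h⟩
    exact ⟨C, hC, fun x hx => h x (hst hx)⟩
  · rintro s t ⟨C, hC, h⟩ ⟨C', hC', h'⟩
    refine ⟨max C C', lt_max_of_lt_left hC, ?_⟩
    rintro x (hx | hx)
    · exact (h x hx).trans (by gcongr; exact le_max_left _ _)
    · exact (h' x hx).trans (by gcongr; exact le_max_right _ _)
  rintro ⟨x₀, y₀⟩ -
  rw [nhdsWithin_univ]
  by_cases hxy : x₀ = y₀
  · subst hxy
    set φ := extChartAt 𝓘(ℝ, E) x₀ with hφ
    have hs : x₀ ∈ φ.source := mem_extChartAt_source (I := 𝓘(ℝ, E)) x₀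
    set A := fderiv ℝ (fun y => e (φ.symm y)) (φ x₀) with hA
    have hAinj : LinearMap.ker (A : E →ₗ[ℝ] F) = ⊥ := by
      refine LinearMap.ker_eq_bot'.2 fun w hw => ?_
      obtain ⟨B, hB⟩ := isInvertible_mfderiv_extChartAt (I := 𝓘(ℝ, E)) hs
      obtain ⟨v, rfl⟩ : ∃ v, vderiv φ x₀ v = w :=
        ⟨B.symm w, (DFunLike.congr_fun hB (B.symm w)).symm.trans (B.apply_symm_apply w)⟩
      have h1 : vderiv e x₀ v = 0 := by
        rw [vderiv_eq_fderiv_comp he hs]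
        exact hw
      have h2 : v = 0 := hder x₀ (h1.trans (map_zero _).symm)
      rw [h2, map_zero]
    obtain ⟨K, hK, hKA⟩ := (A : E →ₗ[ℝ] F).exists_antilipschitzWith hAinj
    have hK' : (0 : ℝ) < K := hK
    have h1 : HasStrictFDerivAt (fun y => e (φ.symm y)) A (φ x₀) :=
      (he.contDiffAt_comp_extChartAt_symm x₀).hasStrictFDerivAt (by simp)
    -- With relative error `1 / (2K)`, where `K` is the antilipschitz constant of `A`, the remainder
    -- contributes at most half of `‖φ x - φ y‖` and is absorbed on the left.
    have h2 := h1.isLittleO.def (c := 1 / (2 * K)) (by positivity)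
    obtain ⟨K', s, hsn, hLip⟩ := ((hW.contDiffAt_comp_extChartAt_symm x₀).of_le
      (m := 1) (by simp)).exists_lipschitzOnWith
    have hφc : ContinuousAt φ x₀ := continuousAt_extChartAt (I := 𝓘(ℝ, E)) x₀
    have h3 := (hφc.prodMap' hφc).eventually h2
    have h4 : ∀ᶠ x in 𝓝 x₀, φ x ∈ s ∧ x ∈ φ.source :=
      (hφc.eventually hsn).and (extChartAt_source_mem_nhds (I := 𝓘(ℝ, E)) x₀)
    have h5 : ∀ᶠ p in 𝓝 (x₀, x₀), (φ p.1 ∈ s ∧ p.1 ∈ φ.source) ∧ (φ p.2 ∈ s ∧ p.2 ∈ φ.source) := by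
      rw [nhds_prod_eq]
      exact h4.prod_mk h4
    refine ⟨{p | _}, h3.and h5, (K' + 1) * (2 * K), by positivity, ?_⟩
    rintro ⟨x, y⟩ ⟨hp1, ⟨hp2, hp3⟩, hp4, hp5⟩
    change ‖e (φ.symm (φ x)) - e (φ.symm (φ y)) - A (φ x - φ y)‖ ≤ 1 / (2 * K) * ‖φ x - φ y‖ at hp1
    change φ x ∈ s at hp2
    change x ∈ φ.source at hp3
    change φ y ∈ s at hp4
    change y ∈ φ.source at hp5
    rw [φ.left_inv hp3, φ.left_inv hp5] at hp1
    have h6 : ‖W (φ.symm (φ x)) - W (φ.symm (φ y))‖ ≤ K' * ‖φ x - φ y‖ :=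
      hLip.norm_sub_le hp2 hp4
    rw [φ.left_inv hp3, φ.left_inv hp5] at h6
    have h7 : ‖φ x - φ y‖ ≤ K * ‖A (φ x - φ y)‖ := by
      have := hKA.le_mul_dist (φ x) (φ y)
      rwa [dist_eq_norm, dist_eq_norm, ← map_sub] at this
    have h8 : ‖A (φ x - φ y)‖ ≤ ‖e x - e y‖ + 1 / (2 * K) * ‖φ x - φ y‖ := by
      have := norm_sub_norm_le (A (φ x - φ y)) (e x - e y)
      rw [norm_sub_rev (A _)] at this
      linarith
    have h9 : ‖φ x - φ y‖ ≤ 2 * K * ‖e x - e y‖ := by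
      have : K * ‖A (φ x - φ y)‖ ≤ K * (‖e x - e y‖ + 1 / (2 * K) * ‖φ x - φ y‖) := by gcongr
      have h10 : (K : ℝ) * (‖e x - e y‖ + 1 / (2 * K) * ‖φ x - φ y‖) =
        K * ‖e x - e y‖ + ‖φ x - φ y‖ / 2 := by field_simp
      linarith
    calc ‖W x - W y‖ ≤ K' * ‖φ x - φ y‖ := h6
      _ ≤ (K' + 1) * (2 * K * ‖e x - e y‖) := by gcongr; simp
      _ = _ := by ring
  -- Away from the diagonal the right-hand side is bounded below and the left-hand side is bounded
  -- above.
  · have hpos : 0 < ‖e x₀ - e y₀‖ := norm_pos_iff.2 (sub_ne_zero.2 fun h => hxy (hinj h))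
    have hc1 : Continuous fun p : X × X => ‖e p.1 - e p.2‖ :=
      ((he.continuous.comp continuous_fst).sub (he.continuous.comp continuous_snd)).norm
    have hc2 : Continuous fun p : X × X => ‖W p.1 - W p.2‖ :=
      ((hW.continuous.comp continuous_fst).sub (hW.continuous.comp continuous_snd)).norm
    have h1 := (hc1.tendsto (x₀, y₀)).eventually (lt_mem_nhds (half_lt_self hpos))
    have h2 := (hc2.tendsto (x₀, y₀)).eventually (gt_mem_nhds (lt_add_one _))
    simp only at h1 h2
    refine ⟨{p | _}, h1.and h2, (‖W x₀ - W y₀‖ + 1) / (‖e x₀ - e y₀‖ / 2), by positivity, ?_⟩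
    rintro ⟨x, y⟩ ⟨hp1, hp2⟩
    simp only at hp1 hp2 ⊢
    refine hp2.le.trans ?_
    rw [div_mul_eq_mul_div, le_div_iff₀ (by positivity)]
    gcongr

theorem contMDiff_vderiv_apply {Z : ∀ x : X, TangentSpace 𝓘(ℝ, E) x}
    (hZ : ContMDiff 𝓘(ℝ, E) 𝓘(ℝ, E).tangent ∞
      (fun x : X => (⟨x, Z x⟩ : TangentBundle 𝓘(ℝ, E) X)))
    {e : X → F} (he : ContMDiff 𝓘(ℝ, E) 𝓘(ℝ, F) ∞ e) :
    ContMDiff 𝓘(ℝ, E) 𝓘(ℝ, F) ∞ (fun x => vderiv e x (Z x)) :=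
  (contMDiff_snd_tangentBundle_modelSpace F 𝓘(ℝ, F)).comp
    ((he.contMDiff_tangentMap (m := ∞) (by simp)).comp hZ)

end Immersion

/-- In the coordinates `e`, points can be subtracted and `V` is Lipschitz with respect to the
distance they induce, so the estimates for curves take place in a vector space. -/
theorem HamiltonianCircleData.exists_embedding {E X : Type*} [NormedAddCommGroup E]
    [NormedSpace ℝ E] [FiniteDimensional ℝ E] [TopologicalSpace X] [CompactSpace X] [T2Space X]
    [ChartedSpace E X] [IsManifold 𝓘(ℝ, E) ∞ X]
    [RiemannianBundle (fun x : X => TangentSpace 𝓘(ℝ, E) x)]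
    [IsContMDiffRiemannianBundle 𝓘(ℝ, E) ∞ E (fun x : X => TangentSpace 𝓘(ℝ, E) x)]
    [MulAction Circle X] [ContMDiffSMul (𝓡 1) 𝓘(ℝ, E) ∞ Circle X]
    (M : HamiltonianCircleData E X) :
    ∃ (n : ℕ) (e : X → EuclideanSpace ℝ (Fin n)) (L C : ℝ),
      ContMDiff 𝓘(ℝ, E) 𝓘(ℝ, EuclideanSpace ℝ (Fin n)) ∞ e ∧ Function.Injective e ∧ 0 < L ∧ 0 < C ∧
      (∀ x y, ‖vderiv e x (M.V x) - vderiv e y (M.V y)‖ ≤ L * ‖e x - e y‖) ∧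
      ∀ (x : X) (v : TangentSpace 𝓘(ℝ, E) x), ‖vderiv e x v‖ ≤ C * ‖v‖ := by
  obtain ⟨n, e, he, hemb, hder⟩ := exists_embedding_euclidean_of_compact (I := 𝓘(ℝ, E)) (M := X)
  obtain ⟨C, hC, h1⟩ := exists_norm_vderiv_le he
  obtain ⟨L, hL, h2⟩ := exists_norm_sub_le_of_injective_immersion he hemb.injective hder
    (contMDiff_vderiv_apply M.contMDiff_V he)
  exact ⟨n, e, L, C, he, hemb.injective, hL, hC, h2, h1⟩

/-! ### Zeros of a vector field with periodic orbits -/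

section PeriodicField

variable {E : Type*} [NormedAddCommGroup E] [NormedSpace ℝ E]

/-- Both `f` and its derivative are Lipschitz near `p`; the mean value inequality on the segment
from `y` to `z` gives the quadratic remainder. -/
theorem ContDiffAt.exists_lipschitz_taylor {F : Type*} [NormedAddCommGroup F] [NormedSpace ℝ F]
    {f : E → F} {p : E} (hf : ContDiffAt ℝ 2 f p) :
    ∃ K > 0, ∃ R > 0, ∀ y ∈ Metric.ball p R, ∀ z ∈ Metric.ball p R, ‖f z - f y‖ ≤ K * ‖z - y‖ ∧
      ‖f z - f y - fderiv ℝ f y (z - y)‖ ≤ K * ‖z - y‖ ^ 2 := by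
  obtain ⟨K₁, s₁, hs₁, h₁⟩ := (hf.of_le one_le_two).exists_lipschitzOnWith
  obtain ⟨K₂, s₂, hs₂, h₂⟩ := (hf.fderiv_right (m := 1) le_rfl).exists_lipschitzOnWith
  have h₃ : ∀ᶠ y in 𝓝 p, DifferentiableAt ℝ f y :=
    (hf.eventually (by simp)).mono fun y hy => hy.differentiableAt (by simp)
  obtain ⟨R, hR, hball⟩ := Metric.mem_nhds_iff.1 (inter_mem (inter_mem hs₁ hs₂) h₃)
  refine ⟨K₁ + K₂ + 1, by positivity, R, hR, fun y hy z hz => ⟨?_, ?_⟩⟩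
  · refine (h₁.norm_sub_le (hball hz).1.1 (hball hy).1.1).trans ?_
    gcongr
    linarith [K₂.2]
  · have hseg : segment ℝ y z ⊆ Metric.ball p R := (convex_ball p R).segment_subset hy hz
    have := (convex_segment (𝕜 := ℝ) y z).norm_image_sub_le_of_norm_hasFDerivWithin_le'
      (f := f) (f' := fderiv ℝ f) (φ := fderiv ℝ f y) (C := K₂ * ‖z - y‖)
      (fun w hw => ((hball (hseg hw)).2 : DifferentiableAt ℝ f w).hasFDerivAt.hasFDerivWithinAt)
      (fun w hw => (h₂.norm_sub_le (hball (hseg hw)).1.2 (hball hy).1.2).trans (by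
        gcongr
        exact norm_sub_le_of_mem_segment hw))
      (left_mem_segment ℝ y z) (right_mem_segment ℝ y z)
    refine this.trans ?_
    rw [mul_assoc, ← sq]
    gcongr
    linarith [K₁.2]

/-- The average of a small closed orbit of a vector field is an approximate zero of the field, to
second order in the speed. -/
theorem exists_approx_zero_of_periodic [CompleteSpace E] {Z : E → E} {A : E → E →L[ℝ] E} {K R : ℝ}
    {p : E} (hK : 0 < K)
    (hZ : ∀ y ∈ Metric.ball p R, ∀ z ∈ Metric.ball p R, ‖Z z - Z y‖ ≤ K * ‖z - y‖ ∧
      ‖Z z - Z y - A y (z - y)‖ ≤ K * ‖z - y‖ ^ 2)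
    {c : ℝ → E} {T : ℝ} (hT : 0 < T) (hc : ∀ t, c t ∈ Metric.ball p R)
    (hd : ∀ t, HasDerivAt c (Z (c t)) t) (hper : c T = c 0) :
    ∃ y ∈ Metric.ball p R, ‖y - c 0‖ ≤ Real.exp (K * T) / K * ‖Z (c 0)‖ ∧
      ‖Z y‖ ≤ 4 * K * (Real.exp (K * T) / K) ^ 2 * ‖Z (c 0)‖ ^ 2 := by
  set C := Real.exp (K * T) / K with hC
  have hC0 : 0 < C := by positivity
  have hcont : Continuous c := continuous_iff_continuousAt.2 fun t => (hd t).continuousAt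
  -- Grönwall: over one period the orbit moves by at most a multiple of its initial speed.
  have hgron : ∀ t ∈ Icc 0 T, ‖c t - c 0‖ ≤ C * ‖Z (c 0)‖ := by
    intro t ht
    have := norm_le_gronwallBound_of_norm_deriv_right_le (f := fun t => c t - c 0)
      (f' := fun t => Z (c t)) (δ := 0) (K := K) (ε := ‖Z (c 0)‖) (a := 0) (b := T)
      (by fun_prop) (fun t _ => ((hd t).sub_const _).hasDerivWithinAt) (by simp)
      (fun t _ => by
        have h1 := (hZ _ (hc 0) _ (hc t)).1
        have h2 := norm_sub_norm_le (Z (c t)) (Z (c 0))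
        linarith) t ht
    refine this.trans ?_
    simp only [gronwallBound_of_K_ne_0 hK.ne', zero_mul, zero_add, sub_zero]
    rw [hC, div_mul_comm]
    gcongr
    · exact sub_le_self _ zero_le_one |>.trans (by gcongr; exact ht.2)
  have hint : ∀ f : ℝ → E, Continuous f → IntervalIntegrable f MeasureTheory.volume 0 T :=
    fun f hf => hf.intervalIntegrable _ _
  have hZc : ContinuousOn Z (Metric.ball p R) := by
    have : LipschitzOnWith ⟨K, hK.le⟩ Z (Metric.ball p R) :=
      LipschitzOnWith.of_dist_le_mul fun y hy z hz => by
        rw [dist_eq_norm, dist_eq_norm]; exact (hZ z hz y hy).1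
    exact this.continuousOn
  have hZcc : Continuous fun t => Z (c t) :=
    continuous_iff_continuousAt.2 fun t =>
      ((hZc.continuousAt (Metric.isOpen_ball.mem_nhds (hc t))).comp hcont.continuousAt)
  set y := T⁻¹ • ∫ t in (0 : ℝ)..T, c t with hy
  have hyint : ∫ t in (0 : ℝ)..T, (c t - y) = 0 := by
    rw [intervalIntegral.integral_sub (hint _ hcont) (hint _ continuous_const),
      intervalIntegral.integral_const, sub_zero, hy, smul_smul, mul_inv_cancel₀ hT.ne', one_smul,
      sub_self]
  have havg : ∀ (q : E) (m : ℝ), (∀ t ∈ Icc 0 T, ‖c t - q‖ ≤ m) → ‖y - q‖ ≤ m := by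
    intro q m hm
    have h1 : y - q = T⁻¹ • ∫ t in (0 : ℝ)..T, (c t - q) := by
      rw [intervalIntegral.integral_sub (hint _ hcont) (hint _ continuous_const),
        intervalIntegral.integral_const, sub_zero, smul_sub, smul_smul, inv_mul_cancel₀ hT.ne',
        one_smul]
    have h2 : ‖∫ t in (0 : ℝ)..T, (c t - q)‖ ≤ m * |T - 0| :=
      intervalIntegral.norm_integral_le_of_norm_le_const fun t ht => by
        rw [uIoc_of_le hT.le] at ht
        exact hm t ⟨ht.1.le, ht.2⟩
    rw [h1, norm_smul, norm_inv, Real.norm_of_nonneg hT.le, inv_mul_le_iff₀ hT]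
    rw [sub_zero, abs_of_pos hT] at h2
    linarith
  have hy0 : ‖y - c 0‖ ≤ C * ‖Z (c 0)‖ := havg _ _ hgron
  have hyball : y ∈ Metric.ball p R := by
    obtain ⟨t₀, -, hmax⟩ := isCompact_Icc.exists_isMaxOn (nonempty_Icc.2 hT.le)
      (f := fun t => ‖c t - p‖) (by fun_prop)
    rw [mem_ball_iff_norm]
    exact (havg p _ fun t ht => hmax ht).trans_lt (mem_ball_iff_norm.1 (hc t₀))
  refine ⟨y, hyball, hy0, ?_⟩
  have hρ : ∀ t ∈ Icc 0 T, ‖Z (c t) - Z y - A y (c t - y)‖ ≤ 4 * K * C ^ 2 * ‖Z (c 0)‖ ^ 2 := by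
    intro t ht
    have h1 : ‖c t - y‖ ≤ 2 * C * ‖Z (c 0)‖ := by
      have := norm_sub_le_norm_sub_add_norm_sub (c t) (c 0) y
      rw [norm_sub_rev (c 0) y] at this
      linarith [hgron t ht]
    calc _ ≤ K * ‖c t - y‖ ^ 2 := (hZ y hyball _ (hc t)).2
      _ ≤ K * (2 * C * ‖Z (c 0)‖) ^ 2 := by gcongr
      _ = _ := by ring
  -- The integral of `Z ∘ c` vanishes because the orbit closes up, and the linear term integrates to
  -- zero because `y` is the average of `c`. Only `-T • Z y` survives, so the quadratic remainder
  -- bounds `Z y`.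
  have hsum : ∫ t in (0 : ℝ)..T, (Z (c t) - Z y - A y (c t - y)) = -(T • Z y) := by
    have h1 : ∫ t in (0 : ℝ)..T, Z (c t) = 0 := by
      rw [intervalIntegral.integral_eq_sub_of_hasDerivAt (fun t _ => hd t) (hint _ hZcc), hper,
        sub_self]
    have h2 : Continuous fun t => Z (c t) - Z y := hZcc.sub continuous_const
    have h3 : Continuous fun t => A y (c t - y) := by fun_prop
    rw [intervalIntegral.integral_sub (hint _ h2) (hint _ h3),
      intervalIntegral.integral_sub (hint _ hZcc) (hint _ continuous_const), h1,
      intervalIntegral.integral_const, sub_zero,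
      (A y).intervalIntegral_comp_comm (hint _ (by fun_prop)), hyint]
    simp
  have hb : ‖∫ t in (0 : ℝ)..T, (Z (c t) - Z y - A y (c t - y))‖ ≤
      4 * K * C ^ 2 * ‖Z (c 0)‖ ^ 2 * |T - 0| :=
    intervalIntegral.norm_integral_le_of_norm_le_const fun t ht => by
      rw [uIoc_of_le hT.le] at ht
      exact hρ t ⟨ht.1.le, ht.2⟩
  rw [hsum, norm_neg, norm_smul, sub_zero, abs_of_pos hT, Real.norm_of_nonneg hT.le,
    mul_comm T] at hb
  exact le_of_mul_le_mul_right hb hT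

/-- Minimize `4C‖Z z‖ + ‖z - y‖` over a closed ball. At the minimizer `z`, the approximate zero `w`
supplied by `havg` satisfies `‖Z w‖ ≤ ‖Z z‖ / 2` and `‖w - z‖ ≤ C‖Z z‖`. Comparing values gives
`4C‖Z z‖ ≤ 3C‖Z z‖`, so `Z z = 0`. -/
theorem exists_zero_near [FiniteDimensional ℝ E] {Z : E → E} {K C r : ℝ} {p : E} (hK : 0 < K)
    (hC : 0 < C) (hr : 0 < r) (hp : Z p = 0)
    (hZ : ∀ y ∈ Metric.ball p r, ∀ z ∈ Metric.ball p r, ‖Z z - Z y‖ ≤ K * ‖z - y‖)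
    (havg : ∀ y ∈ Metric.ball p r, ∃ z, ‖z - y‖ ≤ C * ‖Z y‖ ∧ ‖Z z‖ ≤ C * ‖Z y‖ ^ 2) :
    ∃ ρ > 0, ∀ y ∈ Metric.ball p ρ, ∃ z ∈ Metric.ball p r, Z z = 0 ∧ ‖z - y‖ ≤ 4 * C * ‖Z y‖ := by
  have : ProperSpace E := FiniteDimensional.proper ℝ E
  -- The first bound keeps the competitor `w` in the ball of radius `r / 2`, as `‖w - p‖ ≤ (1 +
  -- 5CK)ρ`. The second gives `C‖Z z‖ ≤ 1/2`, so that the quadratic bound halves `‖Z z‖`.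
  set ρ := min (r / (2 * (1 + 5 * C * K))) (1 / (2 * C * K)) with hρ
  have hρ0 : 0 < ρ := by positivity
  have hρ1 : ρ * (1 + 5 * C * K) ≤ r / 2 := by
    have : ρ ≤ r / (2 * (1 + 5 * C * K)) := min_le_left _ _
    rw [le_div_iff₀ (by positivity)] at this
    linarith
  have hρ2 : C * K * ρ ≤ 1 / 2 := by
    have : ρ ≤ 1 / (2 * C * K) := min_le_right _ _
    rw [le_div_iff₀ (by positivity)] at this
    linarith
  have hCKρ : 0 < C * K * ρ := by positivity
  refine ⟨ρ, hρ0, fun y hy => ?_⟩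
  have hyp := mem_ball_iff_norm.1 hy
  have hsub : Metric.closedBall p (r / 2) ⊆ Metric.ball p r :=
    Metric.closedBall_subset_ball (half_lt_self hr)
  have hyb : y ∈ Metric.closedBall p (r / 2) := by
    rw [mem_closedBall_iff_norm]
    nlinarith
  have hcont : ContinuousOn Z (Metric.closedBall p (r / 2)) := by
    have : LipschitzOnWith ⟨K, hK.le⟩ Z (Metric.closedBall p (r / 2)) :=
      LipschitzOnWith.of_dist_le_mul fun y hy z hz => by
        rw [dist_eq_norm, dist_eq_norm]; exact hZ z (hsub hz) y (hsub hy)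
    exact this.continuousOn
  obtain ⟨z, hz, hmin⟩ := (isCompact_closedBall p (r / 2)).exists_isMinOn ⟨y, hyb⟩
    (f := fun z => 4 * C * ‖Z z‖ + ‖z - y‖)
    ((continuousOn_const.mul hcont.norm).add (by fun_prop))
  have hZy : ‖Z y‖ ≤ K * ρ := by
    have := hZ p (Metric.mem_ball_self hr) y (hsub hyb)
    rw [hp, sub_zero] at this
    exact this.trans (by gcongr)
  have h1 : 4 * C * ‖Z z‖ + ‖z - y‖ ≤ 4 * C * ‖Z y‖ := by
    have := hmin hyb
    simpa using this
  have h2 : ‖z - y‖ ≤ 4 * C * ‖Z y‖ := by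
    have : 0 ≤ 4 * C * ‖Z z‖ := by positivity
    linarith
  have h3 : ‖Z z‖ ≤ ‖Z y‖ := by
    have : 4 * C * ‖Z z‖ ≤ 4 * C * ‖Z y‖ := by linarith [norm_nonneg (z - y)]
    exact le_of_mul_le_mul_left this (by positivity)
  refine ⟨z, hsub hz, ?_, h2⟩
  obtain ⟨w, hw1, hw2⟩ := havg z (hsub hz)
  have h4 : C * ‖Z y‖ ≤ C * (K * ρ) := by gcongr
  have h5 : C * ‖Z z‖ ≤ C * (K * ρ) := by gcongr; exact h3.trans hZy
  have hwb : w ∈ Metric.closedBall p (r / 2) := by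
    rw [mem_closedBall_iff_norm]
    have := norm_sub_le_norm_sub_add_norm_sub w z p
    have := norm_sub_le_norm_sub_add_norm_sub z y p
    nlinarith
  have h6 : 4 * C * ‖Z z‖ + ‖z - y‖ ≤ 4 * C * ‖Z w‖ + ‖w - y‖ := hmin hwb
  have h7 : ‖Z w‖ ≤ ‖Z z‖ / 2 := by
    have : C * ‖Z z‖ ≤ 1 / 2 := by linarith
    nlinarith [norm_nonneg (Z z)]
  have h8 := norm_sub_le_norm_sub_add_norm_sub w z y
  have h9 : C * ‖Z w‖ ≤ C * (‖Z z‖ / 2) := by gcongr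
  have h10 : C * ‖Z z‖ ≤ 0 := by linarith
  have h11 : ‖Z z‖ ≤ 0 := by
    by_contra h
    exact absurd h10 (not_le.2 (mul_pos hC (not_le.1 h)))
  exact norm_le_zero_iff.1 h11

/-- A function whose differential vanishes on the zero set of a field `Z` is locally constant on
that set, provided that approximate zeros of `Z` are close to zeros of `Z`. -/
theorem exists_ball_eq_of_zeros {Z : E → E} {A : E → E →L[ℝ] E} {h : E → ℝ} {K C r ρ : ℝ} {p : E}
    (hK : 0 < K) (hC : 0 < C) (hr : 0 < r) (hρ : 0 < ρ) (hp : Z p = 0)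
    (hZ : ∀ y ∈ Metric.ball p r, ∀ z ∈ Metric.ball p r, ‖Z z - Z y - A y (z - y)‖ ≤ K * ‖z - y‖ ^ 2)
    (hh : ∀ y ∈ Metric.ball p r, ∀ z ∈ Metric.ball p r, Z y = 0 → |h z - h y| ≤ K * ‖z - y‖ ^ 2)
    (hzero : ∀ y ∈ Metric.ball p ρ, ∃ z ∈ Metric.ball p r, Z z = 0 ∧ ‖z - y‖ ≤ C * ‖Z y‖) :
    ∃ ρ' > 0, ∀ x ∈ Metric.ball p ρ', Z x = 0 → h x = h p := by
  set τ := min (min r ρ) (1 / (C * K)) with hτ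
  have hτ0 : 0 < τ := by positivity
  have hτr : τ ≤ r := (min_le_left _ _).trans (min_le_left _ _)
  have hτρ : τ ≤ ρ := (min_le_left _ _).trans (min_le_right _ _)
  have hτC : C * K * τ ≤ 1 := by
    have : τ ≤ 1 / (C * K) := min_le_right _ _
    rw [le_div_iff₀ (by positivity)] at this
    linarith
  -- Between two zeros at distance `d` there is a third one near their midpoint, at distance at most
  -- `3d/5` from both. After `n` bisections there are `2^n` steps of length at most `(3/5)^n d`,
  -- each changing `h` quadratically. The weight `10` keeps all intermediate zeros near `p` and
  -- forces `C K d ≤ 1/10`.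
  have key : ∀ (n : ℕ) (x x' : E), Z x = 0 → Z x' = 0 → ‖x - p‖ + 10 * ‖x - x'‖ < τ →
      |h x - h x'| ≤ 2 ^ n * (K * ((3 / 5) ^ n * ‖x - x'‖) ^ 2) := by
    intro n
    induction n with
    | zero =>
      intro x x' hx hx' hd
      have hxb : x ∈ Metric.ball p r := by
        rw [mem_ball_iff_norm]; linarith [norm_nonneg (x - x')]
      have hxb' : x' ∈ Metric.ball p r := by
        rw [mem_ball_iff_norm]
        have := norm_sub_le_norm_sub_add_norm_sub x' x p
        rw [norm_sub_rev x' x] at this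
        linarith [norm_nonneg (x - x')]
      simpa using hh x' hxb' x hxb hx'
    | succ n ih =>
      intro x x' hx hx' hd
      set d := ‖x - x'‖ with hdd
      have hd0 : 0 ≤ d := norm_nonneg _
      have hxb : x ∈ Metric.ball p r := by
        rw [mem_ball_iff_norm]; linarith
      have hxb' : x' ∈ Metric.ball p r := by
        rw [mem_ball_iff_norm]
        have := norm_sub_le_norm_sub_add_norm_sub x' x p
        rw [norm_sub_rev x' x] at this
        linarith
      set m := midpoint ℝ x x' with hm
      have hmx : ‖x - m‖ = d / 2 := by
        rw [← dist_eq_norm, dist_left_midpoint, dist_eq_norm, Real.norm_ofNat]; ring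
      have hmx' : ‖x' - m‖ = d / 2 := by
        rw [← dist_eq_norm, dist_comm, dist_midpoint_right, dist_eq_norm, Real.norm_ofNat]; ring
      have hmp : ‖m - p‖ < τ := by
        have := norm_sub_le_norm_sub_add_norm_sub m x p
        rw [norm_sub_rev m x] at this
        linarith
      have hmb : m ∈ Metric.ball p r := mem_ball_iff_norm.2 (hmp.trans_le hτr)
      have hZm : ‖Z m‖ ≤ K * d ^ 2 / 4 := by
        have h1 := hZ m hmb x hxb
        have h2 := hZ m hmb x' hxb'
        rw [hx, hmx] at h1
        rw [hx', hmx'] at h2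
        -- The two linear terms cancel by symmetry about the midpoint, so `Z m` is quadratic in `d`.
        have h3 : (0 - Z m - A m (x - m)) + (0 - Z m - A m (x' - m)) = -((2 : ℝ) • Z m) := by
          have : A m (x - m) + A m (x' - m) = 0 := by
            rw [← map_add]
            have : (x - m) + (x' - m) = 0 := by
              have := midpoint_add_self ℝ x x'
              rw [← hm] at this
              rw [sub_add_sub_comm, ← this, sub_self]
            rw [this, map_zero]
          have h5 : ∀ a b b' : E, (0 - a - b) + (0 - a - b') = -(a + a) - (b + b') := by
            intros; abel
          rw [two_smul, h5, this, sub_zero]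
        have h4 := norm_add_le (0 - Z m - A m (x - m)) (0 - Z m - A m (x' - m))
        rw [h3, norm_neg, norm_smul, Real.norm_ofNat] at h4
        nlinarith
      obtain ⟨w, -, hw0, hw⟩ := hzero m (mem_ball_iff_norm.2 (hmp.trans_le hτρ))
      have hwm : ‖w - m‖ ≤ d / 10 := by
        have h1 : C * ‖Z m‖ ≤ C * (K * d ^ 2 / 4) := by gcongr
        have h2 : C * K * d ≤ 1 / 10 := by
          have : C * K * (10 * d) ≤ C * K * τ := by
            gcongr; linarith [norm_nonneg (x - p)]
          linarith
        nlinarith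
      have hxw : ‖x - w‖ ≤ 3 / 5 * d := by
        have := norm_sub_le_norm_sub_add_norm_sub x m w
        rw [norm_sub_rev m w] at this
        linarith
      have hwx : ‖w - x'‖ ≤ 3 / 5 * d := by
        have := norm_sub_le_norm_sub_add_norm_sub w m x'
        rw [norm_sub_rev m x'] at this
        linarith
      have h1 := ih x w hx hw0 (by linarith)
      have h2 := ih w x' hw0 hx' (by
        have := norm_sub_le_norm_sub_add_norm_sub w x p
        rw [norm_sub_rev w x] at this
        linarith)
      calc |h x - h x'| ≤ |h x - h w| + |h w - h x'| := abs_sub_le _ _ _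
        _ ≤ 2 ^ n * (K * ((3 / 5) ^ n * (3 / 5 * d)) ^ 2) +
            2 ^ n * (K * ((3 / 5) ^ n * (3 / 5 * d)) ^ 2) := by
          refine add_le_add (h1.trans ?_) (h2.trans ?_) <;> gcongr
        _ = _ := by ring
  refine ⟨τ / 12, by positivity, fun x hx hx0 => ?_⟩
  have hxp := mem_ball_iff_norm.1 hx
  -- The ratio is `2 · (3/5)² = 18/25 < 1`, so the total change of `h` is zero.
  have hlim : Tendsto (fun n : ℕ => (18 / 25 : ℝ) ^ n * (K * ‖x - p‖ ^ 2)) atTop (𝓝 0) := by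
    simpa using (tendsto_pow_atTop_nhds_zero_of_lt_one (by norm_num) (by norm_num)).mul_const
      (K * ‖x - p‖ ^ 2)
  have hle : |h x - h p| ≤ 0 := ge_of_tendsto' hlim fun n => by
    refine (key n x p hx0 hp (by linarith)).trans_eq ?_
    have : (18 / 25 : ℝ) ^ n = 2 ^ n * ((3 / 5) ^ n) ^ 2 := by
      rw [← pow_mul, mul_comm n 2, pow_mul, ← mul_pow]; norm_num
    rw [this]; ring
  exact sub_eq_zero.1 (abs_nonpos_iff.1 hle)

end PeriodicField

namespace HamiltonianCircleData

/-! ### The Łojasiewicz inequality for the moment map -/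

section Lojasiewicz

variable {E X : Type*} [NormedAddCommGroup E] [NormedSpace ℝ E] [FiniteDimensional ℝ E]
  [TopologicalSpace X] [T2Space X] [ChartedSpace E X] [IsManifold 𝓘(ℝ, E) ∞ X]
  [RiemannianBundle (fun x : X => TangentSpace 𝓘(ℝ, E) x)]
  [MulAction Circle X] [ContMDiffSMul (𝓡 1) 𝓘(ℝ, E) ∞ Circle X] (M : HamiltonianCircleData E X)

theorem vderiv_H_apply (x : X) (v : TangentSpace 𝓘(ℝ, E) x) :
    vderiv M.H x v = -inner ℝ (M.V x) v :=
  M.mfderiv_H_apply x v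

theorem vderiv_extChartAt_bijective {x₀ x : X} (hx : x ∈ (extChartAt 𝓘(ℝ, E) x₀).source) :
    Function.Bijective (vderiv (E := E) (extChartAt 𝓘(ℝ, E) x₀) x) := by
  obtain ⟨B, hB⟩ := isInvertible_mfderiv_extChartAt (I := 𝓘(ℝ, E)) hx
  have : ⇑(vderiv (E := E) (extChartAt 𝓘(ℝ, E) x₀) x) = B := funext fun v => (DFunLike.congr_fun hB v).symm
  rw [this]
  exact B.bijective

theorem mem_F_of_chartField_eq_zero {x₀ : X} {y : E} (hy : y ∈ (extChartAt 𝓘(ℝ, E) x₀).target)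
    (h : chartField (generatingField E (X := X)) x₀ y = 0) :
    (extChartAt 𝓘(ℝ, E) x₀).symm y ∈ M.F := by
  refine (generatingField_eq_zero_iff (E := E) _).1 ?_
  exact (vderiv_extChartAt_bijective ((extChartAt 𝓘(ℝ, E) x₀).map_target hy)).1
    (h.trans (map_zero _).symm)

theorem chartField_eq_zero_of_mem_F {x₀ x : X} (hx : x ∈ (extChartAt 𝓘(ℝ, E) x₀).source)
    (h : x ∈ M.F) :
    chartField (generatingField E (X := X)) x₀ (extChartAt 𝓘(ℝ, E) x₀ x) = 0 := by
  rw [chartField, (extChartAt 𝓘(ℝ, E) x₀).left_inv hx, (generatingField_eq_zero_iff (E := E) x).2 h,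
    map_zero]

theorem fderiv_H_chart_eq_zero {x₀ : X} {y : E} (hy : y ∈ (extChartAt 𝓘(ℝ, E) x₀).target)
    (h : (extChartAt 𝓘(ℝ, E) x₀).symm y ∈ M.F) :
    fderiv ℝ (fun y => M.H ((extChartAt 𝓘(ℝ, E) x₀).symm y)) y = 0 := by
  have hs := (extChartAt 𝓘(ℝ, E) x₀).map_target hy
  ext w
  obtain ⟨v, rfl⟩ := (vderiv_extChartAt_bijective hs).2 w
  have := vderiv_eq_fderiv_comp M.contMDiff_H hs v
  rw [(extChartAt 𝓘(ℝ, E) x₀).right_inv hy, vderiv_H_apply, (M.V_eq_zero_iff _).2 h,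
    inner_zero_left, neg_zero] at this
  exact this.symm

/-- Compactness of the circle: orbits of points near a fixed point stay in one chart, where the
averaging argument applies. -/
theorem eventually_forall_smul_mem {p : X} (hp : p ∈ M.F) {U : Set X} (hU : U ∈ 𝓝 p) :
    ∀ᶠ x in 𝓝 p, ∀ θ : Circle, θ • x ∈ U := by
  have hcont : Continuous (fun q : Circle × X => q.1 • q.2) := by
    have h : ContMDiff ((𝓡 1).prod 𝓘(ℝ, E)) 𝓘(ℝ, E) ∞ (fun p : Circle × X => p.1 • p.2) :=
      ContMDiffSMul.contMDiff_smul
    exact h.continuous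
  have := isCompact_univ.eventually_forall_of_forall_eventually (x₀ := p) (K := (univ : Set Circle))
    (P := fun x θ => θ • x ∈ U) fun θ _ => by
      have h1 : ContinuousAt (fun z : X × Circle => z.2 • z.1) (p, θ) :=
        (hcont.comp continuous_swap).continuousAt
      refine h1.eventually_mem ?_
      simp only [hp θ]
      exact hU
  simpa using this

variable [h : IsContMDiffRiemannianBundle 𝓘(ℝ, E) ∞ E (fun x : X => TangentSpace 𝓘(ℝ, E) x)]

/-- Near a fixed point `H` satisfies a Łojasiewicz inequality with exponent `1/2`, and it is
constant on the fixed points. -/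
theorem exists_eventually_lojasiewicz {p : X} (hp : p ∈ M.F) :
    ∃ C > 0, ∀ᶠ x in 𝓝 p, (x ∈ M.F → M.H x = M.H p) ∧ |M.H x - M.H p| ≤ C * ‖M.V x‖ ^ 2 := by
  have : CompleteSpace E := FiniteDimensional.complete ℝ E
  set φ := extChartAt 𝓘(ℝ, E) p with hφ
  set Z := chartField (generatingField E (X := X)) p with hZdef
  set q := φ p with hq
  have hps : p ∈ φ.source := mem_extChartAt_source p
  have hZq : Z q = 0 := M.chartField_eq_zero_of_mem_F hps hp
  obtain ⟨K₁, hK₁, R₁, hR₁, hT₁⟩ := ((contDiffAt_chartField (contMDiff_generatingField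
    (E := E) (X := X)) p).of_le (m := 2) (WithTop.coe_le_coe.2 le_top)).exists_lipschitz_taylor
  obtain ⟨K₂, hK₂, R₂, hR₂, hT₂⟩ := ((M.contMDiff_H.contDiffAt_comp_extChartAt_symm p).of_le
    (m := 2) (WithTop.coe_le_coe.2 le_top)).exists_lipschitz_taylor
  obtain ⟨R₃, hR₃, hT₃⟩ := Metric.mem_nhds_iff.1 (extChartAt_target_mem_nhds (I := 𝓘(ℝ, E)) p)
  set K := max K₁ K₂ with hK
  have hK0 : 0 < K := lt_max_of_lt_left hK₁
  set R := min (min R₁ R₂) R₃ with hR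
  have hR0 : 0 < R := by positivity
  have hb₁ : Metric.ball q R ⊆ Metric.ball q R₁ :=
    Metric.ball_subset_ball ((min_le_left _ _).trans (min_le_left _ _))
  have hb₂ : Metric.ball q R ⊆ Metric.ball q R₂ :=
    Metric.ball_subset_ball ((min_le_left _ _).trans (min_le_right _ _))
  have hb₃ : Metric.ball q R ⊆ φ.target :=
    (Metric.ball_subset_ball (min_le_right _ _)).trans hT₃
  have hZT : ∀ y ∈ Metric.ball q R, ∀ z ∈ Metric.ball q R, ‖Z z - Z y‖ ≤ K * ‖z - y‖ ∧
      ‖Z z - Z y - fderiv ℝ Z y (z - y)‖ ≤ K * ‖z - y‖ ^ 2 := by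
    intro y hy z hz
    obtain ⟨h1, h2⟩ := hT₁ y (hb₁ hy) z (hb₁ hz)
    exact ⟨h1.trans (by gcongr; exact le_max_left _ _),
      h2.trans (by gcongr; exact le_max_left _ _)⟩
  have hHT : ∀ y ∈ Metric.ball q R, ∀ z ∈ Metric.ball q R, Z y = 0 →
      |M.H (φ.symm z) - M.H (φ.symm y)| ≤ K * ‖z - y‖ ^ 2 := by
    intro y hy z hz hZy
    have h2 := (hT₂ y (hb₂ hy) z (hb₂ hz)).2
    rw [M.fderiv_H_chart_eq_zero (hb₃ hy) (M.mem_F_of_chartField_eq_zero (hb₃ hy) hZy)] at h2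
    rw [zero_apply, sub_zero] at h2
    exact h2.trans (by gcongr; exact le_max_right _ _)
  have hφc : ContinuousAt φ p := continuousAt_extChartAt (I := 𝓘(ℝ, E)) p
  have hU : {x | x ∈ φ.source ∧ φ x ∈ Metric.ball q R} ∈ 𝓝 p :=
    inter_mem (extChartAt_source_mem_nhds (I := 𝓘(ℝ, E)) p)
      (hφc.preimage_mem_nhds (Metric.ball_mem_nhds _ hR0))
  have hsymm : ContinuousAt φ.symm q := continuousAt_extChartAt_symm p
  have horb := M.eventually_forall_smul_mem hp hU
  have horb' : ∀ᶠ y in 𝓝 q, ∀ θ : Circle, θ • φ.symm y ∈ φ.source ∧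
      φ (θ • φ.symm y) ∈ Metric.ball q R := by
    refine hsymm.eventually (p := fun x => ∀ θ : Circle, θ • x ∈ φ.source ∧
      φ (θ • x) ∈ Metric.ball q R) ?_
    rw [φ.left_inv hps]
    exact horb
  obtain ⟨r₀, hr₀, hr₁⟩ := Metric.eventually_nhds_iff_ball.1 horb'
  set r := min r₀ R with hr
  have hr0 : 0 < r := by positivity
  have hrR : Metric.ball q r ⊆ Metric.ball q R := Metric.ball_subset_ball (min_le_right _ _)
  set B := Real.exp (K * (2 * Real.pi)) / K with hB
  have hB0 : 0 < B := by positivity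
  set C := max B (4 * K * B ^ 2) with hC
  have hC0 : 0 < C := lt_max_of_lt_left hB0
  -- The circle orbit through `y`, read in the chart, is a closed integral curve of `Z` of period
  -- `2π`.
  have havg : ∀ y ∈ Metric.ball q r, ∃ z, ‖z - y‖ ≤ C * ‖Z y‖ ∧ ‖Z z‖ ≤ C * ‖Z y‖ ^ 2 := by
    intro y hy
    have horby := hr₁ y (Metric.ball_subset_ball (min_le_left _ _) hy)
    set c : ℝ → E := fun t => φ (Circle.exp t • φ.symm y) with hcdef
    have hc0 : c 0 = y := by
      simp only [hcdef, Circle.exp_zero, one_smul]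
      exact φ.right_inv (hb₃ (hrR hy))
    have hd : ∀ t, HasDerivAt c (Z (c t)) t := by
      intro t
      have h1 := (isMIntegralCurve_exp_smul (E := E) (φ.symm y) t).hasMFDerivWithinAt (s := univ)
      have h2 := h1.hasDerivWithinAt_comp (e := φ)
        (mdifferentiableAt_extChartAt (by simpa [hφ] using (horby (Circle.exp t)).1))
      rw [hasDerivWithinAt_univ] at h2
      convert h2 using 1
      simp only [hZdef, hcdef, chartField]
      rw [φ.left_inv (horby (Circle.exp t)).1]
    obtain ⟨z, -, h1, h2⟩ := exists_approx_zero_of_periodic hK0 hZT Real.two_pi_pos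
      (fun t => (horby (Circle.exp t)).2) hd (by simp)
    change ‖z - c 0‖ ≤ B * ‖Z (c 0)‖ at h1
    change ‖Z z‖ ≤ 4 * K * B ^ 2 * ‖Z (c 0)‖ ^ 2 at h2
    rw [hc0] at h1 h2
    exact ⟨z, h1.trans (by gcongr; exact le_max_left _ _),
      h2.trans (by gcongr; exact le_max_right _ _)⟩
  obtain ⟨ρ, hρ, hzero⟩ := exists_zero_near hK0 hC0 hr0 hZq
    (fun y hy z hz => (hZT y (hrR hy) z (hrR hz)).1) havg
  obtain ⟨ρ', hρ', hconst⟩ := exists_ball_eq_of_zeros (h := fun y => M.H (φ.symm y)) hK0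
    (by positivity : 0 < 4 * C) hr0 hρ hZq (fun y hy z hz => (hZT y (hrR hy) z (hrR hz)).2)
    (fun y hy z hz => hHT y (hrR hy) z (hrR hz)) hzero
  obtain ⟨D, hD, hvd⟩ := exists_eventually_norm_vderiv_extChartAt_le (E := E) p
  -- The zero `z` found near `φ x` satisfies `‖z - q‖ ≤ (1 + 4CK)‖φ x - q‖`; the second bound puts
  -- it in the ball where `H` equals `H p` at zeros.
  set s := min (min ρ r) (ρ' / (1 + 4 * C * K)) with hs
  have hs0 : 0 < s := by positivity
  refine ⟨K * (4 * C * D) ^ 2, by positivity, ?_⟩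
  filter_upwards [hvd, extChartAt_source_mem_nhds (I := 𝓘(ℝ, E)) p,
    hφc.preimage_mem_nhds (Metric.ball_mem_nhds q hs0)] with x hx1 hx2 hx3
  have hsρ' : s * (1 + 4 * C * K) ≤ ρ' := by
    have : s ≤ ρ' / (1 + 4 * C * K) := min_le_right _ _
    rwa [le_div_iff₀ (by positivity)] at this
  have hxs : ‖φ x - q‖ < s := mem_ball_iff_norm.1 hx3
  have hxr : φ x ∈ Metric.ball q r :=
    mem_ball_iff_norm.2 (hxs.trans_le ((min_le_left _ _).trans (min_le_right _ _)))
  have hxp : φ.symm (φ x) = x := φ.left_inv hx2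
  have hqp : φ.symm q = p := φ.left_inv hps
  refine ⟨fun hxF => ?_, ?_⟩
  · have := hconst (φ x) (mem_ball_iff_norm.2 (by nlinarith [mul_pos hC0 hK0]))
      (M.chartField_eq_zero_of_mem_F hx2 hxF)
    simpa only [hxp, hqp] using this
  · obtain ⟨z, hzr, hz0, hz⟩ := hzero (φ x)
      (mem_ball_iff_norm.2 (hxs.trans_le ((min_le_left _ _).trans (min_le_left _ _))))
    have hZx : ‖Z (φ x)‖ ≤ D * ‖M.V x‖ := by
      have : Z (φ x) = vderiv φ x (generatingField E x) := by
        simp only [hZdef, chartField]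
        rw [hxp]
      rw [this, M.norm_V]
      exact hx1 _
    have hZx' : ‖Z (φ x)‖ ≤ K * ‖φ x - q‖ := by
      have := (hZT q (Metric.mem_ball_self hR0) (φ x) (hrR hxr)).1
      rwa [hZq, sub_zero] at this
    have h1 : M.H (φ.symm z) = M.H (φ.symm q) := by
      refine hconst z (mem_ball_iff_norm.2 ?_) hz0
      have h3 := norm_sub_le_norm_sub_add_norm_sub z (φ x) q
      have h4 : 4 * C * ‖Z (φ x)‖ ≤ 4 * C * (K * ‖φ x - q‖) := by gcongr
      have h5 : ‖φ x - q‖ * (1 + 4 * C * K) < s * (1 + 4 * C * K) := by gcongr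
      linarith
    have h2 := hHT z (hrR hzr) (φ x) (hrR hxr) hz0
    rw [h1, hqp, hxp] at h2
    refine h2.trans ?_
    have h3 : ‖φ x - z‖ ≤ 4 * C * D * ‖M.V x‖ := by
      rw [norm_sub_rev]
      refine hz.trans ?_
      rw [mul_assoc (4 * C)]
      gcongr
    calc K * ‖φ x - z‖ ^ 2 ≤ K * (4 * C * D * ‖M.V x‖) ^ 2 := by gcongr
      _ = _ := by ring

/-- `H` satisfies a Łojasiewicz inequality with exponent `1/2` on the whole of a compact manifold;
in particular it takes finitely many values on the fixed point set. -/
theorem exists_lojasiewicz [CompactSpace X] :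
    ∃ K : Finset ℝ, (∀ x ∈ M.F, M.H x ∈ K) ∧
      ∃ C > 0, ∀ x, ∃ c ∈ K, |M.H x - c| ≤ C * ‖M.V x‖ ^ 2 := by
  suffices H : ∃ K : Finset ℝ, (∀ x ∈ (univ : Set X), x ∈ M.F → M.H x ∈ K) ∧
      ∃ C > 0, ∀ x ∈ (univ : Set X), ∃ c ∈ K, |M.H x - c| ≤ C * ‖M.V x‖ ^ 2 by simpa using H
  classical
  refine isCompact_univ.induction_on ⟨∅, by simp, 1, one_pos, by simp⟩ ?_ ?_ ?_
  · rintro s t hst ⟨K, hK, C, hC, h⟩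
    exact ⟨K, fun x hx => hK x (hst hx), C, hC, fun x hx => h x (hst hx)⟩
  · rintro s t ⟨K, hK, C, hC, h⟩ ⟨K', hK', C', hC', h'⟩
    refine ⟨K ∪ K', ?_, max C C', lt_max_of_lt_left hC, ?_⟩
    · rintro x (hx | hx) hF
      · exact Finset.mem_union_left _ (hK x hx hF)
      · exact Finset.mem_union_right _ (hK' x hx hF)
    · rintro x (hx | hx)
      · obtain ⟨c, hc, h⟩ := h x hx
        exact ⟨c, Finset.mem_union_left _ hc, h.trans (by gcongr; exact le_max_left _ _)⟩
      · obtain ⟨c, hc, h⟩ := h' x hx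
        exact ⟨c, Finset.mem_union_right _ hc, h.trans (by gcongr; exact le_max_right _ _)⟩
  · intro p _
    by_cases hp : p ∈ M.F
    · obtain ⟨C, hC, h⟩ := M.exists_eventually_lojasiewicz hp
      refine ⟨_, mem_nhdsWithin_of_mem_nhds h, {M.H p}, fun x hx hF => ?_, C, hC, fun x hx => ?_⟩
      · exact Finset.mem_singleton.2 (hx.1 hF)
      · exact ⟨_, Finset.mem_singleton_self _, hx.2⟩
    · obtain ⟨c, hc, h⟩ := M.exists_eventually_le_norm_V hp
      -- Away from `F` the value `H p` is added to the finite set although it need not be critical: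
      -- `V` is bounded below there, and the inequality is trivial.
      have h1 := M.continuous_H.continuousAt.eventually (Metric.ball_mem_nhds (M.H p) one_pos)
      have h2 := M.isClosed_F.isOpen_compl.mem_nhds hp
      refine ⟨_, mem_nhdsWithin_of_mem_nhds (inter_mem (inter_mem h h1) h2), {M.H p},
        fun x hx hF => absurd hF hx.2, 1 / c ^ 2, by positivity, fun x hx => ?_⟩
      refine ⟨_, Finset.mem_singleton_self _, ?_⟩
      have h3 : |M.H x - M.H p| < 1 := hx.1.2
      have h4 : c ≤ ‖M.V x‖ := hx.1.1
      refine h3.le.trans ?_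
      rw [one_div, inv_mul_eq_div, le_div_iff₀ (by positivity), one_mul]
      gcongr

end Lojasiewicz

end HamiltonianCircleData

/-! ### The error kernel concentrated at the endpoints -/

section EdgeKernel

/-- A kernel on `[A, B]` which decays exponentially away from the endpoints and has total mass at
most `2`. -/
noncomputable def edgeRate (c A B t : ℝ) : ℝ :=
  c * (Real.exp (-c * (t - A)) + Real.exp (-c * (B - t)))

/-- A primitive of `edgeRate`. -/
noncomputable def edgePrimitive (c A B t : ℝ) : ℝ :=
  Real.exp (-c * (B - t)) - Real.exp (-c * (t - A))

variable {c A B t s : ℝ}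

theorem hasDerivAt_edgePrimitive (c A B t : ℝ) :
    HasDerivAt (edgePrimitive c A B) (edgeRate c A B t) t := by
  have h1 : HasDerivAt (fun t => Real.exp (-c * (B - t))) (Real.exp (-c * (B - t)) * c) t := by
    have := ((((hasDerivAt_id t).const_sub B).const_mul (-c)).exp)
    simpa using this
  have h2 : HasDerivAt (fun t => Real.exp (-c * (t - A))) (Real.exp (-c * (t - A)) * -c) t := by
    have := ((((hasDerivAt_id t).sub_const A).const_mul (-c)).exp)
    simpa using this
  have := h1.sub h2
  refine this.congr_deriv ?_
  rw [edgeRate]; ring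

theorem edgeRate_nonneg (hc : 0 ≤ c) (A B t : ℝ) : 0 ≤ edgeRate c A B t := by
  rw [edgeRate]; positivity

theorem abs_edgePrimitive_le_one (hc : 0 ≤ c) (ht : t ∈ Icc A B) :
    |edgePrimitive c A B t| ≤ 1 := by
  have h1 : Real.exp (-c * (B - t)) ≤ 1 := Real.exp_le_one_iff.2 (by nlinarith [ht.2])
  have h2 : Real.exp (-c * (t - A)) ≤ 1 := Real.exp_le_one_iff.2 (by nlinarith [ht.1])
  have := Real.exp_pos (-c * (B - t))
  have := Real.exp_pos (-c * (t - A))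
  rw [edgePrimitive, abs_le]
  constructor <;> linarith

/-- With `p = exp(-c(B - t)/2)` and `q = exp(-c(t - A)/2)` this is `|p² - q²| ≤ (p + q)²`. The
square root of the energy correction is thus integrable, with a bound independent of the length of
the interval. -/
theorem sqrt_abs_edgePrimitive_le (hc : 0 < c) (A B t : ℝ) :
    √|edgePrimitive c A B t| ≤ 2 / c * edgeRate (c / 2) A B t := by
  have h1 := Real.exp_pos (-(c / 2) * (B - t))
  have h2 := Real.exp_pos (-(c / 2) * (t - A))
  have e1 : Real.exp (-c * (B - t)) = Real.exp (-(c / 2) * (B - t)) ^ 2 := by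
    rw [← Real.exp_nat_mul]; congr 1; push_cast; ring
  have e2 : Real.exp (-c * (t - A)) = Real.exp (-(c / 2) * (t - A)) ^ 2 := by
    rw [← Real.exp_nat_mul]; congr 1; push_cast; ring
  have e3 : 2 / c * edgeRate (c / 2) A B t =
      Real.exp (-(c / 2) * (t - A)) + Real.exp (-(c / 2) * (B - t)) := by
    rw [edgeRate]; field_simp
  rw [e3, edgePrimitive, e1, e2]
  refine Real.sqrt_le_iff.2 ⟨by positivity, ?_⟩
  rw [abs_le]
  constructor <;> nlinarith [mul_pos h1 h2]

end EdgeKernel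

/-! ### Grönwall inequalities with integrable error -/

section Gronwall

variable {G : Type*} [NormedAddCommGroup G] [NormedSpace ℝ G]

theorem HasDerivWithinAt.Ici_of_mem_Ico {f : ℝ → G} {f' : G} {a b t : ℝ}
    (h : HasDerivWithinAt f f' (Icc a b) t) (ht : t ∈ Ico a b) : HasDerivWithinAt f f' (Ici t) t :=
  h.mono_of_mem_nhdsWithin (Icc_mem_nhdsGE_of_mem ht)

/-- Grönwall's inequality with an integrable inhomogeneity, given by its primitive. -/
theorem norm_le_gronwall_primitive {D D' : ℝ → G} {κ P : ℝ → ℝ} {L a b : ℝ} (hab : a ≤ b)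
    (hL : 0 ≤ L) (hD : ∀ t ∈ Icc a b, HasDerivWithinAt D (D' t) (Icc a b) t)
    (hP : ∀ t, HasDerivAt P (κ t) t) (hκ : ∀ t, 0 ≤ κ t)
    (hle : ∀ t ∈ Icc a b, ‖D' t‖ ≤ L * ‖D t‖ + κ t) :
    ‖D b‖ ≤ (‖D a‖ + (P b - P a)) * Real.exp (L * (b - a)) := by
  -- The comparison principle needs a strict inequality of derivatives wherever the two sides touch;
  -- the slope `η` provides it and is then sent to `0`.
  have key : ∀ η > 0, ‖D b‖ ≤ (‖D a‖ + η * (1 + (b - a)) + (P b - P a)) *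
      Real.exp (L * (b - a)) := by
    intro η hη
    refine image_norm_le_of_norm_deriv_right_lt_deriv_boundary (f' := D')
      (B := fun t => (‖D a‖ + η * (1 + (t - a)) + (P t - P a)) * Real.exp (L * (t - a)))
      (B' := fun t => (η + κ t) * Real.exp (L * (t - a)) +
        (‖D a‖ + η * (1 + (t - a)) + (P t - P a)) * (Real.exp (L * (t - a)) * L))
      (fun t ht => (hD t ht).continuousWithinAt)
      (fun t ht => (hD t (Ico_subset_Icc_self ht)).Ici_of_mem_Ico ht) ?_ ?_ ?_ (right_mem_Icc.2 hab)
    · simp [hη.le]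
    · intro t
      have h1 : HasDerivAt (fun t => ‖D a‖ + η * (1 + (t - a)) + (P t - P a)) (η + κ t) t := by
        have := (((((hasDerivAt_id t).sub_const a).const_add 1).const_mul η).const_add ‖D a‖).add
          ((hP t).sub_const (P a))
        exact this.congr_deriv (by simp)
      have h2 : HasDerivAt (fun t => Real.exp (L * (t - a))) (Real.exp (L * (t - a)) * L) t := by
        have := ((((hasDerivAt_id t).sub_const a).const_mul L).exp)
        simpa using this
      exact h1.mul h2
    · intro t ht h
      have h1 := hle t (Ico_subset_Icc_self ht)
      have h2 : 1 ≤ Real.exp (L * (t - a)) :=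
        Real.one_le_exp (mul_nonneg hL (sub_nonneg.2 ht.1))
      have h3 : (η + κ t) * 1 ≤ (η + κ t) * Real.exp (L * (t - a)) := by
        gcongr; have := hκ t; linarith
      rw [h] at h1
      nlinarith
  have hlim : Tendsto (fun η => (‖D a‖ + η * (1 + (b - a)) + (P b - P a)) *
      Real.exp (L * (b - a))) (𝓝[>] 0) (𝓝 ((‖D a‖ + 0 * (1 + (b - a)) + (P b - P a)) *
      Real.exp (L * (b - a)))) := by
    refine (Continuous.tendsto ?_ 0).mono_left nhdsWithin_le_nhds
    fun_prop
  have := ge_of_tendsto hlim (eventually_nhdsWithin_of_forall fun η hη => key η hη)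
  simpa using this

/-- Grönwall's inequality with an integrable inhomogeneity, backwards in time. -/
theorem norm_le_gronwall_primitive_backward {D D' : ℝ → G} {κ P : ℝ → ℝ} {L a b : ℝ} (hab : a ≤ b)
    (hL : 0 ≤ L) (hD : ∀ t ∈ Icc a b, HasDerivWithinAt D (D' t) (Icc a b) t)
    (hP : ∀ t, HasDerivAt P (κ t) t) (hκ : ∀ t, 0 ≤ κ t)
    (hle : ∀ t ∈ Icc a b, ‖D' t‖ ≤ L * ‖D t‖ + κ t) :
    ‖D a‖ ≤ (‖D b‖ + (P b - P a)) * Real.exp (L * (b - a)) := by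
  have hr : ∀ t, HasDerivAt (fun t => a + b - t) (-1) t := fun t => by
    simpa using (hasDerivAt_id t).const_sub (a + b)
  have hm : MapsTo (fun t => a + b - t) (Icc a b) (Icc a b) := fun t ht =>
    ⟨by linarith [ht.2], by linarith [ht.1]⟩
  have := norm_le_gronwall_primitive (D := fun t => D (a + b - t)) (D' := fun t => -D' (a + b - t))
    (P := fun t => -P (a + b - t)) (κ := fun t => κ (a + b - t)) hab hL ?_ ?_ (fun t => hκ _) ?_
  · simpa [neg_add_eq_sub] using this
  · intro t ht
    exact ((hD _ (hm ht)).scomp t (hr t).hasDerivWithinAt hm).congr_deriv (by simp)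
  · intro t
    exact ((hP (a + b - t)).comp t (hr t)).neg.congr_deriv (by simp)
  · intro t ht
    simpa using hle _ (hm ht)

end Gronwall

/-! ### A smooth substitute for the signed square root -/

section SmoothSqrt

/-- A regularization of `y ↦ 2 sign(y) √|y|`. -/
noncomputable def smoothSqrt (ε y : ℝ) : ℝ := √(√(y ^ 2 + ε ^ 2) + y) - √(√(y ^ 2 + ε ^ 2) - y)

theorem abs_lt_sqrt_sq_add_sq {ε : ℝ} (hε : 0 < ε) (y : ℝ) : |y| < √(y ^ 2 + ε ^ 2) := by
  rw [← Real.sqrt_sq_eq_abs]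
  exact Real.sqrt_lt_sqrt (sq_nonneg _) (by have := pow_pos hε 2; linarith)

theorem hasDerivAt_smoothSqrt {ε : ℝ} (hε : 0 < ε) (y : ℝ) :
    HasDerivAt (smoothSqrt ε) ((√(√(y ^ 2 + ε ^ 2) + y) + √(√(y ^ 2 + ε ^ 2) - y)) /
      (2 * √(y ^ 2 + ε ^ 2))) y := by
  have hy := abs_lt.1 (abs_lt_sqrt_sq_add_sq hε y)
  have hpos : 0 < y ^ 2 + ε ^ 2 := by positivity
  have hw : HasDerivAt (fun y => √(y ^ 2 + ε ^ 2)) (y / √(y ^ 2 + ε ^ 2)) y := by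
    have := (((hasDerivAt_id y).pow 2).add_const (ε ^ 2)).sqrt (by simpa using hpos.ne')
    refine this.congr_deriv ?_
    simp only [id, Nat.cast_ofNat, Nat.add_one_sub_one, pow_one, mul_one, Pi.pow_apply]
    field_simp
  have hw0 : 0 < √(y ^ 2 + ε ^ 2) := Real.sqrt_pos.2 hpos
  have h1 : 0 < √(y ^ 2 + ε ^ 2) + y := by linarith
  have h2 : 0 < √(y ^ 2 + ε ^ 2) - y := by linarith
  have := ((hw.add (hasDerivAt_id y)).sqrt h1.ne').sub ((hw.sub (hasDerivAt_id y)).sqrt h2.ne')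
  refine this.congr_deriv ?_
  have e1 := Real.sq_sqrt h1.le
  have e2 := Real.sq_sqrt h2.le
  simp only [Pi.add_apply, Pi.sub_apply, id]
  set w := √(y ^ 2 + ε ^ 2)
  have p1 : 0 < √(w + y) := Real.sqrt_pos.2 h1
  have p2 : 0 < √(w - y) := Real.sqrt_pos.2 h2
  have a1 : (y / w + 1) / (2 * √(w + y)) = √(w + y) / (2 * w) := by
    rw [div_eq_div_iff (by positivity) (by positivity)]
    field_simp
    rw [e1]; ring
  have a2 : (y / w - 1) / (2 * √(w - y)) = -(√(w - y) / (2 * w)) := by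
    rw [← neg_div, div_eq_div_iff (by positivity) (by positivity)]
    field_simp
    rw [e2]; ring
  rw [a1, a2]; ring

theorem Real.sqrt_add_le_sqrt_add_sqrt {a b : ℝ} (ha : 0 ≤ a) (hb : 0 ≤ b) :
    √(a + b) ≤ √a + √b := by
  refine Real.sqrt_le_iff.2 ⟨by positivity, ?_⟩
  have := mul_nonneg (Real.sqrt_nonneg a) (Real.sqrt_nonneg b)
  nlinarith [Real.sq_sqrt ha, Real.sq_sqrt hb]

/-- For `w = √(y² + ε²)` the numerator is at least `√(2w)` by subadditivity of the root, and `w ≤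
|y| + ε`. -/
theorem inv_sqrt_le_deriv_smoothSqrt {ε : ℝ} (hε : 0 < ε) (y : ℝ) :
    1 / √(2 * (|y| + ε)) ≤ (√(√(y ^ 2 + ε ^ 2) + y) + √(√(y ^ 2 + ε ^ 2) - y)) /
      (2 * √(y ^ 2 + ε ^ 2)) := by
  have hy := abs_lt.1 (abs_lt_sqrt_sq_add_sq hε y)
  set w := √(y ^ 2 + ε ^ 2) with hw
  have hw0 : 0 < w := Real.sqrt_pos.2 (by positivity)
  have hwle : w ≤ |y| + ε := by
    refine Real.sqrt_le_iff.2 ⟨by positivity, ?_⟩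
    have := mul_nonneg (abs_nonneg y) hε.le
    rw [← sq_abs y]; nlinarith
  have h1 : √(2 * w) ≤ √(w + y) + √(w - y) := by
    have := Real.sqrt_add_le_sqrt_add_sqrt (show 0 ≤ w + y by linarith) (show 0 ≤ w - y by linarith)
    refine le_trans (le_of_eq ?_) this
    congr 1; ring
  have h2 : 1 / √(2 * w) = √(2 * w) / (2 * w) := by
    rw [div_eq_div_iff (by positivity) (by positivity), one_mul, Real.mul_self_sqrt (by positivity)]
  calc 1 / √(2 * (|y| + ε)) ≤ 1 / √(2 * w) := by gcongr
    _ = √(2 * w) / (2 * w) := h2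
    _ ≤ _ := by gcongr

theorem Real.sqrt_sub_sqrt_le_sqrt_sub (a b : ℝ) (hab : b ≤ a) : √a - √b ≤ √(a - b) := by
  rcases le_total b 0 with hb | hb
  · rw [Real.sqrt_eq_zero_of_nonpos hb, sub_zero]
    exact Real.sqrt_le_sqrt (by linarith)
  · have := Real.sqrt_add_le_sqrt_add_sqrt hb (sub_nonneg.2 hab)
    rw [add_sub_cancel] at this
    linarith

/-- Since `y ↦ √(y² + ε²)` is 1-Lipschitz, each radicand moves by at most `2(z - y)`. The bound is
uniform in `ε`, so the regularization can be removed. -/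
theorem smoothSqrt_sub_le (ε : ℝ) {y z : ℝ} (h : y ≤ z) :
    smoothSqrt ε z - smoothSqrt ε y ≤ 2 * √(2 * (z - y)) := by
  have hw : ∀ y z, √(z ^ 2 + ε ^ 2) - √(y ^ 2 + ε ^ 2) ≤ |z - y| := by
    intro y z
    have h0 : 0 ≤ √(y ^ 2 + ε ^ 2) + |z - y| := by positivity
    have h1 : √(z ^ 2 + ε ^ 2) ≤ √(y ^ 2 + ε ^ 2) + |z - y| := by
      refine Real.sqrt_le_iff.2 ⟨h0, ?_⟩
      have h2 := Real.sq_sqrt (show 0 ≤ y ^ 2 + ε ^ 2 by positivity)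
      have h3 : |y| ≤ √(y ^ 2 + ε ^ 2) := by
        rw [← Real.sqrt_sq_eq_abs]; exact Real.sqrt_le_sqrt (by nlinarith [sq_nonneg ε])
      have h4 : y * (z - y) ≤ |y| * |z - y| := by rw [← abs_mul]; exact le_abs_self _
      have h5 : |y| * |z - y| ≤ √(y ^ 2 + ε ^ 2) * |z - y| := by gcongr
      nlinarith [sq_abs (z - y)]
    linarith
  have key : ∀ a b : ℝ, a - b ≤ 2 * (z - y) → √a - √b ≤ √(2 * (z - y)) := by
    intro a b hab
    rcases le_total b a with hb | hb
    · exact (Real.sqrt_sub_sqrt_le_sqrt_sub a b hb).trans (Real.sqrt_le_sqrt hab)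
    · have := Real.sqrt_le_sqrt hb
      have := Real.sqrt_nonneg (2 * (z - y))
      linarith
  have h1 := hw y z
  have h2 := hw z y
  rw [abs_of_nonneg (sub_nonneg.2 h)] at h1
  rw [abs_sub_comm, abs_of_nonneg (sub_nonneg.2 h)] at h2
  have k1 := key (√(z ^ 2 + ε ^ 2) + z) (√(y ^ 2 + ε ^ 2) + y) (by linarith)
  have k2 := key (√(y ^ 2 + ε ^ 2) - y) (√(z ^ 2 + ε ^ 2) - z) (by linarith)
  rw [smoothSqrt, smoothSqrt]
  linarith

end SmoothSqrt

/-! ### Length bounded by the square root of the energy drop -/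

section EnergyLength

theorem sub_edgePrimitive_le_of_deriv_le {h h' : ℝ → ℝ} {A B c m : ℝ}
    (hh : ∀ t ∈ Icc A B, HasDerivWithinAt h (h' t) (Icc A B) t)
    (hh' : ∀ t ∈ Icc A B, h' t ≤ m * edgeRate c A B t) :
    AntitoneOn (fun t => h t - m * edgePrimitive c A B t) (Icc A B) := by
  have hd : ∀ t ∈ Icc A B, HasDerivWithinAt (fun t => h t - m * edgePrimitive c A B t)
      (h' t - m * edgeRate c A B t) (Icc A B) t := fun t ht =>
    (hh t ht).sub ((hasDerivAt_edgePrimitive c A B t).const_mul m).hasDerivWithinAt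
  refine antitoneOn_of_hasDerivWithinAt_nonpos (convex_Icc A B)
    (f' := fun t => h' t - m * edgeRate c A B t)
    (fun t ht => (hd t ht).continuousWithinAt)
    (fun t ht => (hd t (interior_subset ht)).mono interior_subset)
    (fun t ht => by have := hh' t (interior_subset ht); linarith)

/-- If `C n²` dominates `p + ε`, then `2(|z| + ε) ≤ 4 C n²` and the first term alone suffices.
Otherwise `√C n ≤ √(p + ε)`, which the second term covers. -/
theorem le_energy_rate {n C p z ε : ℝ} (hn : 0 ≤ n) (hC : 0 < C) (hp : 0 ≤ p) (hε : 0 < ε)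
    (hz : |z| ≤ C * n ^ 2 + p) :
    n ≤ 2 * √C * (1 / √(2 * (|z| + ε)) * n ^ 2) + (√p + √ε) / √C := by
  have hsC : 0 < √C := Real.sqrt_pos.2 hC
  rcases le_total (p + ε) (C * n ^ 2) with h | h
  · have hn0 : 0 < n := by
      rcases hn.eq_or_lt with rfl | h'
      · simp at h; linarith
      · exact h'
    have h1 : √(2 * (|z| + ε)) ≤ 2 * √C * n := by
      refine Real.sqrt_le_iff.2 ⟨by positivity, ?_⟩
      rw [mul_pow, mul_pow, Real.sq_sqrt hC.le]
      linarith
    have h0 : 0 < √(2 * (|z| + ε)) := Real.sqrt_pos.2 (by positivity)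
    have h2 : 1 / (2 * √C * n) ≤ 1 / √(2 * (|z| + ε)) := by gcongr
    have h3 : 2 * √C * (1 / (2 * √C * n) * n ^ 2) = n := by field_simp
    have h4 : 2 * √C * (1 / (2 * √C * n) * n ^ 2) ≤ 2 * √C * (1 / √(2 * (|z| + ε)) * n ^ 2) := by
      gcongr
    have : 0 ≤ (√p + √ε) / √C := by positivity
    linarith
  · have h1 : √C * n ≤ √p + √ε := by
      refine le_trans ?_ (Real.sqrt_add_le_sqrt_add_sqrt hp hε.le)
      refine Real.le_sqrt_of_sq_le ?_
      rwa [mul_pow, Real.sq_sqrt hC.le]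
    have h2 : n ≤ (√p + √ε) / √C := by rw [le_div_iff₀ hsC]; linarith
    have : 0 ≤ 2 * √C * (1 / √(2 * (|z| + ε)) * n ^ 2) := by positivity
    linarith

/-- The length of an approximate gradient line of a function satisfying a Łojasiewicz inequality is
controlled by the square root of its energy drop. -/
theorem norm_sub_le_sqrt_energy {G : Type*} [NormedAddCommGroup G] [NormedSpace ℝ G]
    {y y' : ℝ → G} {h h' n : ℝ → ℝ} {A B c g C D m : ℝ} {K : Finset ℝ}
    (hc : 1 ≤ c) (hg : 0 ≤ g) (hC : 0 < C) (hD : 0 ≤ D) (hm : 0 ≤ m)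
    (hy : ∀ t ∈ Icc A B, HasDerivWithinAt y (y' t) (Icc A B) t)
    (hh : ∀ t ∈ Icc A B, HasDerivWithinAt h (h' t) (Icc A B) t)
    (hn : ∀ t ∈ Icc A B, 0 ≤ n t)
    (hy' : ∀ t ∈ Icc A B, ‖y' t‖ ≤ D * (n t + g * edgeRate c A B t))
    (hh' : ∀ t ∈ Icc A B, h' t ≤ -n t ^ 2 + m * g * edgeRate c A B t)
    (hK : ∀ t ∈ Icc A B, ∃ k ∈ K, |h t - k| ≤ C * n t ^ 2)
    {s t : ℝ} (hs : s ∈ Icc A B) (ht : t ∈ Icc A B) (hst : s ≤ t) :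
    ‖y t - y s‖ ≤ D * (2 * √C * (K.card * (2 * √(2 * (h s - h t + 2 * (m * g))))) +
      4 * √(m * g) / √C + 2 * g) := by
  have hc0 : 0 < c := by linarith
  have hmg : 0 ≤ m * g := mul_nonneg hm hg
  have hsC : 0 < √C := Real.sqrt_pos.2 hC
  have hsub : Icc s t ⊆ Icc A B := Icc_subset_Icc hs.1 ht.2
  set P := edgePrimitive c A B with hP
  set Q := edgePrimitive (c / 2) A B with hQ
  -- The corrected energy absorbs the error and truly decreases, at rate at least `n²`.
  set e : ℝ → ℝ := fun t => h t - m * g * P t with he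
  set e' : ℝ → ℝ := fun t => h' t - m * g * edgeRate c A B t with he'
  have hed : ∀ r ∈ Icc A B, HasDerivWithinAt e (e' r) (Icc A B) r := fun r hr =>
    (hh r hr).sub ((hasDerivAt_edgePrimitive c A B r).const_mul (m * g)).hasDerivWithinAt
  have he'n : ∀ r ∈ Icc A B, n r ^ 2 ≤ -e' r := fun r hr => by
    have := hh' r hr; simp only [he']; linarith
  have hP1 : ∀ r ∈ Icc A B, |P r| ≤ 1 := fun r hr => abs_edgePrimitive_le_one hc0.le hr
  have hQ1 : ∀ r ∈ Icc A B, |Q r| ≤ 1 := fun r hr =>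
    abs_edgePrimitive_le_one (by linarith) hr
  have hanti : AntitoneOn e (Icc A B) := sub_edgePrimitive_le_of_deriv_le hh fun r hr => by
    have := hh' r hr; nlinarith [sq_nonneg (n r)]
  have hest : e t ≤ e s := hanti hs ht hst
  have hest' : e s - e t ≤ h s - h t + 2 * (m * g) := by
    have h1 := abs_le.1 (hP1 s hs)
    have h2 := abs_le.1 (hP1 t ht)
    simp only [he]
    nlinarith
  set dφ : ℝ → ℝ → ℝ := fun ε y => (√(√(y ^ 2 + ε ^ 2) + y) + √(√(y ^ 2 + ε ^ 2) - y)) /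
      (2 * √(y ^ 2 + ε ^ 2)) with hdφ
  -- The barrier majorizing `‖y r - y s‖` has four parts: drops of regularized roots of `e - k`, the
  -- contribution of `√|P|`, a multiple of `√ε` times the elapsed time, and the direct error in
  -- `y'`.
  have key : ∀ ε > 0, ‖y t - y s‖ ≤ D * (2 * √C * (K.card * (2 * √(2 * (h s - h t + 2 * (m * g))))) +
      4 * √(m * g) / √C + √ε / √C * (t - s) + 2 * g) := by
    intro ε hε
    have hdφ0 : ∀ y, 0 ≤ dφ ε y := fun y => by simp only [hdφ]; positivity
    have main := image_norm_le_of_norm_deriv_right_le_deriv_boundary' (a := s) (b := t)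
      (f := fun r => y r - y s) (f' := y')
      (B := fun r => D * (2 * √C * (∑ k ∈ K, (smoothSqrt ε (e s - k) - smoothSqrt ε (e r - k))) +
        √(m * g) * (2 / c) / √C * (Q r - Q s) + √ε / √C * (r - s) + g * (P r - P s)))
      (B' := fun r => D * (2 * √C * (∑ k ∈ K, dφ ε (e r - k) * -e' r) +
        √(m * g) * (2 / c) / √C * edgeRate (c / 2) A B r + √ε / √C + g * edgeRate c A B r))
    have hBd : ∀ r ∈ Icc s t, HasDerivWithinAt
        (fun r => D * (2 * √C * (∑ k ∈ K, (smoothSqrt ε (e s - k) - smoothSqrt ε (e r - k))) +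
        √(m * g) * (2 / c) / √C * (Q r - Q s) + √ε / √C * (r - s) + g * (P r - P s)))
        (D * (2 * √C * (∑ k ∈ K, dφ ε (e r - k) * -e' r) +
        √(m * g) * (2 / c) / √C * edgeRate (c / 2) A B r + √ε / √C + g * edgeRate c A B r))
        (Icc s t) r := by
      intro r hr
      have h1 : HasDerivWithinAt
          (fun r => ∑ k ∈ K, (smoothSqrt ε (e s - k) - smoothSqrt ε (e r - k)))
          (∑ k ∈ K, dφ ε (e r - k) * -e' r) (Icc s t) r := by
        refine HasDerivWithinAt.fun_sum fun k _ => ?_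
        have h2 := (hasDerivAt_smoothSqrt hε (e r - k)).comp_hasDerivWithinAt r
          (((hed r (hsub hr)).mono hsub).sub_const k)
        exact (h2.const_sub (smoothSqrt ε (e s - k))).congr_deriv (by simp only [hdφ]; ring)
      have h2 := ((hasDerivAt_edgePrimitive (c / 2) A B r).sub_const (Q s)).const_mul
        (√(m * g) * (2 / c) / √C)
      have h3 := ((hasDerivAt_id r).sub_const s).const_mul (√ε / √C)
      have h4 := ((hasDerivAt_edgePrimitive c A B r).sub_const (P s)).const_mul g
      exact (((((h1.const_mul (2 * √C)).add h2.hasDerivWithinAt).add h3.hasDerivWithinAt).add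
        h4.hasDerivWithinAt).const_mul D).congr_deriv (by rw [mul_one])
    have hyd : ∀ r ∈ Icc s t, HasDerivWithinAt (fun r => y r - y s) (y' r) (Icc s t) r :=
      fun r hr => ((hy r (hsub hr)).mono hsub).sub_const (y s)
    have main' := main (fun r hr => (hyd r hr).continuousWithinAt)
      (fun r hr => (hyd r (Ico_subset_Icc_self hr)).Ici_of_mem_Ico hr) (by simp)
      (fun r hr => (hBd r hr).continuousWithinAt)
      (fun r hr => (hBd r (Ico_subset_Icc_self hr)).Ici_of_mem_Ico hr) ?_ (right_mem_Icc.2 hst)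
    · refine main'.trans ?_
      have hsum : ∑ k ∈ K, (smoothSqrt ε (e s - k) - smoothSqrt ε (e t - k)) ≤
          K.card * (2 * √(2 * (h s - h t + 2 * (m * g)))) := by
        rw [← nsmul_eq_mul]
        refine Finset.sum_le_card_nsmul _ _ _ fun k _ => ?_
        refine (smoothSqrt_sub_le ε (by linarith)).trans ?_
        have : √(2 * (e s - k - (e t - k))) ≤ √(2 * (h s - h t + 2 * (m * g))) :=
          Real.sqrt_le_sqrt (by linarith)
        linarith
      have hQst : √(m * g) * (2 / c) / √C * (Q t - Q s) ≤ 4 * √(m * g) / √C := by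
        have h1 := abs_le.1 (hQ1 s hs)
        have h2 := abs_le.1 (hQ1 t ht)
        have h3 : 2 / c ≤ 2 := by rw [div_le_iff₀ hc0]; linarith
        calc √(m * g) * (2 / c) / √C * (Q t - Q s) ≤ √(m * g) * (2 / c) / √C * 2 := by
              gcongr; linarith
          _ ≤ √(m * g) * 2 / √C * 2 := by gcongr
          _ = _ := by ring
      have hPst : g * (P t - P s) ≤ 2 * g := by
        have h1 := abs_le.1 (hP1 s hs)
        have h2 := abs_le.1 (hP1 t ht)
        nlinarith
      gcongr
    · intro r hr
      have hr' := hsub (Ico_subset_Icc_self hr)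
      refine (hy' r hr').trans ?_
      gcongr
      obtain ⟨k, hk, hkn⟩ := hK r hr'
      have hz : |e r - k| ≤ C * n r ^ 2 + m * g * |P r| := by
        have : e r - k = (h r - k) - m * g * P r := by simp only [he]; ring
        rw [this]
        refine (abs_sub _ _).trans ?_
        rw [abs_mul, abs_of_nonneg hmg]
        linarith
      have h1 := le_energy_rate (hn r hr') hC (mul_nonneg hmg (abs_nonneg (P r))) hε hz
      have h2 : √(m * g * |P r|) ≤ √(m * g) * (2 / c * edgeRate (c / 2) A B r) := by
        rw [Real.sqrt_mul hmg]
        gcongr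
        exact sqrt_abs_edgePrimitive_le hc0 A B r
      -- The value `k` for which the Łojasiewicz bound holds may change with `r`; all terms of the
      -- sum over `K` are nonnegative, so the sum dominates each of them.
      have h3 : 1 / √(2 * (|e r - k| + ε)) * n r ^ 2 ≤ ∑ k ∈ K, dφ ε (e r - k) * -e' r := by
        have h4 := he'n r hr'
        refine le_trans ?_ (Finset.single_le_sum (f := fun k => dφ ε (e r - k) * -e' r)
          (fun i _ => mul_nonneg (hdφ0 _) ((sq_nonneg _).trans h4)) hk)
        have h5 : 1 / √(2 * (|e r - k| + ε)) ≤ dφ ε (e r - k) := inv_sqrt_le_deriv_smoothSqrt hε _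
        have := hdφ0 (e r - k)
        gcongr
      calc n r ≤ _ := h1
        _ ≤ 2 * √C * (∑ k ∈ K, dφ ε (e r - k) * -e' r) +
            (√(m * g) * (2 / c * edgeRate (c / 2) A B r) + √ε) / √C := by gcongr
        _ = _ := by ring
  -- For fixed `s` and `t` the only term depending on `ε` is proportional to `√ε (t - s)`, so
  -- letting `ε` tend to `0` removes the dependence on the duration.
  have hlim : Tendsto (fun ε => D * (2 * √C * (K.card * (2 * √(2 * (h s - h t + 2 * (m * g))))) +
      4 * √(m * g) / √C + √ε / √C * (t - s) + 2 * g)) (𝓝[>] 0)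
      (𝓝 (D * (2 * √C * (K.card * (2 * √(2 * (h s - h t + 2 * (m * g))))) +
      4 * √(m * g) / √C + √0 / √C * (t - s) + 2 * g))) := by
    refine (Continuous.tendsto ?_ 0).mono_left nhdsWithin_le_nhds
    fun_prop
  have := ge_of_tendsto hlim (eventually_nhdsWithin_of_forall fun ε hε => key ε hε)
  simpa using this

end EnergyLength

/-- On the compact set of pairs at distance at least `η`, the distance of the images has a positive
lower bound. This converts estimates in the embedding into estimates in `X`. -/
theorem exists_edist_lt_of_dist_lt {X Y : Type*} [EMetricSpace X] [CompactSpace X]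
    [MetricSpace Y] {e : X → Y} (he : Continuous e) (hinj : Function.Injective e)
    {η : ℝ≥0∞} (hη : 0 < η) : ∃ ρ > 0, ∀ x y, dist (e x) (e y) < ρ → edist x y < η := by
  have hclosed : IsClosed {p : X × X | η ≤ edist p.1 p.2} :=
    isClosed_le continuous_const (continuous_fst.edist continuous_snd)
  obtain ⟨ρ, hρ, h⟩ := hclosed.isCompact.exists_forall_le' (a := (0 : ℝ))
    (f := fun p : X × X => dist (e p.1) (e p.2))
    ((he.comp continuous_fst).dist (he.comp continuous_snd)).continuousOn (fun p hp => by
      refine dist_pos.2 fun h => ?_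
      have := hinj h
      have hp : η ≤ edist p.1 p.2 := hp
      rw [this, edist_self] at hp
      exact absurd hp (not_le.2 hη))
  refine ⟨ρ, hρ, fun x y hxy => ?_⟩
  by_contra hcon
  exact absurd (h (x, y) (not_lt.1 hcon)) (not_le.2 hxy)

namespace HamiltonianCircleData

/-! ### The gradient flow and approximate gradient lines -/

section Curves

variable {E X : Type*} [NormedAddCommGroup E] [NormedSpace ℝ E] [FiniteDimensional ℝ E]
  [EMetricSpace X] [CompactSpace X] [ChartedSpace E X] [IsManifold 𝓘(ℝ, E) ∞ X]
  [RiemannianBundle (fun x : X => TangentSpace 𝓘(ℝ, E) x)]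
  [MulAction Circle X] [ContMDiffSMul (𝓡 1) 𝓘(ℝ, E) ∞ Circle X] (M : HamiltonianCircleData E X)

theorem ξ_zero_and_isMIntegralCurve (x : X) :
    M.ξ 0 x = x ∧ IsMIntegralCurve (I := 𝓘(ℝ, E)) (fun t => M.ξ t x) M.V := by
  have : CompleteSpace E := FiniteDimensional.complete ℝ E
  exact Classical.epsilon_spec (exists_isMIntegralCurve_of_compactSpace M.contMDiff_V x)

theorem ξ_zero (x : X) : M.ξ 0 x = x := (M.ξ_zero_and_isMIntegralCurve x).1

theorem isMIntegralCurve_ξ (x : X) : IsMIntegralCurve (I := 𝓘(ℝ, E)) (fun t => M.ξ t x) M.V :=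
  (M.ξ_zero_and_isMIntegralCurve x).2

theorem ξ_ξ (s t : ℝ) (x : X) : M.ξ t (M.ξ s x) = M.ξ (t + s) x := by
  have : CompleteSpace E := FiniteDimensional.complete ℝ E
  have := isMIntegralCurve_Ioo_eq_of_contMDiff_boundaryless (t₀ := 0)
    (M.contMDiff_V.of_le (by norm_num))
    (M.isMIntegralCurve_ξ (M.ξ s x)) ((M.isMIntegralCurve_ξ x).comp_add s)
    (by simp [ξ_zero])
  exact congrFun this t

theorem continuous_ξ_left (x : X) : Continuous fun t => M.ξ t x :=
  continuous_iff_continuousAt.2 fun t => (M.isMIntegralCurve_ξ x t).continuousAt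

theorem ξ_of_mem_F {x : X} (hx : x ∈ M.F) (t : ℝ) : M.ξ t x = x := by
  have : CompleteSpace E := FiniteDimensional.complete ℝ E
  have hV : M.V x = 0 := (M.V_eq_zero_iff x).2 hx
  have := isMIntegralCurve_Ioo_eq_of_contMDiff_boundaryless (t₀ := 0) (γ' := fun _ => x)
    (M.contMDiff_V.of_le (by norm_num)) (M.isMIntegralCurve_ξ x) (isMIntegralCurve_const hV)
    (M.ξ_zero x)
  exact congrFun this t

theorem ξ_notMem_F {x : X} (hx : x ∉ M.F) (t : ℝ) : M.ξ t x ∉ M.F := fun h => by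
  have := M.ξ_of_mem_F h (-t)
  rw [ξ_ξ, neg_add_cancel, ξ_zero] at this
  exact hx (this ▸ h)

theorem hasDerivAt_H_ξ (x : X) (t : ℝ) :
    HasDerivAt (fun t => M.H (M.ξ t x)) (-‖M.V (M.ξ t x)‖ ^ 2) t := by
  have h := ((M.isMIntegralCurve_ξ x t).hasMFDerivWithinAt (s := univ)).hasDerivWithinAt_comp
    (M.contMDiff_H.mdifferentiableAt (by simp))
  rw [hasDerivWithinAt_univ] at h
  refine h.congr_deriv ?_
  rw [vderiv_H_apply, real_inner_self_eq_norm_sq]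

theorem strictAnti_H_ξ {x : X} (hx : x ∉ M.F) : StrictAnti fun t => M.H (M.ξ t x) := by
  refine strictAnti_of_hasDerivAt_neg (fun t => M.hasDerivAt_H_ξ x t) fun t => ?_
  have : 0 < ‖M.V (M.ξ t x)‖ := norm_pos_iff.2 fun h =>
    M.ξ_notMem_F hx t ((M.V_eq_zero_iff _).1 h)
  simpa using pow_pos this 2

/-- A curve on `[A, B]` which is a downward gradient line, up to an error concentrated near the
endpoints. -/
def IsApproxLine (f : ℝ → X) (A B g c : ℝ) : Prop :=
  ∀ t ∈ Icc A B, ∃ v : TangentSpace 𝓘(ℝ, E) (f t),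
    HasMFDerivWithinAt 𝓘(ℝ, ℝ) 𝓘(ℝ, E) f (Icc A B) t ((1 : ℝ →L[ℝ] ℝ).smulRight v) ∧
    ‖v - M.V (f t)‖ ≤ g * edgeRate c A B t

theorem isApproxLine_ξ (x : X) (t₀ A B c : ℝ) :
    M.IsApproxLine (fun t => M.ξ (t - t₀) x) A B 0 c := by
  intro t _
  have h := (M.isMIntegralCurve_ξ x).comp_add (-t₀) t
  exact ⟨M.V (M.ξ (t - t₀) x), h.hasMFDerivWithinAt, by simp⟩

variable {M} {f f₁ : ℝ → X} {A B g c : ℝ}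

theorem IsApproxLine.continuousOn (hf : M.IsApproxLine f A B g c) : ContinuousOn f (Icc A B) :=
  fun t ht => let ⟨_, h, _⟩ := hf t ht; h.continuousWithinAt

/-- Two approximate gradient lines which are close at one time stay close for bounded times. -/
theorem IsApproxLine.norm_sub_le {G : Type*} [NormedAddCommGroup G] [NormedSpace ℝ G] {e : X → G}
    {L C : ℝ} (he : ContMDiff 𝓘(ℝ, E) 𝓘(ℝ, G) ∞ e) (hL : 0 < L) (hC : 0 < C)
    (hLip : ∀ x y, ‖vderiv e x (M.V x) - vderiv e y (M.V y)‖ ≤ L * ‖e x - e y‖)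
    (hbd : ∀ (x : X) (v : TangentSpace 𝓘(ℝ, E) x), ‖vderiv e x v‖ ≤ C * ‖v‖)
    (hg : 0 ≤ g) (hc : 0 ≤ c) (hf : M.IsApproxLine f A B g c) (hf₁ : M.IsApproxLine f₁ A B 0 c)
    {t₀ t : ℝ} (ht₀ : t₀ ∈ Icc A B) (ht : t ∈ Icc A B) :
    ‖e (f t) - e (f₁ t)‖ ≤ (‖e (f t₀) - e (f₁ t₀)‖ + 2 * (C * g)) * Real.exp (L * |t - t₀|) := by
  choose! v hv hv' using hf
  choose! w hw hw' using hf₁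
  have hed : ∀ x, MDifferentiableAt 𝓘(ℝ, E) 𝓘(ℝ, G) e x := fun x =>
    he.mdifferentiableAt (by simp)
  set D : ℝ → G := fun t => e (f t) - e (f₁ t) with hD
  set D' : ℝ → G := fun t => vderiv e (f t) (v t) - vderiv e (f₁ t) (w t) with hD'
  have hDd : ∀ t ∈ Icc A B, HasDerivWithinAt D (D' t) (Icc A B) t := fun t ht =>
    ((hv t ht).hasDerivWithinAt_comp (hed _)).sub ((hw t ht).hasDerivWithinAt_comp (hed _))
  have hDle : ∀ t ∈ Icc A B, ‖D' t‖ ≤ L * ‖D t‖ + C * g * edgeRate c A B t := by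
    intro t ht
    have hw0 : w t = M.V (f₁ t) := by
      have := hw' t ht
      rw [zero_mul] at this
      exact sub_eq_zero.1 (norm_le_zero_iff.1 this)
    -- The first term is the error, of size at most `C g` times the kernel; the second is controlled
    -- by the Lipschitz bound for `V`.
    have e1 : D' t = vderiv e (f t) (v t - M.V (f t)) +
        (vderiv e (f t) (M.V (f t)) - vderiv e (f₁ t) (M.V (f₁ t))) := by
      simp only [hD', hw0, map_sub]; abel
    rw [e1]
    refine (norm_add_le _ _).trans ?_
    have h1 := (hbd (f t) (v t - M.V (f t))).trans
      (mul_le_mul_of_nonneg_left (hv' t ht) hC.le)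
    have h2 := hLip (f t) (f₁ t)
    linarith
  have hP : ∀ t, HasDerivAt (fun t => C * g * edgePrimitive c A B t) (C * g * edgeRate c A B t) t :=
    fun t => (hasDerivAt_edgePrimitive c A B t).const_mul _
  have hκ : ∀ t, 0 ≤ C * g * edgeRate c A B t := fun t => by
    have := edgeRate_nonneg hc A B t; positivity
  have hCg : 0 ≤ C * g := by positivity
  have hPd : ∀ s ∈ Icc A B, ∀ t ∈ Icc A B,
      C * g * edgePrimitive c A B t - C * g * edgePrimitive c A B s ≤ 2 * (C * g) := by
    intro s hs t ht
    have h1 := abs_le.1 (abs_edgePrimitive_le_one hc hs)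
    have h2 := abs_le.1 (abs_edgePrimitive_le_one hc ht)
    nlinarith
  rcases le_total t₀ t with h | h
  · have hsub : Icc t₀ t ⊆ Icc A B := Icc_subset_Icc ht₀.1 ht.2
    have := norm_le_gronwall_primitive h hL.le (fun s hs => (hDd s (hsub hs)).mono hsub) hP hκ
      (fun s hs => hDle s (hsub hs))
    rw [abs_of_nonneg (sub_nonneg.2 h)]
    refine this.trans ?_
    gcongr
    exact hPd t₀ ht₀ t ht
  · have hsub : Icc t t₀ ⊆ Icc A B := Icc_subset_Icc ht.1 ht₀.2
    have := norm_le_gronwall_primitive_backward h hL.le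
      (fun s hs => (hDd s (hsub hs)).mono hsub) hP hκ (fun s hs => hDle s (hsub hs))
    rw [abs_sub_comm, abs_of_nonneg (sub_nonneg.2 h)]
    refine this.trans ?_
    gcongr
    exact hPd t ht t₀ ht₀

variable [h : IsContMDiffRiemannianBundle 𝓘(ℝ, E) ∞ E (fun x : X => TangentSpace 𝓘(ℝ, E) x)]

variable (M) in
/-- Along approximate gradient lines `H` is almost decreasing, and it controls the length. -/
theorem exists_energy_estimate {G : Type*} [NormedAddCommGroup G] [NormedSpace ℝ G] {e : X → G}
    {D : ℝ} (he : ContMDiff 𝓘(ℝ, E) 𝓘(ℝ, G) ∞ e) (hD : 0 < D)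
    (hbd : ∀ (x : X) (v : TangentSpace 𝓘(ℝ, E) x), ‖vderiv e x v‖ ≤ D * ‖v‖) :
    ∃ C > 0, ∃ m > 0, ∀ ⦃f : ℝ → X⦄ ⦃A B g c : ℝ⦄, 0 ≤ g → 1 ≤ c → M.IsApproxLine f A B g c →
      ∀ s ∈ Icc A B, ∀ t ∈ Icc A B, s ≤ t → M.H (f t) ≤ M.H (f s) + m * g ∧
        ‖e (f t) - e (f s)‖ ≤ C * (√(M.H (f s) - M.H (f t) + m * g) + √g + g) ∧
        ‖e (f t) - e (f s)‖ ≤ C * ((t - s) + g) := by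
  obtain ⟨m, hm, hVm⟩ := M.exists_norm_V_le
  obtain ⟨K, -, C, hC, hK⟩ := M.exists_lojasiewicz
  have hsC : 0 < √C := Real.sqrt_pos.2 hC
  -- A single constant covering the coefficients of both distance estimates, for large energy drop
  -- and for short time.
  set C' := D * (2 * √C * (K.card * (2 * √2)) + 4 * √m / √C + 2 + m) with hC'
  have hC'0 : 0 < C' := by positivity
  refine ⟨C', hC'0, 2 * m, by positivity, ?_⟩
  intro f A B g c hg hc hf s hs t ht hst
  choose! v hv hv' using hf
  have hed : ∀ x, MDifferentiableAt 𝓘(ℝ, E) 𝓘(ℝ, G) e x := fun x =>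
    he.mdifferentiableAt (by simp)
  have hHd : ∀ x, MDifferentiableAt 𝓘(ℝ, E) 𝓘(ℝ, ℝ) M.H x := fun x =>
    M.contMDiff_H.mdifferentiableAt (by simp)
  have hy : ∀ t ∈ Icc A B, HasDerivWithinAt (fun t => e (f t)) (vderiv e (f t) (v t)) (Icc A B) t :=
    fun t ht => (hv t ht).hasDerivWithinAt_comp (hed _)
  have hh : ∀ t ∈ Icc A B, HasDerivWithinAt (fun t => M.H (f t)) (vderiv M.H (f t) (v t))
    (Icc A B) t := fun t ht => (hv t ht).hasDerivWithinAt_comp (hHd _)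
  have hy' : ∀ t ∈ Icc A B, ‖vderiv e (f t) (v t)‖ ≤ D * (‖M.V (f t)‖ + g * edgeRate c A B t) := by
    intro t ht
    refine (hbd _ _).trans ?_
    gcongr
    have h1 : v t = M.V (f t) + (v t - M.V (f t)) := by abel
    rw [h1]
    refine (norm_add_le _ _).trans ?_
    gcongr
    exact hv' t ht
  have hh' : ∀ t ∈ Icc A B, vderiv M.H (f t) (v t) ≤
      -‖M.V (f t)‖ ^ 2 + m * g * edgeRate c A B t := by
    intro t ht
    have h1 : v t = M.V (f t) + (v t - M.V (f t)) := by abel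
    rw [M.vderiv_H_apply, h1, inner_add_right, real_inner_self_eq_norm_sq]
    have h2 := (abs_le.1 (abs_real_inner_le_norm (M.V (f t)) (v t - M.V (f t)))).1
    have h3 : ‖M.V (f t)‖ * ‖v t - M.V (f t)‖ ≤ m * (g * edgeRate c A B t) :=
      mul_le_mul (hVm _) (hv' t ht) (norm_nonneg _) hm.le
    linarith
  have hc0 : 0 ≤ c := by linarith
  have hmg : 0 ≤ m * g := by positivity
  have hanti := sub_edgePrimitive_le_of_deriv_le (c := c) (m := m * g) hh (fun r hr => by
    have := hh' r hr; nlinarith [sq_nonneg ‖M.V (f r)‖]) hs ht hst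
  have hPs := abs_le.1 (abs_edgePrimitive_le_one hc0 hs)
  have hPt := abs_le.1 (abs_edgePrimitive_le_one hc0 ht)
  refine ⟨by simp only at hanti; nlinarith, ?_, ?_⟩
  · have := norm_sub_le_sqrt_energy hc hg hC hD.le hm.le hy hh (fun t _ => norm_nonneg _) hy' hh'
      (fun t _ => hK (f t)) hs ht hst
    refine this.trans ?_
    rw [← mul_assoc 2 m g, Real.sqrt_mul (by norm_num : (0 : ℝ) ≤ 2), Real.sqrt_mul hm.le]
    set S := √(M.H (f s) - M.H (f t) + 2 * m * g)
    have hS : 0 ≤ S := Real.sqrt_nonneg _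
    have hsg : 0 ≤ √g := Real.sqrt_nonneg _
    rw [hC', mul_assoc D]
    refine mul_le_mul_of_nonneg_left ?_ hD.le
    have a1 : 0 ≤ 2 * √C * (K.card * (2 * √2)) := by positivity
    have a2 : 0 ≤ 4 * √m / √C := by positivity
    have e1 : 2 * √C * (K.card * (2 * (√2 * S))) + 4 * (√m * √g) / √C + 2 * g =
      2 * √C * (K.card * (2 * √2)) * S + 4 * √m / √C * √g + 2 * g := by ring
    rw [e1]
    set a := 2 * √C * (K.card * (2 * √2))
    set b := 4 * √m / √C
    have := mul_nonneg a1 hsg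
    have := mul_nonneg a1 hg
    have := mul_nonneg a2 hS
    have := mul_nonneg a2 hg
    have := mul_nonneg hm.le hS
    have := mul_nonneg hm.le hsg
    nlinarith
  · have hsub : Icc s t ⊆ Icc A B := Icc_subset_Icc hs.1 ht.2
    have main := image_norm_le_of_norm_deriv_right_le_deriv_boundary (a := s) (b := t)
      (f := fun r => e (f r) - e (f s)) (f' := fun r => vderiv e (f r) (v r))
      (B := fun r => D * (m * (r - s) + g * (edgePrimitive c A B r - edgePrimitive c A B s)))
      (B' := fun r => D * (m * 1 + g * edgeRate c A B r))
      (fun r hr => (((hy r (hsub hr)).mono hsub).sub_const _).continuousWithinAt)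
      (fun r hr => (((hy r (hsub (Ico_subset_Icc_self hr))).mono hsub).Ici_of_mem_Ico hr).sub_const
        _) (by simp)
      (fun r => ((((hasDerivAt_id r).sub_const s).const_mul m).add
        (((hasDerivAt_edgePrimitive c A B r).sub_const _).const_mul g)).const_mul D)
      (fun r hr => by
        refine (hy' r (hsub (Ico_subset_Icc_self hr))).trans ?_
        rw [mul_one]
        gcongr
        exact hVm _) (right_mem_Icc.2 hst)
    refine main.trans ?_
    rw [hC', mul_assoc D]
    refine mul_le_mul_of_nonneg_left ?_ hD.le
    have a1 : 0 ≤ 2 * √C * (K.card * (2 * √2)) := by positivity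
    have a2 : 0 ≤ 4 * √m / √C := by positivity
    set a := 2 * √C * (K.card * (2 * √2))
    set b := 4 * √m / √C
    have hts : 0 ≤ t - s := by linarith
    have := mul_nonneg a1 hts
    have := mul_nonneg a1 hg
    have := mul_nonneg a2 hts
    have := mul_nonneg a2 hg
    have : g * (edgePrimitive c A B t - edgePrimitive c A B s) ≤ g * 2 := by gcongr; linarith
    nlinarith

end Curves

end HamiltonianCircleData

namespace HamiltonianCircleData

/-! ### Asymptotic gradient lines and limits of flow lines -/

section AsymptoticLines

variable {E X : Type*} [NormedAddCommGroup E] [NormedSpace ℝ E] [FiniteDimensional ℝ E]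
  [EMetricSpace X] [CompactSpace X] [ChartedSpace E X] [IsManifold 𝓘(ℝ, E) ∞ X]
  [RiemannianBundle (fun x : X => TangentSpace 𝓘(ℝ, E) x)]
  [MulAction Circle X] (M : HamiltonianCircleData E X)

/-- A sequence of curves `f u` on `[A u, B u]` which asymptotically behave like downward gradient
lines: they follow the flow for bounded times, `H` is almost decreasing along them, and a part of
the curve along which `H` drops by a small amount is small. -/
structure IsAsymptoticLine (f : ℕ → ℝ → X) (A B : ℕ → ℝ) : Prop where
  le : ∀ u, A u ≤ B u
  continuousOn : ∀ u, ContinuousOn (f u) (Icc (A u) (B u))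
  flow : ∀ (R : ℝ) (η : ℝ≥0∞), 0 < η → ∀ᶠ u in atTop, ∀ s ∈ Icc (A u) (B u),
    ∀ t ∈ Icc (A u) (B u), |t - s| ≤ R → edist (M.ξ (t - s) (f u s)) (f u t) < η
  almost_antitone : ∀ η > 0, ∀ᶠ u in atTop, ∀ s ∈ Icc (A u) (B u), ∀ t ∈ Icc (A u) (B u), s ≤ t →
    M.H (f u t) < M.H (f u s) + η
  length : ∀ η : ℝ≥0∞, 0 < η → ∃ ρ > 0, ∀ᶠ u in atTop, ∀ s ∈ Icc (A u) (B u),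
    ∀ t ∈ Icc (A u) (B u), s ≤ t → M.H (f u s) - M.H (f u t) < ρ → edist (f u s) (f u t) < η

theorem IsAsymptoticLine.comp {M : HamiltonianCircleData E X} {f : ℕ → ℝ → X} {A B : ℕ → ℝ}
    (hf : M.IsAsymptoticLine f A B) {φ : ℕ → ℕ} (hφ : StrictMono φ) :
    M.IsAsymptoticLine (fun u => f (φ u)) (fun u => A (φ u)) (fun u => B (φ u)) where
  le _ := hf.le _
  continuousOn _ := hf.continuousOn _
  flow R η hη := hφ.tendsto_atTop.eventually (hf.flow R η hη)
  almost_antitone η hη := hφ.tendsto_atTop.eventually (hf.almost_antitone η hη)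
  length η hη := let ⟨ρ, hρ, h⟩ := hf.length η hη
    ⟨ρ, hρ, hφ.tendsto_atTop.eventually h⟩

variable [ContMDiffSMul (𝓡 1) 𝓘(ℝ, E) ∞ Circle X]
  [h : IsContMDiffRiemannianBundle 𝓘(ℝ, E) ∞ E (fun x : X => TangentSpace 𝓘(ℝ, E) x)]

/-- Grönwall over times at most `R` loses only the fixed factor `exp(L R)`, and the error masses
tend to `0`. The other two properties come from the energy estimate. -/
theorem isAsymptoticLine_of_isApproxLine {f : ℕ → ℝ → X} {A B g c : ℕ → ℝ}
    (hAB : ∀ u, A u ≤ B u) (hf : ∀ u, M.IsApproxLine (f u) (A u) (B u) (g u) (c u))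
    (hg : ∀ u, 0 ≤ g u) (hg0 : Tendsto g atTop (𝓝 0)) (hc : ∀ᶠ u in atTop, 1 ≤ c u) :
    M.IsAsymptoticLine f A B := by
  obtain ⟨n, e, L, C, he, hinj, hL, hC, hLip, hbd⟩ := M.exists_embedding
  obtain ⟨D, hD, m, hm, hen⟩ := M.exists_energy_estimate he hC hbd
  refine ⟨hAB, fun u => (hf u).continuousOn, fun R η hη => ?_, fun η hη => ?_, fun η hη => ?_⟩
  · obtain ⟨ρ, hρ, hρη⟩ := exists_edist_lt_of_dist_lt he.continuous hinj hη
    have hlim : Tendsto (fun u => 2 * (C * g u) * Real.exp (L * R)) atTop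
        (𝓝 (2 * (C * 0) * Real.exp (L * R))) := by
      refine Tendsto.mul_const _ (Tendsto.const_mul _ (Tendsto.const_mul _ hg0))
    rw [mul_zero, mul_zero, zero_mul] at hlim
    filter_upwards [hc, hlim.eventually (gt_mem_nhds hρ)] with u hcu hu s hs t ht hst
    rw [edist_comm]
    refine hρη _ _ ?_
    have := IsApproxLine.norm_sub_le he hL hC hLip hbd (hg u) (by linarith) (hf u)
      (M.isApproxLine_ξ (f u s) s (A u) (B u) (c u)) hs ht
    rw [sub_self, M.ξ_zero, sub_self, norm_zero, zero_add] at this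
    rw [dist_eq_norm]
    refine (this.trans ?_).trans_lt hu
    have := hg u
    gcongr
  · have hlim : Tendsto (fun u => m * g u) atTop (𝓝 (m * 0)) := hg0.const_mul _
    rw [mul_zero] at hlim
    filter_upwards [hc, hlim.eventually (gt_mem_nhds hη)] with u hcu hu s hs t ht hst
    have := (hen (hg u) hcu (hf u) s hs t ht hst).1
    linarith
  · obtain ⟨ρ, hρ, hρη⟩ := exists_edist_lt_of_dist_lt he.continuous hinj hη
    have hlim : Tendsto (fun p : ℝ × ℝ => D * (√(p.1 + m * p.2) + √p.2 + p.2)) (𝓝 (0, 0))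
        (𝓝 (D * (√(0 + m * 0) + √0 + 0))) := by
      have : Continuous (fun p : ℝ × ℝ => D * (√(p.1 + m * p.2) + √p.2 + p.2)) := by fun_prop
      exact this.tendsto (0, 0)
    simp only [mul_zero, add_zero, Real.sqrt_zero] at hlim
    have hev := hlim.eventually (gt_mem_nhds hρ)
    rw [nhds_prod_eq] at hev
    obtain ⟨p, hp, q, hq, hpq⟩ := eventually_prod_iff.1 hev
    obtain ⟨r, hr, hr'⟩ := Metric.eventually_nhds_iff.1 hp
    refine ⟨r / 2, by positivity, ?_⟩
    filter_upwards [hc, hg0.eventually hq] with u hcu hu s hs t ht hst hlt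
    rw [edist_comm]
    refine hρη _ _ ?_
    rw [dist_eq_norm]
    refine (hen (hg u) hcu (hf u) s hs t ht hst).2.1.trans_lt (lt_of_le_of_lt ?_
      (hpq (x := r / 2) (hr' (by rw [Real.dist_eq, sub_zero, abs_of_pos] <;> linarith)) hu))
    gcongr

/-- The flow depends continuously on the initial point, uniformly for bounded times. -/
theorem exists_edist_ξ_lt (R : ℝ) {η : ℝ≥0∞} (hη : 0 < η) (x : X) :
    ∀ᶠ y in 𝓝 x, ∀ t, |t| ≤ R → edist (M.ξ t y) (M.ξ t x) < η := by
  obtain ⟨n, e, L, C, he, hinj, hL, hC, hLip, hbd⟩ := M.exists_embedding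
  obtain ⟨ρ, hρ, hρη⟩ := exists_edist_lt_of_dist_lt he.continuous hinj hη
  have hlim : Tendsto (fun y => ‖e y - e x‖ * Real.exp (L * R)) (𝓝 x)
      (𝓝 (‖e x - e x‖ * Real.exp (L * R))) := by
    have h1 := he.continuous
    have : Continuous (fun y => ‖e y - e x‖ * Real.exp (L * R)) := by fun_prop
    exact this.tendsto x
  rw [sub_self, norm_zero, zero_mul] at hlim
  filter_upwards [hlim.eventually (gt_mem_nhds hρ)] with y hy t ht
  refine hρη _ _ ?_
  have h1 := M.isApproxLine_ξ y 0 (-R) R 0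
  have h2 := M.isApproxLine_ξ x 0 (-R) R 0
  have hR := (abs_nonneg t).trans ht
  have := IsApproxLine.norm_sub_le he hL hC hLip hbd le_rfl le_rfl h1 h2
    (t₀ := 0) (t := t) ⟨by linarith, hR⟩ (abs_le.1 ht)
  simp only [sub_zero, M.ξ_zero, mul_zero, add_zero] at this
  rw [dist_eq_norm]
  refine (this.trans ?_).trans_lt hy
  gcongr

theorem continuous_ξ_right (t : ℝ) : Continuous (M.ξ t) := by
  refine continuous_iff_continuousAt.2 fun x => EMetric.tendsto_nhds.2 fun η hη => ?_
  filter_upwards [M.exists_edist_ξ_lt |t| hη x] with y hy using hy t le_rfl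

/-- `H` strictly decreases along the flow line of a non-fixed point. -/
theorem mem_F_of_ξ_eq {p : X} (hp : M.ξ 1 p = p) : p ∈ M.F := by
  by_contra h
  have := M.strictAnti_H_ξ h (show (0 : ℝ) < 1 by norm_num)
  simp only [hp, M.ξ_zero, lt_self_iff_false] at this

/-- Apply the length property to one exact flow line, restricted to the growing intervals `[-u, u]`;
the resulting `ρ` is valid for all times. -/
theorem exists_edist_ξ_lt_of_H_sub_lt (x : X) {η : ℝ≥0∞} (hη : 0 < η) :
    ∃ ρ > 0, ∀ s t, s ≤ t → M.H (M.ξ s x) - M.H (M.ξ t x) < ρ →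
      edist (M.ξ s x) (M.ξ t x) < η := by
  have hf := M.isAsymptoticLine_of_isApproxLine (f := fun _ t => M.ξ t x) (A := fun u => -(u : ℝ))
    (B := fun u => u) (g := fun _ => 0) (c := fun _ => 1)
    (fun u => (neg_nonpos.2 u.cast_nonneg).trans u.cast_nonneg)
    (fun u => by simpa using M.isApproxLine_ξ x 0 (-(u : ℝ)) u 1) (fun _ => le_rfl)
    tendsto_const_nhds (Eventually.of_forall fun _ => le_rfl)
  obtain ⟨ρ, hρ, h⟩ := hf.length η hη
  refine ⟨ρ, hρ, fun s t hst hlt => ?_⟩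
  have h1 : ∀ᶠ u : ℕ in atTop, max |s| |t| ≤ u := tendsto_natCast_atTop_atTop.eventually_ge_atTop _
  obtain ⟨u, hu, hu'⟩ := (h.and h1).exists
  exact hu s (abs_le.1 ((le_max_left _ _).trans hu')) t (abs_le.1 ((le_max_right _ _).trans hu'))
    hst hlt

theorem antitone_H_ξ (x : X) : Antitone fun t => M.H (M.ξ t x) :=
  antitone_of_hasDerivAt_nonpos (fun t => M.hasDerivAt_H_ξ x t) fun t => by
    simp

theorem isBounded_range_H : ∃ m, ∀ x, |M.H x| ≤ m := by
  obtain ⟨m, hm⟩ := isCompact_univ.exists_bound_of_continuousOn (M.continuous_H).continuousOn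
  exact ⟨m, fun x => hm x (mem_univ x)⟩

/-- `H` is monotone and bounded along the line, hence Cauchy, and the length estimate makes the line
itself Cauchy. The limit is invariant under the flow, so it is fixed. -/
theorem exists_tendsto_ξ_atTop (x : X) : ∃ p ∈ M.F, Tendsto (fun t => M.ξ t x) atTop (𝓝 p) := by
  obtain ⟨m, hm⟩ := M.isBounded_range_H
  have hH : CauchySeq fun t => M.H (M.ξ t x) :=
    (tendsto_atTop_ciInf (M.antitone_H_ξ x)
      ⟨-m, by rintro _ ⟨t, rfl⟩; exact (abs_le.1 (hm _)).1⟩).cauchySeq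
  have hc : CauchySeq fun t => M.ξ t x := by
    refine EMetric.cauchySeq_iff.2 fun η hη => ?_
    obtain ⟨ρ, hρ, h⟩ := M.exists_edist_ξ_lt_of_H_sub_lt x hη
    obtain ⟨N, hN⟩ := Metric.cauchySeq_iff.1 hH ρ hρ
    have key : ∀ s ≥ N, ∀ t ≥ N, s ≤ t → edist (M.ξ s x) (M.ξ t x) < η := fun s hs t ht hst =>
      h s t hst ((le_abs_self _).trans_lt (hN s hs t ht))
    refine ⟨N, fun s hs t ht => ?_⟩
    rcases le_total s t with hst | hst
    · exact key s hs t ht hst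
    · rw [edist_comm]; exact key t ht s hs hst
  obtain ⟨p, hp⟩ := cauchySeq_tendsto_of_complete hc
  refine ⟨p, M.mem_F_of_ξ_eq ?_, hp⟩
  have h1 := ((M.continuous_ξ_right 1).tendsto p).comp hp
  have h2 := hp.comp (tendsto_atTop_add_const_left atTop (1 : ℝ) tendsto_id)
  refine tendsto_nhds_unique h1 (h2.congr fun t => ?_)
  simp [ξ_ξ]

theorem exists_tendsto_ξ_atBot (x : X) : ∃ p ∈ M.F, Tendsto (fun t => M.ξ t x) atBot (𝓝 p) := by
  obtain ⟨m, hm⟩ := M.isBounded_range_H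
  have hmono : Monotone fun t => M.H (M.ξ (-t) x) := fun s t hst =>
    M.antitone_H_ξ x (neg_le_neg hst)
  have hH : CauchySeq fun t => M.H (M.ξ (-t) x) :=
    (tendsto_atTop_ciSup hmono ⟨m, by rintro _ ⟨t, rfl⟩; exact (abs_le.1 (hm _)).2⟩).cauchySeq
  have hc : CauchySeq fun t => M.ξ (-t) x := by
    refine EMetric.cauchySeq_iff.2 fun η hη => ?_
    obtain ⟨ρ, hρ, h⟩ := M.exists_edist_ξ_lt_of_H_sub_lt x hη
    obtain ⟨N, hN⟩ := Metric.cauchySeq_iff.1 hH ρ hρ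
    have key : ∀ s ≥ N, ∀ t ≥ N, s ≤ t → edist (M.ξ (-t) x) (M.ξ (-s) x) < η :=
      fun s hs t ht hst =>
        h (-t) (-s) (neg_le_neg hst) ((le_abs_self _).trans_lt (hN t ht s hs))
    refine ⟨N, fun s hs t ht => ?_⟩
    rcases le_total s t with hst | hst
    · rw [edist_comm]; exact key s hs t ht hst
    · exact key t ht s hs hst
  obtain ⟨p, hp⟩ := cauchySeq_tendsto_of_complete hc
  have hp' : Tendsto (fun t => M.ξ t x) atBot (𝓝 p) := by
    refine (hp.comp tendsto_neg_atBot_atTop).congr fun t => ?_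
    simp
  refine ⟨p, M.mem_F_of_ξ_eq ?_, hp'⟩
  have h1 := ((M.continuous_ξ_right 1).tendsto p).comp hp'
  have h2 := hp'.comp (tendsto_atBot_add_const_left atBot (1 : ℝ) tendsto_id)
  refine tendsto_nhds_unique h1 (h2.congr fun t => ?_)
  simp [ξ_ξ]

end AsymptoticLines

end HamiltonianCircleData

/-- By the intermediate value theorem `[h t, h s]` is covered by the balls of radius `ρ` around `K`;
compare Lebesgue measures. -/
theorem sub_le_of_forall_mem_exists_abs_sub_lt {h : ℝ → ℝ} {s t ρ : ℝ} {K : Finset ℝ} (hst : s ≤ t)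
    (hρ : 0 ≤ ρ) (hc : ContinuousOn h (Icc s t)) (hK : ∀ r ∈ Icc s t, ∃ k ∈ K, |h r - k| < ρ) :
    h s - h t ≤ K.card * (2 * ρ) := by
  have hsub : Icc (h t) (h s) ⊆ ⋃ k ∈ K, Metric.ball k ρ := by
    intro y hy
    obtain ⟨r, hr, rfl⟩ := intermediate_value_Icc' hst hc hy
    obtain ⟨k, hk, hlt⟩ := hK r hr
    exact mem_iUnion₂.2 ⟨k, hk, hlt⟩
  have h1 := (MeasureTheory.measure_mono (μ := MeasureTheory.volume) hsub).trans
    (MeasureTheory.measure_biUnion_finset_le K _)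
  simp only [Real.volume_Icc, Real.volume_ball, Finset.sum_const, nsmul_eq_mul] at h1
  rw [← ENNReal.ofReal_natCast, ← ENNReal.ofReal_mul (Nat.cast_nonneg _)] at h1
  exact (ENNReal.ofReal_le_ofReal_iff (by positivity)).1 h1

namespace HamiltonianCircleData

/-! ### Marked times and gaps -/

section Marking

variable {E X : Type*} [NormedAddCommGroup E] [NormedSpace ℝ E] [FiniteDimensional ℝ E]
  [EMetricSpace X] [CompactSpace X] [ChartedSpace E X] [IsManifold 𝓘(ℝ, E) ∞ X]
  [RiemannianBundle (fun x : X => TangentSpace 𝓘(ℝ, E) x)]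
  [MulAction Circle X] (M : HamiltonianCircleData E X)

/-- Times `s u 0 ≪ ⋯ ≪ s u (k - 1)` in `[A u, B u]`, moving infinitely far apart, at which the
curves `f u` converge to points `x 0, …, x (k - 1)` which are not fixed. -/
structure IsMarking (f : ℕ → ℝ → X) (A B : ℕ → ℝ) (k : ℕ) (s : ℕ → ℕ → ℝ) (x : ℕ → X) : Prop where
  mem : ∀ u, ∀ j < k, s u j ∈ Icc (A u) (B u)
  tendsto : ∀ j < k, Tendsto (fun u => f u (s u j)) atTop (𝓝 (x j))
  not_fixed : ∀ j < k, x j ∉ M.F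
  separated : ∀ i j, i < j → j < k → Tendsto (fun u => s u j - s u i) atTop atTop

/-- The part of `[A, B]` between `s (g - 1) + R` and `s g - R`. -/
def gapSet (A B : ℝ) (k : ℕ) (s : ℕ → ℝ) (g : ℕ) (R : ℝ) : Set ℝ :=
  {t | t ∈ Icc A B ∧ (0 < g → s (g - 1) + R ≤ t) ∧ (g < k → t + R ≤ s g)}

theorem ordConnected_gapSet (A B : ℝ) (k : ℕ) (s : ℕ → ℝ) (g : ℕ) (R : ℝ) :
    (gapSet A B k s g R).OrdConnected := by
  refine ⟨fun a ha b hb t ht => ⟨⟨ha.1.1.trans ht.1, ht.2.trans hb.1.2⟩, fun h => ?_, fun h => ?_⟩⟩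
  · exact (ha.2.1 h).trans ht.1
  · have := hb.2.2 h
    linarith [ht.2]

theorem gapSet_anti {A B : ℝ} {k : ℕ} {s : ℕ → ℝ} {g : ℕ} {R R' : ℝ} (h : R ≤ R') :
    gapSet A B k s g R' ⊆ gapSet A B k s g R := fun t ht =>
  ⟨ht.1, fun hg => by linarith [ht.2.1 hg], fun hg => by linarith [ht.2.2 hg]⟩

variable {M} {f : ℕ → ℝ → X} {A B : ℕ → ℝ} {k : ℕ} {s : ℕ → ℕ → ℝ} {x : ℕ → X}

theorem IsMarking.comp (hs : M.IsMarking f A B k s x) {φ : ℕ → ℕ} (hφ : StrictMono φ) :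
    M.IsMarking (fun u => f (φ u)) (fun u => A (φ u)) (fun u => B (φ u)) k (fun u => s (φ u)) x where
  mem _ := hs.mem _
  tendsto j hj := (hs.tendsto j hj).comp hφ.tendsto_atTop
  not_fixed := hs.not_fixed
  separated i j hi hj := (hs.separated i j hi hj).comp hφ.tendsto_atTop

theorem IsMarking.eventually_add_le (hs : M.IsMarking f A B k s x) (R : ℝ) :
    ∀ᶠ u in atTop, ∀ i j, i < j → j < k → s u i + R ≤ s u j := by
  have : ∀ᶠ u in atTop, ∀ j ∈ Finset.range k, ∀ i ∈ Finset.range j, s u i + R ≤ s u j := by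
    refine (Finset.eventually_all _).2 fun j hj => (Finset.eventually_all _).2 fun i hi => ?_
    filter_upwards [(hs.separated i j (Finset.mem_range.1 hi)
      (Finset.mem_range.1 hj)).eventually_ge_atTop R] with u hu
    linarith
  filter_upwards [this] with u hu i j hi hj
  exact hu j (Finset.mem_range.2 hj) i (Finset.mem_range.2 hi)

/-- A new time far from the old ones can be added to a marking. -/
theorem IsMarking.insert (hs : M.IsMarking f A B k s x) {g : ℕ} (hg : g ≤ k) {t : ℕ → ℝ} {y : X}
    (ht : ∀ u : ℕ, t u ∈ gapSet (A u) (B u) k (s u) g u) (hy : y ∉ M.F)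
    (hlim : Tendsto (fun u => f u (t u)) atTop (𝓝 y)) :
    M.IsMarking f A B (k + 1)
      (fun u j => if j < g then s u j else if j = g then t u else s u (j - 1))
      (fun j => if j < g then x j else if j = g then y else x (j - 1)) := by
  have h0 := hs.eventually_add_le 0
  have hleft : ∀ i < g, Tendsto (fun u => t u - s u i) atTop atTop := by
    intro i hi
    refine tendsto_atTop_mono' _ ?_ tendsto_natCast_atTop_atTop
    filter_upwards [h0] with u hu
    have h1 := (ht u).2.1 (by omega)
    rcases (show i ≤ g - 1 by omega).eq_or_lt with rfl | h
    · linarith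
    · have := hu i (g - 1) h (by omega)
      linarith
  have hright : ∀ j, g ≤ j → j < k → Tendsto (fun u => s u j - t u) atTop atTop := by
    intro j hgj hj
    refine tendsto_atTop_mono' _ ?_ tendsto_natCast_atTop_atTop
    filter_upwards [h0] with u hu
    have h1 := (ht u).2.2 (by omega)
    rcases hgj.eq_or_lt with rfl | h
    · linarith
    · have := hu g j h hj
      linarith
  refine ⟨fun u j hj => ?_, fun j hj => ?_, fun j hj => ?_, fun i j hij hj => ?_⟩
  · split_ifs with h1 h2
    · exact hs.mem u j (by omega)
    · exact (ht u).1
    · exact hs.mem u (j - 1) (by omega)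
  · split_ifs with h1 h2
    · exact hs.tendsto j (by omega)
    · exact hlim
    · exact hs.tendsto (j - 1) (by omega)
  · split_ifs with h1 h2
    · exact hs.not_fixed j (by omega)
    · exact hy
    · exact hs.not_fixed (j - 1) (by omega)
  · rcases lt_trichotomy j g with h1 | rfl | h1
    · simp only [h1, hij.trans h1, if_true]
      exact hs.separated i j hij (by omega)
    · simp only [hij, lt_irrefl, if_true, if_false]
      exact hleft i hij
    · simp only [h1.not_gt, h1.ne', if_false]
      rcases lt_trichotomy i g with h2 | rfl | h2
      · simp only [h2, if_true]
        exact hs.separated i (j - 1) (by omega) (by omega)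
      · simp only [lt_irrefl, if_true, if_false]
        exact hright (j - 1) (by omega) (by omega)
      · simp only [h2.not_gt, h2.ne', if_false]
        exact hs.separated (i - 1) (j - 1) (by omega) (by omega)

/-- If a marking cannot be enlarged, the curves are close to fixed points between the marked
times. -/
theorem IsMarking.exists_eventually_infEDist_lt (hs : M.IsMarking f A B k s x)
    (hmax : ∀ φ : ℕ → ℕ, StrictMono φ → ∀ s' x', ¬ M.IsMarking (fun u => f (φ u))
      (fun u => A (φ u)) (fun u => B (φ u)) (k + 1) s' x')
    {g : ℕ} (hg : g ≤ k) {η : ℝ≥0∞} (hη : 0 < η) :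
    ∃ R, ∀ᶠ u in atTop, ∀ t ∈ gapSet (A u) (B u) k (s u) g R, Metric.infEDist (f u t) M.F < η := by
  by_contra! hcon
  -- The `n`-th chosen time keeps distance at least `n` from the adjacent marks. A limit point of
  -- the curves there would be a further non-fixed marked point.
  obtain ⟨φ, hφ, hφ'⟩ := extraction_forall_of_frequently (fun n : ℕ => hcon n)
  choose t ht hfar using hφ'
  obtain ⟨y, -, ψ, hψ, hlim⟩ := isCompact_univ.tendsto_subseq
    (x := fun n => f (φ n) (t n)) (fun n => mem_univ _)
  have hy : y ∉ M.F := fun hyF => by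
    have h1 : Tendsto (fun n => Metric.infEDist (f (φ (ψ n)) (t (ψ n))) M.F) atTop
        (𝓝 (Metric.infEDist y M.F)) := (Metric.continuous_infEDist.tendsto y).comp hlim
    have h2 := ge_of_tendsto' h1 fun n => hfar (ψ n)
    rw [Metric.infEDist_zero_of_mem hyF] at h2
    exact absurd h2 (not_le.2 hη)
  refine hmax (φ ∘ ψ) (hφ.comp hψ) _ _ ((hs.comp (hφ.comp hψ)).insert hg (t := fun n => t (ψ n))
    (fun n => ?_) hy hlim)
  refine gapSet_anti ?_ (ht (ψ n))
  exact_mod_cast hψ.id_le n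

variable [ContMDiffSMul (𝓡 1) 𝓘(ℝ, E) ∞ Circle X]
  [h : IsContMDiffRiemannianBundle 𝓘(ℝ, E) ∞ E (fun x : X => TangentSpace 𝓘(ℝ, E) x)]

variable (M) in
/-- The limit of the gradient line through `x` in positive time. -/
noncomputable def limTop (x : X) : X := (M.exists_tendsto_ξ_atTop x).choose

variable (M) in
/-- The limit of the gradient line through `x` in negative time. -/
noncomputable def limBot (x : X) : X := (M.exists_tendsto_ξ_atBot x).choose

variable (M) in
theorem limTop_mem_F (x : X) : M.limTop x ∈ M.F := (M.exists_tendsto_ξ_atTop x).choose_spec.1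

variable (M) in
theorem limBot_mem_F (x : X) : M.limBot x ∈ M.F := (M.exists_tendsto_ξ_atBot x).choose_spec.1

variable (M) in
theorem tendsto_limTop (x : X) : Tendsto (fun t => M.ξ t x) atTop (𝓝 (M.limTop x)) :=
  (M.exists_tendsto_ξ_atTop x).choose_spec.2

variable (M) in
theorem tendsto_limBot (x : X) : Tendsto (fun t => M.ξ t x) atBot (𝓝 (M.limBot x)) :=
  (M.exists_tendsto_ξ_atBot x).choose_spec.2

variable (M) in
theorem H_limTop_lt_H_limBot {x : X} (hx : x ∉ M.F) : M.H (M.limTop x) < M.H (M.limBot x) := by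
  have h1 := ge_of_tendsto ((M.continuous_H.tendsto _).comp (M.tendsto_limBot x))
    ((eventually_le_atBot 0).mono fun t ht => M.antitone_H_ξ x ht)
  have h2 := le_of_tendsto ((M.continuous_H.tendsto _).comp (M.tendsto_limTop x))
    ((eventually_ge_atTop 1).mono fun t ht => M.antitone_H_ξ x ht)
  have h3 := M.strictAnti_H_ξ hx (zero_lt_one (α := ℝ))
  exact h2.trans_lt (h3.trans_le h1)

/-- Near a marked time the curves converge to the gradient line, uniformly for bounded times. -/
theorem IsMarking.eventually_edist_lt (hs : M.IsMarking f A B k s x)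
    (hf : M.IsAsymptoticLine f A B) {j : ℕ} (hj : j < k) (R : ℝ) {η : ℝ≥0∞} (hη : 0 < η) :
    ∀ᶠ u in atTop, ∀ τ, |τ| ≤ R → s u j + τ ∈ Icc (A u) (B u) →
      edist (f u (s u j + τ)) (M.ξ τ (x j)) < η := by
  have hη2 : 0 < η / 2 := ENNReal.half_pos hη.ne'
  filter_upwards [hf.flow R _ hη2, (hs.tendsto j hj).eventually (M.exists_edist_ξ_lt R hη2 (x j))]
    with u h1 h2 τ hτ hmem
  have h3 := h1 (s u j) (hs.mem u j hj) _ hmem (by simpa using hτ)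
  have h4 := h2 τ hτ
  rw [add_sub_cancel_left, edist_comm] at h3
  calc edist (f u (s u j + τ)) (M.ξ τ (x j)) ≤ _ := edist_triangle _ (M.ξ τ (f u (s u j))) _
    _ < η / 2 + η / 2 := ENNReal.add_lt_add h3 h4
    _ = η := ENNReal.add_halves η

theorem IsMarking.tendsto_add (hs : M.IsMarking f A B k s x)
    (hf : M.IsAsymptoticLine f A B) {j : ℕ} (hj : j < k) {τ : ℝ}
    (h : ∀ᶠ u in atTop, s u j + τ ∈ Icc (A u) (B u)) :
    Tendsto (fun u => f u (s u j + τ)) atTop (𝓝 (M.ξ τ (x j))) := by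
  refine EMetric.tendsto_nhds.2 fun η hη => ?_
  filter_upwards [h, hs.eventually_edist_lt hf hj |τ| hη] with u h1 h2 using h2 τ le_rfl h1

theorem IsMarking.eventually_add_mem (hs : M.IsMarking f A B k s x) {i j : ℕ} (hij : i < j)
    (hj : j < k) {τ : ℝ} (hτ : 0 ≤ τ) : ∀ᶠ u in atTop, s u i + τ ∈ Icc (A u) (B u) := by
  filter_upwards [hs.eventually_add_le τ] with u hu
  exact ⟨by linarith [(hs.mem u i (hij.trans hj)).1], (hu i j hij hj).trans (hs.mem u j hj).2⟩

theorem IsMarking.eventually_sub_mem (hs : M.IsMarking f A B k s x) {i j : ℕ} (hij : i < j)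
    (hj : j < k) {τ : ℝ} (hτ : 0 ≤ τ) : ∀ᶠ u in atTop, s u j + -τ ∈ Icc (A u) (B u) := by
  filter_upwards [hs.eventually_add_le τ] with u hu
  have := hu i j hij hj
  exact ⟨by linarith [(hs.mem u i (hij.trans hj)).1], by linarith [(hs.mem u j hj).2]⟩

/-- Eventually `s_i + τ ≤ s_j - τ`, so almost monotonicity of `H` compares the two lines at times
`τ` and `-τ`; then `τ` tends to infinity. -/
theorem IsMarking.H_limBot_le (hs : M.IsMarking f A B k s x)
    (hf : M.IsAsymptoticLine f A B) {i j : ℕ} (hij : i < j) (hj : j < k) :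
    M.H (M.limBot (x j)) ≤ M.H (M.limTop (x i)) := by
  have key : ∀ τ : ℝ, 0 ≤ τ → M.H (M.ξ (-τ) (x j)) ≤ M.H (M.ξ τ (x i)) := by
    intro τ hτ
    refine le_of_forall_pos_le_add fun η hη => ?_
    have hi := hs.eventually_add_mem hij hj hτ
    have hj' := hs.eventually_sub_mem hij hj hτ
    have h1 := (M.continuous_H.tendsto _).comp (hs.tendsto_add hf (hij.trans hj) hi)
    have h2 := (M.continuous_H.tendsto _).comp (hs.tendsto_add hf hj hj')
    refine le_of_tendsto_of_tendsto h2 (h1.add_const η) ?_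
    filter_upwards [hi, hj', hf.almost_antitone η hη, hs.eventually_add_le (2 * τ)] with u a b c d
    have := d i j hij hj
    exact (c _ a _ b (by linarith)).le
  refine le_of_tendsto_of_tendsto
    ((M.continuous_H.tendsto _).comp ((M.tendsto_limBot (x j)).comp tendsto_neg_atTop_atBot))
    ((M.continuous_H.tendsto _).comp (M.tendsto_limTop (x i))) ?_
  filter_upwards [eventually_ge_atTop 0] with τ hτ using key τ hτ

/-- The values of `H` at the forward limits strictly decrease with the index and all belong to `K`.
-/
theorem IsMarking.le_card (hs : M.IsMarking f A B k s x) (hf : M.IsAsymptoticLine f A B)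
    {K : Finset ℝ} (hK : ∀ x ∈ M.F, M.H x ∈ K) : k ≤ K.card := by
  have hlt : ∀ i j, i < j → j < k → M.H (M.limTop (x j)) < M.H (M.limTop (x i)) := fun i j hij hj =>
    (M.H_limTop_lt_H_limBot (hs.not_fixed j hj)).trans_le (hs.H_limBot_le hf hij hj)
  have := Finset.card_le_card_of_injOn (s := Finset.range k) (t := K)
    (fun j => M.H (M.limTop (x j))) (fun j _ => hK _ (M.limTop_mem_F _)) (fun i hi j hj hij => by
      have hi : i < k := by simpa using hi
      have hj : j < k := by simpa using hj
      rcases lt_trichotomy i j with h | h | h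
      · exact absurd hij (hlt i j h hj).ne'
      · exact h
      · exact absurd hij (hlt j i h hi).ne)
  simpa using this

/-- If a marking cannot be enlarged, the curves have small diameter between the marked times. -/
theorem IsMarking.exists_eventually_edist_lt (hs : M.IsMarking f A B k s x)
    (hf : M.IsAsymptoticLine f A B)
    (hmax : ∀ φ : ℕ → ℕ, StrictMono φ → ∀ s' x', ¬ M.IsMarking (fun u => f (φ u))
      (fun u => A (φ u)) (fun u => B (φ u)) (k + 1) s' x')
    {g : ℕ} (hg : g ≤ k) {η : ℝ≥0∞} (hη : 0 < η) :
    ∃ R, ∀ᶠ u in atTop, ∀ t ∈ gapSet (A u) (B u) k (s u) g R,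
      ∀ t' ∈ gapSet (A u) (B u) k (s u) g R, edist (f u t) (f u t') < η := by
  obtain ⟨K, hK, -⟩ := M.exists_lojasiewicz
  obtain ⟨ρ, hρ, hlen⟩ := hf.length η hη
  -- Chosen so that `K.card` intervals of length `2ρ'` have total length below `ρ`.
  set ρ' := ρ / (2 * K.card + 1) / 2 with hρ'
  have hρ'0 : 0 < ρ' := by positivity
  have hKρ : K.card * (2 * ρ') < ρ := by
    rw [hρ', mul_div_cancel₀ _ two_ne_zero, mul_div_assoc', div_lt_iff₀ (by positivity)]
    nlinarith
  -- By compactness, `H` is `ρ'`-close to `K` on a uniform neighbourhood of `F`.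
  have hU : ∃ θ : ℝ≥0∞, 0 < θ ∧ ∀ y, Metric.infEDist y M.F < θ → ∃ c ∈ K, |M.H y - c| < ρ' := by
    have hopen : IsOpen {y | ∃ c ∈ K, |M.H y - c| < ρ'} := by
      have : {y | ∃ c ∈ K, |M.H y - c| < ρ'} = ⋃ c ∈ K, {y | |M.H y - c| < ρ'} := by
        ext; simp
      rw [this]
      exact isOpen_biUnion fun c _ =>
        isOpen_lt ((M.continuous_H.sub continuous_const).abs) continuous_const
    have hpos : ∀ y ∈ {y | ∃ c ∈ K, |M.H y - c| < ρ'}ᶜ, 0 < Metric.infEDist y M.F := by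
      intro y hy
      refine pos_iff_ne_zero.2 fun h0 => hy ?_
      have hyF : y ∈ M.F := by
        rw [← M.isClosed_F.closure_eq]; exact Metric.mem_closure_iff_infEDist_zero.2 h0
      exact ⟨_, hK y hyF, by simpa using hρ'0⟩
    rcases eq_empty_or_nonempty {y | ∃ c ∈ K, |M.H y - c| < ρ'}ᶜ with he | hne
    · exact ⟨1, one_pos, fun y _ => (compl_empty_iff.1 he ▸ mem_univ y :)⟩
    · obtain ⟨y₀, hy₀, hmin⟩ := hopen.isClosed_compl.isCompact.exists_isMinOn hne
        (f := fun y => Metric.infEDist y M.F) Metric.continuous_infEDist.continuousOn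
      refine ⟨_, hpos y₀ hy₀, fun y hy => ?_⟩
      by_contra hcon
      exact absurd (hmin hcon) (not_le.2 hy)
  obtain ⟨θ, hθ, hθK⟩ := hU
  obtain ⟨R, hR⟩ := hs.exists_eventually_infEDist_lt hmax hg hθ
  refine ⟨R, ?_⟩
  filter_upwards [hR, hlen] with u h1 h2
  have key : ∀ t ∈ gapSet (A u) (B u) k (s u) g R, ∀ t' ∈ gapSet (A u) (B u) k (s u) g R, t ≤ t' →
      edist (f u t) (f u t') < η := by
    intro t ht t' ht' htt'
    have hsub : Icc t t' ⊆ gapSet (A u) (B u) k (s u) g R :=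
      (ordConnected_gapSet (A u) (B u) k (s u) g R).out ht ht'
    refine h2 t ht.1 t' ht'.1 htt' (lt_of_le_of_lt ?_ hKρ)
    refine sub_le_of_forall_mem_exists_abs_sub_lt (h := fun r => M.H (f u r)) htt' hρ'0.le
      (M.continuous_H.comp_continuousOn ((hf.continuousOn u).mono fun r hr => (hsub hr).1))
      (fun r hr => hθK _ (h1 r (hsub hr)))
  intro t ht t' ht'
  rcases le_total t t' with h | h
  · exact key t ht t' ht' h
  · rw [edist_comm]; exact key t' ht' t ht h

/-- Consecutive gradient lines of a maximal marking meet. -/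
theorem IsMarking.limTop_eq_limBot (hs : M.IsMarking f A B k s x)
    (hf : M.IsAsymptoticLine f A B)
    (hmax : ∀ φ : ℕ → ℕ, StrictMono φ → ∀ s' x', ¬ M.IsMarking (fun u => f (φ u))
      (fun u => A (φ u)) (fun u => B (φ u)) (k + 1) s' x')
    {j : ℕ} (hj : j + 1 < k) : M.limTop (x j) = M.limBot (x (j + 1)) := by
  refine eq_of_forall_edist_le fun η hη => ?_
  obtain ⟨R, hR⟩ := hs.exists_eventually_edist_lt hf hmax (g := j + 1) hj.le hη
  -- For large `τ` the times `s_j + τ` and `s_{j+1} - τ` both lie in the gap between the marks,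
  -- where the curve has diameter below `η`.
  have key : ∀ τ, max R 0 ≤ τ → edist (M.ξ τ (x j)) (M.ξ (-τ) (x (j + 1))) ≤ η := by
    intro τ hτ
    have hτ0 : 0 ≤ τ := (le_max_right _ _).trans hτ
    have hτR : R ≤ τ := (le_max_left _ _).trans hτ
    have h1 := hs.eventually_add_mem (Nat.lt_succ_self j) hj hτ0
    have h2 := hs.eventually_sub_mem (Nat.lt_succ_self j) hj hτ0
    refine le_of_tendsto ((hs.tendsto_add hf (by omega) h1).edist (hs.tendsto_add hf hj h2)) ?_
    filter_upwards [h1, h2, hR, hs.eventually_add_le (2 * τ)] with u a b c d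
    have := d j (j + 1) (by omega) hj
    refine (c _ ⟨a, fun _ => ?_, fun _ => ?_⟩ _ ⟨b, fun _ => ?_, fun _ => ?_⟩).le
    · rw [Nat.add_sub_cancel]; linarith
    · linarith
    · rw [Nat.add_sub_cancel]; linarith
    · linarith
  refine le_of_tendsto ((M.tendsto_limTop (x j)).edist
    ((M.tendsto_limBot (x (j + 1))).comp tendsto_neg_atTop_atBot)) ?_
  filter_upwards [eventually_ge_atTop (max R 0)] with τ hτ using key τ hτ

end Marking

end HamiltonianCircleData

/-! ### Limiting time intervals with possibly infinite ends -/

section TimeSet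

/-- The interval `[-α, β]`, where `α` and `β` may be infinite. -/
def timeSet (α β : ℝ≥0∞) : Set ℝ := {τ | ENNReal.ofReal (-τ) ≤ α ∧ ENNReal.ofReal τ ≤ β}

variable {α β : ℝ≥0∞}

theorem isClosed_timeSet : IsClosed (timeSet α β) :=
  (isClosed_le (ENNReal.continuous_ofReal.comp continuous_neg) continuous_const).inter
    (isClosed_le ENNReal.continuous_ofReal continuous_const)

theorem ordConnected_timeSet : (timeSet α β).OrdConnected :=
  ⟨fun _ ha _ hb _ ht => ⟨(ENNReal.ofReal_le_ofReal (neg_le_neg ht.1)).trans ha.1,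
    (ENNReal.ofReal_le_ofReal ht.2).trans hb.2⟩⟩

theorem zero_mem_timeSet : (0 : ℝ) ∈ timeSet α β := by simp [timeSet]

theorem bddAbove_timeSet_iff : BddAbove (timeSet α β) ↔ β ≠ ⊤ := by
  constructor
  · rintro ⟨b, hb⟩ rfl
    have h0 : 0 ≤ b := hb zero_mem_timeSet
    have := hb (show b + 1 ∈ timeSet α ⊤ from
      ⟨by rw [ENNReal.ofReal_of_nonpos (by linarith)]; exact zero_le, le_top⟩)
    linarith
  · intro h
    refine ⟨β.toReal, fun τ hτ => ?_⟩
    rcases le_total τ 0 with h0 | h0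
    · exact h0.trans ENNReal.toReal_nonneg
    · exact (ENNReal.ofReal_le_iff_le_toReal h).1 hτ.2

theorem bddBelow_timeSet_iff : BddBelow (timeSet α β) ↔ α ≠ ⊤ := by
  constructor
  · rintro ⟨b, hb⟩ rfl
    have h0 : b ≤ 0 := hb zero_mem_timeSet
    have := hb (show b - 1 ∈ timeSet ⊤ β from
      ⟨le_top, by rw [ENNReal.ofReal_of_nonpos (by linarith)]; exact zero_le⟩)
    linarith
  · intro h
    refine ⟨-α.toReal, fun τ hτ => ?_⟩
    have := (ENNReal.ofReal_le_iff_le_toReal h).1 hτ.1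
    linarith

/-- Truncation at radius `r` makes both ends finite, so convergence of extended distances becomes
convergence of real endpoints. -/
theorem timeSet_inter_Icc {r : ℝ} (hr : 0 ≤ r) : timeSet α β ∩ Icc (-r) r =
    Icc (-(min α (ENNReal.ofReal r)).toReal) (min β (ENNReal.ofReal r)).toReal := by
  have key : ∀ (γ : ℝ≥0∞) (τ : ℝ), τ ≤ (min γ (ENNReal.ofReal r)).toReal ↔
      ENNReal.ofReal τ ≤ γ ∧ τ ≤ r := by
    intro γ τ
    have hfin : min γ (ENNReal.ofReal r) ≠ ⊤ :=
      ne_top_of_le_ne_top ENNReal.ofReal_ne_top (min_le_right _ _)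
    rw [← ENNReal.ofReal_le_iff_le_toReal hfin, le_min_iff, ENNReal.ofReal_le_ofReal_iff hr]
  ext τ
  rw [mem_Icc, neg_le, key, key]
  simp only [timeSet, mem_inter_iff, mem_ofPred_eq, mem_Icc, neg_le (a := r)]
  tauto

theorem tendsto_min_of_tendsto_ofReal {a : ℕ → ℝ} (ha : ∀ u, 0 ≤ a u)
    (h : Tendsto (fun u => ENNReal.ofReal (a u)) atTop (𝓝 α)) {r : ℝ} (hr : 0 ≤ r) :
    Tendsto (fun u => min (a u) r) atTop (𝓝 (min α (ENNReal.ofReal r)).toReal) := by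
  have hfin : min α (ENNReal.ofReal r) ≠ ⊤ :=
    ne_top_of_le_ne_top ENNReal.ofReal_ne_top (min_le_right _ _)
  refine ((ENNReal.tendsto_toReal hfin).comp
    (h.min (tendsto_const_nhds (x := ENNReal.ofReal r)))).congr fun u => ?_
  rw [Function.comp, ← ENNReal.ofReal_min, ENNReal.toReal_ofReal (le_min (ha u) hr)]

/-- Clamp `τ` to the second interval. -/
theorem exists_mem_Icc_abs_sub_lt {a b a' b' θ τ : ℝ} (ha' : 0 ≤ a') (hb' : 0 ≤ b')
    (haa : |a - a'| < θ) (hbb : |b - b'| < θ) (hτ : τ ∈ Icc (-a) b) :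
    ∃ τ' ∈ Icc (-a') b', |τ - τ'| < θ := by
  have h1 := abs_lt.1 haa
  have h2 := abs_lt.1 hbb
  rcases lt_or_ge τ (-a') with h | h
  · exact ⟨-a', ⟨le_rfl, by linarith⟩, by rw [abs_lt]; constructor <;> linarith [hτ.1]⟩
  · rcases lt_or_ge b' τ with h' | h'
    · exact ⟨b', ⟨by linarith, le_rfl⟩, by rw [abs_lt]; constructor <;> linarith [hτ.2]⟩
    · exact ⟨τ, ⟨h, h'⟩, by rw [sub_self, abs_zero]; linarith⟩

end TimeSet

/-! ### Closures of flow lines and Hausdorff limits -/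

section OrbitClosure

/-- Split `T` into two tails and a compact middle part, whose image is closed. A point in the
closure of every forward (or backward) tail must be the corresponding limit. -/
theorem mem_closure_image_of_tendsto {X : Type*} [TopologicalSpace X] [T2Space X] {γ : ℝ → X}
    (hγ : Continuous γ) {p q : X} (hp : Tendsto γ atTop (𝓝 p)) (hq : Tendsto γ atBot (𝓝 q))
    {T : Set ℝ} (hT : IsClosed T) {y : X} (hy : y ∈ closure (γ '' T)) :
    y ∈ γ '' T ∨ (¬ BddAbove T ∧ y = p) ∨ (¬ BddBelow T ∧ y = q) := by
  have top : (∀ N, y ∈ closure (γ '' (T ∩ Ici N))) → ¬ BddAbove T ∧ y = p := by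
    intro h
    refine ⟨fun ⟨b, hb⟩ => ?_, ?_⟩
    · obtain ⟨_, t, ht, -⟩ := closure_nonempty_iff.1 ⟨y, h (b + 1)⟩
      have := hb ht.1
      linarith [ht.2.out]
    · by_contra hne
      obtain ⟨U, V, hU, hV, hyU, hpV, hUV⟩ := t2_separation hne
      obtain ⟨N, hN⟩ := eventually_atTop.1 (hp.eventually (hV.mem_nhds hpV))
      obtain ⟨z, hzU, t, ht, rfl⟩ := mem_closure_iff.1 (h N) U hU hyU
      exact hUV.le_bot ⟨hzU, hN t ht.2⟩
  have bot : (∀ N, y ∈ closure (γ '' (T ∩ Iic (-N)))) → ¬ BddBelow T ∧ y = q := by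
    intro h
    refine ⟨fun ⟨b, hb⟩ => ?_, ?_⟩
    · obtain ⟨_, t, ht, -⟩ := closure_nonempty_iff.1 ⟨y, h (-(b - 1))⟩
      have := hb ht.1
      linarith [ht.2.out]
    · by_contra hne
      obtain ⟨U, V, hU, hV, hyU, hqV, hUV⟩ := t2_separation hne
      obtain ⟨N, hN⟩ := eventually_atBot.1 (hq.eventually (hV.mem_nhds hqV))
      obtain ⟨z, hzU, t, ht, rfl⟩ := mem_closure_iff.1 (h (-N)) U hU hyU
      exact hUV.le_bot ⟨hzU, hN t (by simpa using ht.2)⟩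
  by_cases h1 : ∀ N, y ∈ closure (γ '' (T ∩ Ici N))
  · exact Or.inr (Or.inl (top h1))
  by_cases h2 : ∀ N, y ∈ closure (γ '' (T ∩ Iic (-N)))
  · exact Or.inr (Or.inr (bot h2))
  push Not at h1 h2
  obtain ⟨N₁, h1⟩ := h1
  obtain ⟨N₂, h2⟩ := h2
  have hsplit : γ '' T ⊆ γ '' (T ∩ Ici N₁) ∪ γ '' (T ∩ Iic (-N₂)) ∪ γ '' (T ∩ Icc (-N₂) N₁) := by
    rintro _ ⟨t, ht, rfl⟩
    rcases le_total N₁ t with h | h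
    · exact Or.inl (Or.inl ⟨t, ⟨ht, h⟩, rfl⟩)
    · rcases le_total t (-N₂) with h' | h'
      · exact Or.inl (Or.inr ⟨t, ⟨ht, h'⟩, rfl⟩)
      · exact Or.inr ⟨t, ⟨ht, h', h⟩, rfl⟩
  have hmem := closure_mono hsplit hy
  rw [closure_union, closure_union] at hmem
  rcases hmem with (h | h) | h
  · exact absurd h h1
  · exact absurd h h2
  · rw [((isCompact_Icc.inter_left hT).image hγ).isClosed.closure_eq] at h
    exact Or.inl (image_mono inter_subset_left h)

/-- Times beyond `±R` are replaced by `±R`, where the curve is already close to its limit; `±R`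
belongs to the time set because `0` does. -/
theorem exists_forall_mem_timeSet_edist_lt {X : Type*} [PseudoEMetricSpace X] {γ : ℝ → X}
    {p q : X} (hp : Tendsto γ atTop (𝓝 p)) (hq : Tendsto γ atBot (𝓝 q)) {α β η : ℝ≥0∞}
    (hη : 0 < η) : ∃ R > 0, ∀ τ ∈ timeSet α β, ∃ τ' ∈ timeSet α β ∩ Icc (-R) R,
      edist (γ τ) (γ τ') < η := by
  have hη2 : 0 < η / 2 := ENNReal.half_pos hη.ne'
  obtain ⟨N₁, h1⟩ := eventually_atTop.1 (EMetric.tendsto_nhds.1 hp _ hη2)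
  obtain ⟨N₂, h2⟩ := eventually_atBot.1 (EMetric.tendsto_nhds.1 hq _ hη2)
  set R := max (max N₁ (-N₂)) 1 with hR
  have hR1 : N₁ ≤ R := (le_max_left _ _).trans (le_max_left _ _)
  have hR2 : -N₂ ≤ R := (le_max_right _ _).trans (le_max_left _ _)
  have hR0 : 0 < R := lt_max_of_lt_right one_pos
  refine ⟨R, hR0, fun τ hτ => ?_⟩
  have tri : ∀ z a b, edist a z < η / 2 → edist b z < η / 2 → edist (α := X) a b < η := by
    intro z a b ha hb
    calc edist a b ≤ edist a z + edist b z := edist_triangle_right _ _ _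
      _ < η / 2 + η / 2 := ENNReal.add_lt_add ha hb
      _ = η := ENNReal.add_halves η
  rcases lt_or_ge R τ with h | h
  · exact ⟨R, ⟨ordConnected_timeSet.out zero_mem_timeSet hτ ⟨hR0.le, h.le⟩, by linarith, le_rfl⟩,
      tri p _ _ (h1 τ (by linarith)) (h1 R hR1)⟩
  · rcases lt_or_ge τ (-R) with h' | h'
    · exact ⟨-R, ⟨ordConnected_timeSet.out hτ zero_mem_timeSet ⟨h'.le, by linarith⟩, le_rfl,
        by linarith⟩, tri q _ _ (h2 τ (by linarith)) (h2 _ (by linarith))⟩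
    · exact ⟨τ, ⟨hτ, h', h⟩, by rwa [edist_self]⟩

/-- The definition of convergence requires the limit in `u` to exist for fixed `δ`; this identifies
it as the distance between the limit set `y` and the comparison set `z`. -/
theorem tendsto_hausdorffEDist_of_tendsto_zero {X ι : Type*} [PseudoEMetricSpace X] {l : Filter ι}
    {a : ι → Set X} {y z : Set X} (h : Tendsto (fun u => Metric.hausdorffEDist (a u) y) l (𝓝 0)) :
    Tendsto (fun u => Metric.hausdorffEDist (a u) z) l (𝓝 (Metric.hausdorffEDist y z)) := by
  have h1 : Tendsto (fun u => Metric.hausdorffEDist y z - Metric.hausdorffEDist (a u) y) l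
      (𝓝 (Metric.hausdorffEDist y z - 0)) :=
    ENNReal.Tendsto.sub tendsto_const_nhds h (Or.inr ENNReal.zero_ne_top)
  have h2 : Tendsto (fun u => Metric.hausdorffEDist (a u) y + Metric.hausdorffEDist y z) l
      (𝓝 (0 + Metric.hausdorffEDist y z)) := h.add tendsto_const_nhds
  rw [tsub_zero] at h1
  rw [zero_add] at h2
  refine tendsto_of_tendsto_of_tendsto_of_le_of_le h1 h2 (fun u => ?_) (fun u => ?_)
  · refine tsub_le_iff_left.2 ?_
    rw [Metric.hausdorffEDist_comm (s := a u) (t := y)]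
    exact Metric.hausdorffEDist_triangle
  · exact Metric.hausdorffEDist_triangle

end OrbitClosure

namespace HamiltonianCircleData

/-! ### Convergence of the windows around marked times -/

section HausdorffLimits

variable {E X : Type*} [NormedAddCommGroup E] [NormedSpace ℝ E] [FiniteDimensional ℝ E]
  [EMetricSpace X] [CompactSpace X] [ChartedSpace E X] [IsManifold 𝓘(ℝ, E) ∞ X]
  [RiemannianBundle (fun x : X => TangentSpace 𝓘(ℝ, E) x)]
  [MulAction Circle X] {M : HamiltonianCircleData E X}
  [ContMDiffSMul (𝓡 1) 𝓘(ℝ, E) ∞ Circle X]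
  [h : IsContMDiffRiemannianBundle 𝓘(ℝ, E) ∞ E (fun x : X => TangentSpace 𝓘(ℝ, E) x)]
  {f : ℕ → ℝ → X} {A B : ℕ → ℝ} {k : ℕ} {s : ℕ → ℕ → ℝ} {x : ℕ → X}

/-- The endpoints of the window, measured from the mark, converge to those of the truncated time
set. The curves converge uniformly for bounded times and the limit line is uniformly continuous
there. -/
theorem IsMarking.tendsto_hausdorffEDist (hs : M.IsMarking f A B k s x)
    (hf : M.IsAsymptoticLine f A B) {j : ℕ} (hj : j < k) {α β : ℝ≥0∞}
    (hα : Tendsto (fun u => ENNReal.ofReal (s u j - A u)) atTop (𝓝 α))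
    (hβ : Tendsto (fun u => ENNReal.ofReal (B u - s u j)) atTop (𝓝 β)) {r : ℝ} (hr : 0 ≤ r) :
    Tendsto (fun u => Metric.hausdorffEDist
      (f u '' Icc (max (A u) (s u j - r)) (min (B u) (s u j + r)))
      ((fun t => M.ξ t (x j)) '' (timeSet α β ∩ Icc (-r) r))) atTop (𝓝 0) := by
  refine ENNReal.tendsto_nhds_zero.2 fun η hη => ?_
  have hη2 : 0 < η / 2 := ENNReal.half_pos hη.ne'
  rw [timeSet_inter_Icc hr]
  have ha0 : ∀ u, 0 ≤ s u j - A u := fun u => sub_nonneg.2 (hs.mem u j hj).1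
  have hb0 : ∀ u, 0 ≤ B u - s u j := fun u => sub_nonneg.2 (hs.mem u j hj).2
  have ha := tendsto_min_of_tendsto_ofReal ha0 hα hr
  have hb := tendsto_min_of_tendsto_ofReal hb0 hβ hr
  set a := (min α (ENNReal.ofReal r)).toReal with hadef
  set b := (min β (ENNReal.ofReal r)).toReal with hbdef
  have har : a ≤ r := ENNReal.toReal_le_of_le_ofReal hr (min_le_right _ _)
  have hbr : b ≤ r := ENNReal.toReal_le_of_le_ofReal hr (min_le_right _ _)
  have ha' : 0 ≤ a := ENNReal.toReal_nonneg
  have hb' : 0 ≤ b := ENNReal.toReal_nonneg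
  obtain ⟨θ, hθ, hunif⟩ : ∃ θ > 0, ∀ τ ∈ Icc (-r) r, ∀ τ' ∈ Icc (-r) r, |τ - τ'| < θ →
      edist (M.ξ τ (x j)) (M.ξ τ' (x j)) < η / 2 := by
    have h1 := isCompact_Icc.uniformContinuousOn_of_continuous
      (s := Icc (-r) r) (M.continuous_ξ_left (x j)).continuousOn
    obtain ⟨θ, hθ, h2⟩ := EMetric.uniformContinuousOn_iff.1 h1 _ hη2
    obtain ⟨θ', hθ', hlt⟩ := ENNReal.lt_iff_exists_real_btwn.1 hθ
    refine ⟨θ', ?_, fun τ hτ τ' hτ' h3 => h2 hτ hτ' (lt_of_lt_of_le ?_ hlt.2.le)⟩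
    · simpa using hlt.1
    · rw [edist_dist, Real.dist_eq]
      exact (ENNReal.ofReal_lt_ofReal_iff (by simpa using hlt.1)).2 h3
  filter_upwards [hs.eventually_edist_lt hf hj r hη2, Metric.tendsto_nhds.1 ha θ hθ,
    Metric.tendsto_nhds.1 hb θ hθ] with u h1 h2 h3
  rw [Real.dist_eq] at h2 h3
  have tri : ∀ τ τ', |τ| ≤ r → |τ'| ≤ r → s u j + τ ∈ Icc (A u) (B u) → |τ - τ'| < θ →
      edist (f u (s u j + τ)) (M.ξ τ' (x j)) ≤ η := by
    intro τ τ' hτ hτ' hmem hlt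
    calc edist (f u (s u j + τ)) (M.ξ τ' (x j)) ≤ _ := edist_triangle _ (M.ξ τ (x j)) _
      _ ≤ η / 2 + η / 2 :=
        add_le_add (h1 τ hτ hmem).le (hunif τ (abs_le.1 hτ) τ' (abs_le.1 hτ') hlt).le
      _ = η := ENNReal.add_halves η
  have hau : 0 ≤ min (s u j - A u) r := le_min (ha0 u) hr
  have hbu : 0 ≤ min (B u - s u j) r := le_min (hb0 u) hr
  have hIcc : ∀ τ, τ ∈ Icc (-(min (s u j - A u) r)) (min (B u - s u j) r) ↔
      |τ| ≤ r ∧ s u j + τ ∈ Icc (A u) (B u) := by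
    intro τ
    rw [mem_Icc, mem_Icc, neg_le, le_min_iff, le_min_iff, abs_le]
    constructor
    · rintro ⟨⟨p1, p2⟩, p3, p4⟩
      exact ⟨⟨by linarith, p4⟩, by linarith, by linarith⟩
    · rintro ⟨⟨p1, p2⟩, p3, p4⟩
      exact ⟨⟨by linarith, by linarith⟩, by linarith, p2⟩
  refine Metric.hausdorffEDist_le_of_mem_edist ?_ ?_
  · rintro _ ⟨t, ht, rfl⟩
    have ht1 := max_le_iff.1 ht.1
    have ht2 := le_min_iff.1 ht.2
    have hτ : |t - s u j| ≤ r ∧ s u j + (t - s u j) ∈ Icc (A u) (B u) :=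
      ⟨abs_le.2 ⟨by linarith, by linarith⟩, by rw [add_sub_cancel]; exact ⟨ht1.1, ht2.1⟩⟩
    obtain ⟨τ', hτ', hlt⟩ := exists_mem_Icc_abs_sub_lt ha' hb' h2 h3 ((hIcc _).2 hτ)
    refine ⟨_, ⟨τ', hτ', rfl⟩, ?_⟩
    have := tri _ τ' hτ.1 (abs_le.2 ⟨by linarith [hτ'.1], by linarith [hτ'.2]⟩) hτ.2 hlt
    rwa [add_sub_cancel] at this
  · rintro _ ⟨τ', hτ', rfl⟩
    rw [abs_sub_comm] at h2 h3
    obtain ⟨τ, hτ, hlt⟩ := exists_mem_Icc_abs_sub_lt hau hbu h2 h3 hτ'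
    obtain ⟨p1, p2⟩ := (hIcc τ).1 hτ
    refine ⟨_, ⟨s u j + τ, ⟨max_le p2.1 ?_, le_min p2.2 ?_⟩, rfl⟩, ?_⟩
    · linarith [(abs_le.1 p1).1]
    · linarith [(abs_le.1 p1).2]
    · rw [edist_comm]
      exact tri τ τ' p1 (abs_le.2 ⟨by linarith [hτ'.1], by linarith [hτ'.2]⟩) p2
        (by rwa [abs_sub_comm])

/-- A compact time range `[-R, R]` already traces the line up to `η`. For small `δ` its image lies
in `X^δ` and it is contained in `[-δ⁻¹, δ⁻¹]`, so both sets are `η`-dense in the line. -/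
theorem tendsto_hausdorffEDist_inter_away {x : X} (hx : x ∉ M.F) (α β : ℝ≥0∞) :
    Tendsto (fun δ => Metric.hausdorffEDist
      ((fun t => M.ξ t x) '' (timeSet α β ∩ Icc (-δ⁻¹) δ⁻¹))
      ((fun t => M.ξ t x) '' timeSet α β ∩ M.away δ)) (𝓝[>] 0) (𝓝 0) := by
  refine ENNReal.tendsto_nhds_zero.2 fun η hη => ?_
  obtain ⟨R, hR, hclose⟩ := exists_forall_mem_timeSet_edist_lt (α := α) (β := β)
    (M.tendsto_limTop x) (M.tendsto_limBot x) hη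
  have haway : ∀ᶠ δ in 𝓝[>] (0 : ℝ), ∀ τ ∈ Icc (-R) R, M.ξ τ x ∈ M.away δ := by
    have hcont : Continuous fun τ => Metric.infEDist (M.ξ τ x) M.F :=
      Metric.continuous_infEDist.comp (M.continuous_ξ_left x)
    obtain ⟨τ₀, -, hmin⟩ := isCompact_Icc.exists_isMinOn (s := Icc (-R) R)
      ⟨0, by linarith, hR.le⟩ hcont.continuousOn
    have hpos : 0 < Metric.infEDist (M.ξ τ₀ x) M.F := by
      refine pos_iff_ne_zero.2 fun h0 => M.ξ_notMem_F hx τ₀ ?_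
      rw [← M.isClosed_F.closure_eq]
      exact Metric.mem_closure_iff_infEDist_zero.2 h0
    have hlim : Tendsto ENNReal.ofReal (𝓝[>] 0) (𝓝 (ENNReal.ofReal 0)) :=
      (ENNReal.continuous_ofReal.tendsto 0).mono_left nhdsWithin_le_nhds
    rw [ENNReal.ofReal_zero] at hlim
    filter_upwards [hlim.eventually (gt_mem_nhds hpos)] with δ hδ τ hτ hmem
    exact absurd (hmin hτ) (not_le.2 ((Metric.mem_cthickening_iff.1 hmem).trans_lt hδ))
  have hinv : ∀ᶠ δ in 𝓝[>] (0 : ℝ), R ≤ δ⁻¹ := tendsto_inv_nhdsGT_zero.eventually_ge_atTop R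
  filter_upwards [haway, hinv] with δ h1 h2
  refine Metric.hausdorffEDist_le_of_mem_edist ?_ ?_
  · rintro _ ⟨τ, hτ, rfl⟩
    obtain ⟨τ', hτ', hlt⟩ := hclose τ hτ.1
    exact ⟨_, ⟨⟨τ', hτ'.1, rfl⟩, h1 τ' hτ'.2⟩, hlt.le⟩
  · rintro _ ⟨⟨τ, hτ, rfl⟩, -⟩
    obtain ⟨τ', hτ', hlt⟩ := hclose τ hτ
    exact ⟨_, ⟨τ', ⟨hτ'.1, by linarith [hτ'.2.1], by linarith [hτ'.2.2]⟩, rfl⟩, hlt.le⟩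

end HausdorffLimits

end HamiltonianCircleData

/-! ### Cutting the interval into windows and gaps -/

section Decomposition

/-- The beginning of the part of `[A, B]` around the `j`-th marked time. -/
noncomputable def segLo (A r : ℝ) (s : ℕ → ℝ) (j : ℕ) : ℝ := max A (s j - r)

/-- The end of the part of `[A, B]` around the `j`-th marked time. -/
noncomputable def segHi (B r : ℝ) (s : ℕ → ℝ) (j : ℕ) : ℝ := min B (s j + r)

/-- The beginning of the gap before the `g`-th marked time. -/
noncomputable def gapLo (A B r : ℝ) (s : ℕ → ℝ) (g : ℕ) : ℝ :=
  if g = 0 then A else segHi B r s (g - 1)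

/-- The end of the gap before the `g`-th of `k` marked times. -/
noncomputable def gapHi (A B r : ℝ) (k : ℕ) (s : ℕ → ℝ) (g : ℕ) : ℝ :=
  if g < k then segLo A r s g else B

variable {A B r : ℝ} {s : ℕ → ℝ} {k na nb : ℕ}

/-- There are `k + 1` possible gaps. `na = 1` (or `nb = 1`) means that the first (or last) window
already reaches the end of `[A, B]`, so that the gap there is dropped; the shift by `na` renumbers
those that remain. -/
theorem Icc_eq_iUnion_segments_gaps (hk : 0 < k) (hna : na ≤ 1) (hnb : nb ≤ 1) (hr : 0 < r)
    (hmem : ∀ j < k, s j ∈ Icc A B) (hsep : ∀ i j, i < j → j < k → s i + 2 * r ≤ s j)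
    (hL0 : na = 0 → A ≤ s 0 - r) (hL1 : na = 1 → s 0 - r ≤ A)
    (hR1 : nb = 1 → B ≤ s (k - 1) + r) :
    Icc A B = (⋃ j : Fin k, Icc (segLo A r s j) (segHi B r s j)) ∪
        (⋃ i : Fin (k + 1 - na - nb), Icc (gapLo A B r s (i + na)) (gapHi A B r k s (i + na))) ∧
      (∀ j : Fin k, segLo A r s j ≤ segHi B r s j) ∧
      (∀ i : Fin (k + 1 - na - nb), gapLo A B r s (i + na) ≤ gapHi A B r k s (i + na)) ∧
      (∀ i j : Fin k, i < j → segHi B r s i ≤ segLo A r s j) ∧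
      (∀ i j : Fin (k + 1 - na - nb), i < j →
        gapHi A B r k s (i + na) < gapLo A B r s (j + na)) := by
  have hAB : A ≤ B := (hmem 0 hk).1.trans (hmem 0 hk).2
  have hlohi : ∀ j < k, segLo A r s j ≤ s j ∧ s j ≤ segHi B r s j := fun j hj =>
    ⟨max_le (hmem j hj).1 (by linarith), le_min (hmem j hj).2 (by linarith)⟩
  have hA : ∀ j, A ≤ segLo A r s j := fun j => le_max_left _ _
  have hB : ∀ j, segHi B r s j ≤ B := fun j => min_le_left _ _
  have hmono : ∀ i j, i ≤ j → j < k → s i ≤ s j := fun i j hij hj => by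
    rcases hij.eq_or_lt with rfl | h
    · exact le_rfl
    · linarith [hsep i j h hj]
  have hadj : ∀ i j, i < j → j < k → segHi B r s i ≤ segLo A r s j := fun i j hij hj => by
    have h1 : segHi B r s i ≤ s i + r := min_le_right _ _
    have h2 : s j - r ≤ segLo A r s j := le_max_right _ _
    linarith [hsep i j hij hj]
  have hgap : ∀ g ≤ k, gapLo A B r s g ≤ gapHi A B r k s g := by
    intro g hg
    unfold gapLo gapHi
    split_ifs with h1 h2 h2
    · exact hA g
    · exact hAB
    · exact hadj (g - 1) g (by omega) h2
    · exact hB _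
  refine ⟨Subset.antisymm ?_ ?_, fun j => (hlohi j j.2).1.trans (hlohi j j.2).2,
    fun i => hgap _ (by omega), fun i j hij => hadj i j hij j.2, fun i j hij => ?_⟩
  · intro t ht
    classical
    -- Let `g` be the first window beginning after `t`. Then `t` lies in window `g - 1` or in gap
    -- `g`.
    have hex : ∃ g, g = k ∨ t < segLo A r s g := ⟨k, Or.inl rfl⟩
    set g := Nat.find hex with hg
    have hgk : g ≤ k := Nat.find_min' hex (Or.inl rfl)
    have hspec : g = k ∨ t < segLo A r s g := Nat.find_spec hex
    have hHi : t ≤ gapHi A B r k s g := by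
      unfold gapHi
      split_ifs with h
      · exact (hspec.resolve_left h.ne).le
      · exact ht.2
    have hin : gapLo A B r s g ≤ t → na ≤ g → g + nb ≤ k →
        t ∈ ⋃ i : Fin (k + 1 - na - nb),
          Icc (gapLo A B r s (i + na)) (gapHi A B r k s (i + na)) := by
      intro h1 h2 h3
      refine mem_iUnion.2 ⟨⟨g - na, by omega⟩, ?_⟩
      simp only [Nat.sub_add_cancel h2]
      exact ⟨h1, hHi⟩
    rcases Nat.eq_zero_or_pos g with h0 | h0
    · have hlt : t < segLo A r s 0 := h0 ▸ hspec.resolve_left (by omega)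
      have hna0 : na = 0 := by
        by_contra hne
        have := hL1 (by omega)
        rw [segLo, max_eq_left this] at hlt
        exact absurd ht.1 (not_le.2 hlt)
      exact Or.inr (hin (by rw [h0, gapLo, if_pos rfl]; exact ht.1) (by omega) (by omega))
    · have hnot := Nat.find_min hex (m := g - 1) (by omega)
      push Not at hnot
      by_cases hle : t ≤ segHi B r s (g - 1)
      · exact Or.inl (mem_iUnion.2 ⟨⟨g - 1, by omega⟩, hnot.2, hle⟩)
      · refine Or.inr (hin (by rw [gapLo, if_neg h0.ne']; exact (not_le.1 hle).le) (by omega) ?_)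
        rcases hgk.eq_or_lt with h | h
        · by_contra hne
          have := hR1 (by omega)
          rw [h, segHi, min_eq_left this] at hle
          exact hle ht.2
        · omega
  · refine union_subset (iUnion_subset fun j => Icc_subset_Icc (hA _) (hB _))
      (iUnion_subset fun i => Icc_subset_Icc ?_ ?_)
    · unfold gapLo
      split_ifs with h
      · exact le_rfl
      · exact (hA _).trans ((hlohi _ (by omega)).1.trans (hlohi _ (by omega)).2)
    · unfold gapHi
      split_ifs with h
      · exact (hlohi _ h).1.trans ((hlohi _ h).2.trans (hB _))
      · exact le_rfl
  · have hij' : (i : ℕ) < j := hij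
    have h1 : (i : ℕ) + na < k := by omega
    have h2 : (j : ℕ) + na ≠ 0 := by omega
    rw [gapHi, if_pos h1, gapLo, if_neg h2]
    -- The window after gap `i` is not truncated on the left, so it begins strictly before its mark;
    -- this makes consecutive gaps strictly separated.
    have hstrict : segLo A r s (i + na) = s (i + na) - r := by
      refine max_eq_right ?_
      rcases Nat.eq_zero_or_pos ((i : ℕ) + na) with h | h
      · rw [h]; exact hL0 (by omega)
      · have := hsep 0 (i + na) h h1
        linarith [(hmem 0 hk).1]
    have h3 := (hlohi (j + na - 1) (by omega)).2
    have h4 := hmono (i + na) (j + na - 1) (by omega) (by omega)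
    linarith

theorem Icc_gap_subset_gapSet {g : ℕ} (hmem : ∀ j < k, s j ∈ Icc A B) (hg : g ≤ k) (hr : 0 ≤ r)
    (hL : g < k → A ≤ s g - r) (hR : 0 < g → s (g - 1) + r ≤ B) :
    Icc (gapLo A B r s g) (gapHi A B r k s g) ⊆
      HamiltonianCircleData.gapSet A B k s g r := by
  intro t ht
  have h1 : 0 < g → s (g - 1) + r ≤ t := fun h => by
    have := ht.1
    rwa [gapLo, if_neg h.ne', segHi, min_eq_right (hR h)] at this
  have h2 : g < k → t + r ≤ s g := fun h => by
    have := ht.2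
    rw [gapHi, if_pos h, segLo, max_eq_right (hL h)] at this
    linarith
  refine ⟨⟨?_, ?_⟩, h1, h2⟩
  · rcases Nat.eq_zero_or_pos g with h | h
    · have := ht.1
      rwa [gapLo, if_pos h] at this
    · have := h1 h
      linarith [(hmem (g - 1) (by omega)).1]
  · rcases hg.eq_or_lt with h | h
    · have := ht.2
      rwa [gapHi, if_neg (by omega)] at this
    · have := h2 h
      linarith [(hmem g h).2]

end Decomposition

namespace HamiltonianCircleData

/-! ### Complete markings -/

section ChainLimit

variable {E X : Type*} [NormedAddCommGroup E] [NormedSpace ℝ E] [FiniteDimensional ℝ E]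
  [EMetricSpace X] [CompactSpace X] [ChartedSpace E X] [IsManifold 𝓘(ℝ, E) ∞ X]
  [RiemannianBundle (fun x : X => TangentSpace 𝓘(ℝ, E) x)]
  [MulAction Circle X] (M : HamiltonianCircleData E X)

/-- A marking of a sequence of asymptotic gradient lines which cannot be enlarged, for which the
distances of the marked times to the ends of the intervals converge. -/
structure IsCompleteMarking (f : ℕ → ℝ → X) (A B : ℕ → ℝ) (k : ℕ) (s : ℕ → ℕ → ℝ) (x : ℕ → X)
    (α β : ℕ → ℝ≥0∞) : Prop extends M.IsMarking f A B k s x where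
  line : M.IsAsymptoticLine f A B
  pos : 0 < k
  maximal : ∀ φ : ℕ → ℕ, StrictMono φ → ∀ s' x', ¬ M.IsMarking (fun u => f (φ u))
      (fun u => A (φ u)) (fun u => B (φ u)) (k + 1) s' x'
  tendsto_left : ∀ j < k, Tendsto (fun u => ENNReal.ofReal (s u j - A u)) atTop (𝓝 (α j))
  tendsto_right : ∀ j < k, Tendsto (fun u => ENNReal.ofReal (B u - s u j)) atTop (𝓝 (β j))

variable {M} {f : ℕ → ℝ → X} {A B : ℕ → ℝ} {k : ℕ} {s : ℕ → ℕ → ℝ} {x : ℕ → X} {α β : ℕ → ℝ≥0∞}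

theorem IsCompleteMarking.left_eq_top (hs : M.IsCompleteMarking f A B k s x α β) {j : ℕ}
    (h0 : 0 < j) (hj : j < k) : α j = ⊤ := by
  refine tendsto_nhds_unique (hs.tendsto_left j hj) (ENNReal.tendsto_ofReal_atTop.comp ?_)
  refine tendsto_atTop_mono (fun u => ?_) (hs.separated 0 j h0 hj)
  have := (hs.mem u 0 hs.pos).1
  linarith

theorem IsCompleteMarking.right_eq_top (hs : M.IsCompleteMarking f A B k s x α β) {j : ℕ}
    (hj : j + 1 < k) : β j = ⊤ := by
  refine tendsto_nhds_unique (hs.tendsto_right j (by omega)) (ENNReal.tendsto_ofReal_atTop.comp ?_)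
  refine tendsto_atTop_mono (fun u => ?_) (hs.separated j (j + 1) (by omega) hj)
  have := (hs.mem u (j + 1) hj).2
  linarith

/-- The truncated distances of a mark to the two ends add up to at least `ε`, and this survives in
the limit. -/
theorem IsCompleteMarking.volume_pos (hs : M.IsCompleteMarking f A B k s x α β) {ε : ℝ}
    (hε : 0 < ε) (hAB : ∀ u, ε ≤ B u - A u) {j : ℕ} (hj : j < k) :
    0 < MeasureTheory.volume (timeSet (α j) (β j)) := by
  have ha0 : ∀ u, 0 ≤ s u j - A u := fun u => sub_nonneg.2 (hs.mem u j hj).1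
  have hb0 : ∀ u, 0 ≤ B u - s u j := fun u => sub_nonneg.2 (hs.mem u j hj).2
  have hlim := (tendsto_min_of_tendsto_ofReal ha0 (hs.tendsto_left j hj) hε.le).add
    (tendsto_min_of_tendsto_ofReal hb0 (hs.tendsto_right j hj) hε.le)
  have hge := ge_of_tendsto' hlim (b := ε) fun u => by
    have := hAB u
    rcases min_cases (s u j - A u) ε with h1 | h1 <;>
      rcases min_cases (B u - s u j) ε with h2 | h2 <;> linarith [ha0 u, hb0 u, h1.1, h2.1]
  refine lt_of_lt_of_le ?_ (MeasureTheory.measure_mono (inter_subset_left (t := Icc (-ε) ε)))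
  rw [timeSet_inter_Icc hε.le, Real.volume_Icc, ENNReal.ofReal_pos]
  linarith

theorem eventually_le_of_tendsto_ofReal {a : ℕ → ℝ} {γ : ℝ≥0∞} (ha : ∀ u, 0 ≤ a u)
    (h : Tendsto (fun u => ENNReal.ofReal (a u)) atTop (𝓝 γ)) {r : ℝ} (hr : γ.toReal < r) :
    (γ = ⊤ → ∀ᶠ u in atTop, r ≤ a u) ∧ (γ ≠ ⊤ → ∀ᶠ u in atTop, a u ≤ r) := by
  constructor
  · rintro rfl
    filter_upwards [h.eventually (lt_mem_nhds (ENNReal.ofReal_lt_top (r := r)))] with u hu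
    exact ((ENNReal.ofReal_lt_ofReal_iff_of_nonneg (ENNReal.toReal_nonneg.trans hr.le)).1 hu).le
  · intro hγ
    have hlt : γ < ENNReal.ofReal r := (ENNReal.lt_ofReal_iff_toReal_lt hγ).2 hr
    filter_upwards [h.eventually (gt_mem_nhds hlt)] with u hu
    exact ((ENNReal.ofReal_lt_ofReal_iff_of_nonneg (ha u)).1 hu).le

/-- Once `r` exceeds every finite `α j` and `β j`, the windows of radius `r` swallow the ends at
bounded distance and stay clear of those at infinite distance. -/
theorem IsCompleteMarking.eventually_ends (hs : M.IsCompleteMarking f A B k s x α β) :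
    ∀ᶠ r in atTop, ∀ᶠ u in atTop, ∀ j < k,
      (α j = ⊤ → A u ≤ s u j - r) ∧ (α j ≠ ⊤ → s u j - r ≤ A u) ∧
      (β j = ⊤ → s u j + r ≤ B u) ∧ (β j ≠ ⊤ → B u ≤ s u j + r) := by
  have h1 : ∀ᶠ r in atTop, ∀ j ∈ Finset.range k, (α j).toReal < r ∧ (β j).toReal < r :=
    (Finset.eventually_all _).2 fun j _ => (eventually_gt_atTop _).and (eventually_gt_atTop _)
  filter_upwards [h1] with r hr
  have : ∀ᶠ u in atTop, ∀ j ∈ Finset.range k,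
      (α j = ⊤ → A u ≤ s u j - r) ∧ (α j ≠ ⊤ → s u j - r ≤ A u) ∧
      (β j = ⊤ → s u j + r ≤ B u) ∧ (β j ≠ ⊤ → B u ≤ s u j + r) := by
    refine (Finset.eventually_all _).2 fun j hj => ?_
    have hjk := Finset.mem_range.1 hj
    obtain ⟨a1, a2⟩ := eventually_le_of_tendsto_ofReal
      (fun u => sub_nonneg.2 (hs.mem u j hjk).1) (hs.tendsto_left j hjk) (hr j hj).1
    obtain ⟨b1, b2⟩ := eventually_le_of_tendsto_ofReal
      (fun u => sub_nonneg.2 (hs.mem u j hjk).2) (hs.tendsto_right j hjk) (hr j hj).2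
    refine Eventually.and ?_ (Eventually.and ?_ (Eventually.and ?_ ?_))
    · exact eventually_imp_distrib_left.2 fun h => (a1 h).mono fun u hu => by linarith
    · exact eventually_imp_distrib_left.2 fun h => (a2 h).mono fun u hu => by linarith
    · exact eventually_imp_distrib_left.2 fun h => (b1 h).mono fun u hu => by linarith
    · exact eventually_imp_distrib_left.2 fun h => (b2 h).mono fun u hu => by linarith
  filter_upwards [this] with u hu j hj using hu j (Finset.mem_range.2 hj)

end ChainLimit

end HamiltonianCircleData

namespace HamiltonianCircleData

/-! ### Convergence to a chain -/

section ChainConvergence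

variable {E X : Type*} [NormedAddCommGroup E] [NormedSpace ℝ E] [FiniteDimensional ℝ E]
  [EMetricSpace X] [CompactSpace X] [ChartedSpace E X] [IsManifold 𝓘(ℝ, E) ∞ X]
  [RiemannianBundle (fun x : X => TangentSpace 𝓘(ℝ, E) x)]
  [MulAction Circle X] (M : HamiltonianCircleData E X)
  [ContMDiffSMul (𝓡 1) 𝓘(ℝ, E) ∞ Circle X]
  [h : IsContMDiffRiemannianBundle 𝓘(ℝ, E) ∞ E (fun x : X => TangentSpace 𝓘(ℝ, E) x)]

/-- The image of the component under `H` is connected and contained in a finite set. -/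
theorem H_eq_of_mem_connectedComponentIn {p y : X} (hp : p ∈ M.F)
    (hy : y ∈ connectedComponentIn M.F p) : M.H y = M.H p := by
  obtain ⟨K, hK, -⟩ := M.exists_lojasiewicz
  have hpre := (isPreconnected_connectedComponentIn (F := M.F) (x := p)).image M.H
    M.continuous_H.continuousOn
  have hfin : (M.H '' connectedComponentIn M.F p).Finite := by
    refine K.finite_toSet.subset ?_
    rintro _ ⟨z, hz, rfl⟩
    exact hK z (connectedComponentIn_subset _ _ hz)
  by_contra hne
  exact hpre.infinite_of_nontrivial
    ⟨_, ⟨y, hy, rfl⟩, _, ⟨p, mem_connectedComponentIn hp, rfl⟩, hne⟩ hfin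

/-- The fixed points at which the gradient lines through `x 0, x 1, …` begin and end. -/
noncomputable def vertex (x : ℕ → X) (g : ℕ) : X :=
  if g = 0 then M.limBot (x 0) else M.limTop (x (g - 1))

theorem vertex_mem_F (x : ℕ → X) (g : ℕ) : M.vertex x g ∈ M.F := by
  unfold vertex
  split_ifs
  · exact M.limBot_mem_F _
  · exact M.limTop_mem_F _

/-- Whether a chain of gradient lines begins with a bounded one. -/
noncomputable def leftCount (α : ℕ → ℝ≥0∞) : ℕ := open Classical in if α 0 = ⊤ then 0 else 1

/-- Whether a chain of gradient lines ends with a bounded one. -/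
noncomputable def rightCount (k : ℕ) (β : ℕ → ℝ≥0∞) : ℕ :=
  open Classical in if β (k - 1) = ⊤ then 0 else 1

theorem leftCount_le (α : ℕ → ℝ≥0∞) : leftCount α ≤ 1 := by
  unfold leftCount; split_ifs <;> simp

theorem rightCount_le (k : ℕ) (β : ℕ → ℝ≥0∞) : rightCount k β ≤ 1 := by
  unfold rightCount; split_ifs <;> simp

theorem leftCount_eq_zero {α : ℕ → ℝ≥0∞} : leftCount α = 0 ↔ α 0 = ⊤ := by
  unfold leftCount; split_ifs with h <;> simp [h]

theorem rightCount_eq_zero {k : ℕ} {β : ℕ → ℝ≥0∞} : rightCount k β = 0 ↔ β (k - 1) = ⊤ := by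
  unfold rightCount; split_ifs with h <;> simp [h]

variable {M} {f : ℕ → ℝ → X} {A B : ℕ → ℝ} {k : ℕ} {s : ℕ → ℕ → ℝ} {x : ℕ → X} {α β : ℕ → ℝ≥0∞}

theorem IsCompleteMarking.vertex_eq_limBot (hs : M.IsCompleteMarking f A B k s x α β) {g : ℕ}
    (hg : g < k) : M.vertex x g = M.limBot (x g) := by
  rcases Nat.eq_zero_or_pos g with rfl | h
  · rw [vertex, if_pos rfl]
  · rw [vertex, if_neg h.ne']
    obtain ⟨j, rfl⟩ := Nat.exists_eq_succ_of_ne_zero h.ne'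
    exact hs.limTop_eq_limBot hs.line hs.maximal hg

theorem vertex_succ (x : ℕ → X) (g : ℕ) : M.vertex x (g + 1) = M.limTop (x g) := by
  rw [vertex, if_neg (Nat.succ_ne_zero g), Nat.add_sub_cancel]

/-- Consecutive vertices are the two ends of a nonconstant gradient line. This orders the fixed
components and shows that they are distinct. -/
theorem IsCompleteMarking.H_vertex_lt (hs : M.IsCompleteMarking f A B k s x α β) {g g' : ℕ}
    (hg : g < g') (hg' : g' ≤ k) : M.H (M.vertex x g') < M.H (M.vertex x g) := by
  have step : ∀ i < k, M.H (M.vertex x (i + 1)) < M.H (M.vertex x i) := fun i hi => by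
    rw [vertex_succ, hs.vertex_eq_limBot hi]
    exact M.H_limTop_lt_H_limBot (hs.not_fixed i hi)
  induction g', hg using Nat.le_induction with
  | base => exact step g hg'
  | succ n hn ih => exact (step n hg').trans (ih (by omega))

theorem IsCompleteMarking.ends_eq_top (hs : M.IsCompleteMarking f A B k s x α β) {g : ℕ}
    (hg : leftCount α ≤ g) (hg' : g + rightCount k β ≤ k) :
    (g < k → α g = ⊤) ∧ (0 < g → β (g - 1) = ⊤) := by
  constructor
  · intro h
    rcases Nat.eq_zero_or_pos g with rfl | h0
    · exact leftCount_eq_zero.1 (by omega)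
    · exact hs.left_eq_top h0 h
  · intro h0
    rcases (show g ≤ k by omega).eq_or_lt with rfl | h
    · exact rightCount_eq_zero.1 (by omega)
    · exact hs.right_eq_top (by omega)

theorem IsCompleteMarking.eventually_subset_gapSet (hs : M.IsCompleteMarking f A B k s x α β)
    {g : ℕ} (hg : leftCount α ≤ g) (hg' : g + rightCount k β ≤ k) :
    ∀ᶠ r in atTop, ∀ᶠ u in atTop, Icc (gapLo (A u) (B u) r (s u) g) (gapHi (A u) (B u) r k (s u) g)
      ⊆ gapSet (A u) (B u) k (s u) g r := by
  obtain ⟨h1, h2⟩ := hs.ends_eq_top hg hg'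
  filter_upwards [hs.eventually_ends, eventually_ge_atTop 0] with r hr hr0
  filter_upwards [hr] with u hu
  exact Icc_gap_subset_gapSet (hs.mem u) (by omega) hr0 (fun h => (hu g h).1 (h1 h))
    (fun h => (hu (g - 1) (by omega)).2.2.1 (h2 h))

theorem IsCompleteMarking.eventually_ediam_gap_le (hs : M.IsCompleteMarking f A B k s x α β)
    {g : ℕ} (hg : leftCount α ≤ g) (hg' : g + rightCount k β ≤ k) {η : ℝ≥0∞} (hη : 0 < η) :
    ∀ᶠ r in atTop, ∀ᶠ u in atTop, Metric.ediam
      (f u '' Icc (gapLo (A u) (B u) r (s u) g) (gapHi (A u) (B u) r k (s u) g)) ≤ η := by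
  obtain ⟨R, hR⟩ := hs.exists_eventually_edist_lt hs.line hs.maximal (g := g) (by omega) hη
  filter_upwards [hs.eventually_subset_gapSet hg hg', eventually_ge_atTop R] with r hr hrR
  filter_upwards [hr, hR] with u hu hRu
  refine Metric.ediam_le ?_
  rintro _ ⟨t, ht, rfl⟩ _ ⟨t', ht', rfl⟩
  exact (hRu t (gapSet_anti hrR (hu ht)) t' (gapSet_anti hrR (hu ht'))).le

/-- One good point suffices: an end of the gap adjacent to a window is close to `ξ_{±r}` of the
marked limit, which is close to the vertex for large `r`. -/
theorem IsCompleteMarking.eventually_infEDist_gap_le (hs : M.IsCompleteMarking f A B k s x α β)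
    {g : ℕ} (hg : leftCount α ≤ g) (hg' : g + rightCount k β ≤ k) {η : ℝ≥0∞} (hη : 0 < η) :
    ∀ᶠ r in atTop, ∀ᶠ u in atTop,
      ⨅ y ∈ f u '' Icc (gapLo (A u) (B u) r (s u) g) (gapHi (A u) (B u) r k (s u) g),
        Metric.infEDist y (connectedComponentIn M.F (M.vertex x g)) ≤ η := by
  have hη2 : 0 < η / 2 := ENNReal.half_pos hη.ne'
  obtain ⟨h1, h2⟩ := hs.ends_eq_top hg hg'
  have hC := mem_connectedComponentIn (M.vertex_mem_F x g)
  have tri : ∀ {y z : X}, edist y z < η / 2 → edist z (M.vertex x g) < η / 2 → ∀ {S : Set X},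
      y ∈ S → ⨅ y ∈ S, Metric.infEDist y (connectedComponentIn M.F (M.vertex x g)) ≤ η := by
    intro y z hy hz S hyS
    refine (iInf₂_le y hyS).trans ((Metric.infEDist_le_edist_of_mem hC).trans ?_)
    calc edist y (M.vertex x g) ≤ edist y z + edist z (M.vertex x g) := edist_triangle _ _ _
      _ ≤ η / 2 + η / 2 := add_le_add hy.le hz.le
      _ = η := ENNReal.add_halves η
  rcases Nat.eq_zero_or_pos g with rfl | h0
  · have hlim : Tendsto (fun r => M.ξ (-r) (x 0)) atTop (𝓝 (M.vertex x 0)) := by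
      rw [vertex, if_pos rfl]
      exact (M.tendsto_limBot (x 0)).comp tendsto_neg_atTop_atBot
    filter_upwards [hs.eventually_ends, eventually_ge_atTop 0, EMetric.tendsto_nhds.1 hlim _ hη2]
      with r hr hr0 hclose
    filter_upwards [hr, hs.eventually_edist_lt hs.line hs.pos r hη2] with u hu hedist
    have hle : A u ≤ s u 0 - r := (hu 0 hs.pos).1 (h1 hs.pos)
    refine tri (hedist (-r) (by rw [abs_neg, abs_of_nonneg hr0]) ⟨by linarith, ?_⟩) hclose
      ⟨s u 0 + -r, ⟨?_, ?_⟩, rfl⟩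
    · linarith [(hs.mem u 0 hs.pos).2]
    · rw [gapLo, if_pos rfl]; linarith
    · rw [gapHi, if_pos hs.pos, segLo, max_eq_right hle]; linarith
  · have hgk : g - 1 < k := by omega
    have hlim : Tendsto (fun r => M.ξ r (x (g - 1))) atTop (𝓝 (M.vertex x g)) := by
      rw [vertex, if_neg h0.ne']
      exact M.tendsto_limTop _
    filter_upwards [hs.eventually_ends, eventually_ge_atTop 0, EMetric.tendsto_nhds.1 hlim _ hη2]
      with r hr hr0 hclose
    filter_upwards [hr, hs.eventually_edist_lt hs.line hgk r hη2, hs.eventually_add_le (2 * r)]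
      with u hu hedist hsep
    have hle : s u (g - 1) + r ≤ B u := (hu (g - 1) hgk).2.2.1 (h2 h0)
    refine tri (hedist r (by rw [abs_of_nonneg hr0]) ⟨?_, hle⟩) hclose
      ⟨s u (g - 1) + r, ⟨?_, ?_⟩, rfl⟩
    · linarith [(hs.mem u (g - 1) hgk).1]
    · rw [gapLo, if_neg h0.ne', segHi, min_eq_right hle]
    · unfold gapHi
      split_ifs with h
      · have := hsep (g - 1) g (by omega) h
        exact le_max_of_le_right (by linarith)
      · exact hle

/-- The flow line itself avoids `F`, so only its limits through unbounded ends can be fixed; the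
index bounds exclude the outer vertices at bounded ends. -/
theorem IsCompleteMarking.exists_vertex_of_mem_closure (hs : M.IsCompleteMarking f A B k s x α β)
    {j : ℕ} (hj : j < k) {y : X} (hyF : y ∈ M.F)
    (hy : y ∈ closure ((fun t => M.ξ t (x j)) '' timeSet (α j) (β j))) :
    ∃ g, leftCount α ≤ g ∧ g + rightCount k β ≤ k ∧ y = M.vertex x g := by
  have hl := leftCount_le α
  have hr := rightCount_le k β
  rcases mem_closure_image_of_tendsto (M.continuous_ξ_left (x j)) (M.tendsto_limTop (x j))
    (M.tendsto_limBot (x j)) isClosed_timeSet hy with ⟨t, -, rfl⟩ | ⟨hb, rfl⟩ | ⟨hb, rfl⟩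
  · exact absurd hyF (M.ξ_notMem_F (hs.not_fixed j hj) t)
  · refine ⟨j + 1, by omega, ?_, (vertex_succ x j).symm⟩
    rw [bddAbove_timeSet_iff, not_not] at hb
    rcases (show j + 1 ≤ k by omega).eq_or_lt with h | h
    · have : rightCount k β = 0 := rightCount_eq_zero.2 (by rw [← h, Nat.add_sub_cancel]; exact hb)
      omega
    · omega
  · refine ⟨j, ?_, by omega, (hs.vertex_eq_limBot hj).symm⟩
    rw [bddBelow_timeSet_iff, not_not] at hb
    rcases Nat.eq_zero_or_pos j with rfl | h
    · rw [leftCount_eq_zero.2 hb]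
    · omega

theorem IsCompleteMarking.exists_vertex_mem_closure (hs : M.IsCompleteMarking f A B k s x α β)
    {g : ℕ} (hg : leftCount α ≤ g) (hg' : g + rightCount k β ≤ k) :
    ∃ j < k, M.vertex x g ∈ closure ((fun t => M.ξ t (x j)) '' timeSet (α j) (β j)) := by
  obtain ⟨h1, h2⟩ := hs.ends_eq_top hg hg'
  have hk := hs.pos
  rcases Nat.eq_zero_or_pos g with rfl | h0
  · refine ⟨0, hk, ?_⟩
    rw [vertex, if_pos rfl]
    refine mem_closure_of_tendsto (M.tendsto_limBot (x 0)) ?_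
    filter_upwards [eventually_le_atBot 0] with t ht
    refine ⟨t, ⟨by rw [h1 hk]; exact le_top, ?_⟩, rfl⟩
    rw [ENNReal.ofReal_of_nonpos ht]; exact zero_le
  · refine ⟨g - 1, by omega, ?_⟩
    rw [vertex, if_neg h0.ne']
    refine mem_closure_of_tendsto (M.tendsto_limTop _) ?_
    filter_upwards [eventually_ge_atTop 0] with t ht
    refine ⟨t, ⟨?_, by rw [h2 h0]; exact le_top⟩, rfl⟩
    rw [ENNReal.ofReal_of_nonpos (by linarith)]; exact zero_le

/-- The pointed segment of a complete marking. -/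
def IsCompleteMarking.segment (hs : M.IsCompleteMarking f A B k s x α β) {ε : ℝ}
    (hε : 0 < ε) (hAB : ∀ u, ε ≤ B u - A u) (j : Fin k) : M.PointedSegment where
  x := x j
  T := timeSet (α j) (β j)
  not_fixed := hs.not_fixed j j.2
  isClosed := isClosed_timeSet
  ordConnected := ordConnected_timeSet
  pos := hs.volume_pos hε hAB j.2

theorem IsCompleteMarking.convergesToSegments (hs : M.IsCompleteMarking f A B k s x α β) {ε : ℝ}
    (hε : 0 < ε) (hAB : ∀ u, ε ≤ B u - A u) :
    M.ConvergesToSegments f (fun u => Icc (A u) (B u)) (hs.segment hε hAB) := by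
  have hl := leftCount_le α
  have hr := rightCount_le k β
  have hk := hs.pos
  set na := leftCount α with hna
  set nb := rightCount k β with hnb
  have hinv : Tendsto (fun δ : ℝ => δ⁻¹) (𝓝[>] 0) atTop := tendsto_inv_nhdsGT_zero
  refine ⟨k + 1 - na - nb, fun i => connectedComponentIn M.F (M.vertex x (i + na)), ?_, ?_,
    fun δ u j => segLo (A u) δ⁻¹ (s u) j, fun δ u j => segHi (B u) δ⁻¹ (s u) j,
    fun δ u i => gapLo (A u) (B u) δ⁻¹ (s u) (i + na),
    fun δ u i => gapHi (A u) (B u) δ⁻¹ k (s u) (i + na), ?_, ?_, ?_, ?_, ?_⟩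
  · ext Z
    constructor
    · rintro ⟨i, rfl⟩
      refine ⟨⟨_, M.vertex_mem_F x _, rfl⟩, M.vertex x (i + na),
        mem_connectedComponentIn (M.vertex_mem_F x _), ?_⟩
      obtain ⟨j, hj, hmem⟩ := hs.exists_vertex_mem_closure (g := i + na) (by omega) (by omega)
      exact closure_mono (subset_iUnion (fun j : Fin k => (hs.segment hε hAB j).image) ⟨j, hj⟩) hmem
    · rintro ⟨⟨p, hp, rfl⟩, y, hyp, hy⟩
      rw [closure_iUnion_of_finite] at hy
      obtain ⟨j, hy⟩ := mem_iUnion.1 hy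
      obtain ⟨g, hg, hg', rfl⟩ := hs.exists_vertex_of_mem_closure j.2
        (connectedComponentIn_subset _ _ hyp) hy
      refine ⟨⟨g - na, by omega⟩, ?_⟩
      change connectedComponentIn M.F (M.vertex x (g - na + na)) = _
      rw [Nat.sub_add_cancel (show na ≤ g from hg)]
      exact (connectedComponentIn_eq hyp).symm
  · intro i j hij y hy z hz
    rw [M.H_eq_of_mem_connectedComponentIn (M.vertex_mem_F x _) hy,
      M.H_eq_of_mem_connectedComponentIn (M.vertex_mem_F x _) hz]
    have : (i : ℕ) < j := hij
    exact hs.H_vertex_lt (by omega) (by omega)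
  · filter_upwards [hinv.eventually hs.eventually_ends, self_mem_nhdsWithin] with δ h1 hδ
    have hδ0 : 0 < δ⁻¹ := inv_pos.2 hδ
    filter_upwards [h1, hs.eventually_add_le (2 * δ⁻¹)] with u h2 h3
    refine Icc_eq_iUnion_segments_gaps hk hl hr hδ0 (hs.mem u) h3 (fun h => ?_) (fun h => ?_)
      (fun h => ?_)
    · exact (h2 0 hk).1 (leftCount_eq_zero.1 h)
    · exact (h2 0 hk).2.1 fun h' => by
        have := leftCount_eq_zero.2 h'
        omega
    · exact (h2 (k - 1) (by omega)).2.2.2 fun h' => by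
        have := rightCount_eq_zero.2 h'
        omega
  · filter_upwards [self_mem_nhdsWithin] with δ hδ j
    refine ENNReal.tendsto_nhds_zero.2 fun η hη => ?_
    filter_upwards [hs.line.flow (2 * δ⁻¹) η hη] with u hu
    refine iSup₂_le fun t₀ ht₀ => iSup₂_le fun t ht => (hu t₀ ?_ t ?_ ?_).le
    · exact ⟨(le_max_left _ _).trans ht₀.1, ht₀.2.trans (min_le_left _ _)⟩
    · exact ⟨(le_max_left _ _).trans ht.1, ht.2.trans (min_le_left _ _)⟩
    · have a1 := (le_max_right _ _).trans ht₀.1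
      have a2 := ht₀.2.trans (min_le_right _ _)
      have a3 := (le_max_right _ _).trans ht.1
      have a4 := ht.2.trans (min_le_right _ _)
      rw [abs_le]
      constructor <;> linarith
  · intro j
    refine ⟨_, ?_, tendsto_hausdorffEDist_inter_away (hs.not_fixed j j.2) (α j) (β j)⟩
    filter_upwards [self_mem_nhdsWithin] with δ hδ
    exact tendsto_hausdorffEDist_of_tendsto_zero (hs.tendsto_hausdorffEDist hs.line j.2
      (hs.tendsto_left j j.2) (hs.tendsto_right j j.2) (inv_pos.2 hδ).le)
  · intro i
    refine ENNReal.tendsto_nhds_zero.2 fun η hη => ?_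
    filter_upwards [hinv.eventually (hs.eventually_ediam_gap_le (g := i + na) (by omega) (by omega)
      hη)] with δ hδ
    exact limsup_le_of_le (by isBoundedDefault) hδ
  · intro i
    refine ENNReal.tendsto_nhds_zero.2 fun η hη => ?_
    filter_upwards [hinv.eventually (hs.eventually_infEDist_gap_le (g := i + na) (by omega)
      (by omega) hη)] with δ hδ
    exact limsup_le_of_le (by isBoundedDefault) hδ

theorem IsCompleteMarking.exists_converges (hs : M.IsCompleteMarking f A B k s x α β) {ε : ℝ}
    (hε : 0 < ε) (hAB : ∀ u, ε ≤ B u - A u) :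
    ∃ T : M.Chain, M.Converges f (fun u => Icc (A u) (B u)) T := by
  refine ⟨.segments k hs.pos (hs.segment hε hAB) (fun j hj => ?_) (fun j hj => ?_)
    (fun i j hij => ?_), hs.convergesToSegments hε hAB⟩
  · exact bddBelow_timeSet_iff.not.2 (not_not.2 (hs.left_eq_top hj j.2))
  · exact bddAbove_timeSet_iff.not.2 (not_not.2 (hs.right_eq_top hj))
  · refine ⟨M.limTop (x i), M.tendsto_limTop _, ?_⟩
    have := hs.limTop_eq_limBot hs.line hs.maximal (j := i) (by omega)
    rw [this, ← hij]
    exact M.tendsto_limBot _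

/-- Compactness: a sequence of asymptotic gradient lines has a subsequence which converges to a
chain of gradient segments. -/
theorem IsAsymptoticLine.exists_subseq_converges (hf : M.IsAsymptoticLine f A B) {ε : ℝ}
    (hε : 0 < ε) (hAB : ∀ u, ε ≤ B u - A u) : ∃ φ : ℕ → ℕ, StrictMono φ ∧ ∃ T : M.Chain,
      M.Converges (fun u => f (φ u)) (fun u => Icc (A (φ u)) (B (φ u))) T := by
  obtain ⟨K, hK, -⟩ := M.exists_lojasiewicz
  let P : ℕ → Prop := fun k => ∃ φ : ℕ → ℕ, StrictMono φ ∧ ∃ s x, M.IsMarking (fun u => f (φ u))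
    (fun u => A (φ u)) (fun u => B (φ u)) k s x
  -- The empty marking always exists and sizes are bounded by `K.card`. Maximality is required over
  -- all further subsequences, hence the quantification over `φ` in `P`.
  obtain ⟨k, ⟨φ, hφ, s, x, hs⟩, hmax⟩ : ∃ k, P k ∧ ¬ P (k + 1) := by
    by_contra! hcon
    have hall : ∀ k, P k := fun k => by
      induction k with
      | zero =>
        exact ⟨id, strictMono_id, fun _ _ => 0, fun _ => f 0 0, by simp, by simp, by simp, by simp⟩
      | succ n ih => exact hcon n ih
    obtain ⟨φ, hφ, s, x, hs⟩ := hall (K.card + 1)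
    have := hs.le_card (hf.comp hφ) hK
    omega
  have hmax' : ∀ ψ : ℕ → ℕ, StrictMono ψ → ∀ s' x', ¬ M.IsMarking (fun u => f (φ (ψ u)))
      (fun u => A (φ (ψ u))) (fun u => B (φ (ψ u))) (k + 1) s' x' := fun ψ hψ s' x' h =>
    hmax ⟨φ ∘ ψ, hφ.comp hψ, s', x', h⟩
  rcases Nat.eq_zero_or_pos k with rfl | hk
  -- Without marks the whole interval is a single gap, so the curve shrinks to a point, which is
  -- necessarily fixed.
  · obtain ⟨p, -, ψ, hψ, hlim⟩ := isCompact_univ.tendsto_subseq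
      (x := fun n => f (φ n) (A (φ n))) (fun n => mem_univ _)
    have hgap : ∀ u R, ∀ t ∈ Icc (A (φ u)) (B (φ u)),
        t ∈ gapSet (A (φ u)) (B (φ u)) 0 (s u) 0 R := fun u R t ht =>
      ⟨ht, fun h => absurd h (lt_irrefl _), fun h => absurd h (lt_irrefl _)⟩
    have hpF : p ∈ M.F := by
      rw [← M.isClosed_F.closure_eq, Metric.mem_closure_iff_infEDist_zero]
      refine le_antisymm (ENNReal.le_of_forall_pos_le_add fun η hη _ => ?_) zero_le
      obtain ⟨R, hR⟩ := hs.exists_eventually_infEDist_lt hmax' (g := 0) le_rfl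
        (ENNReal.coe_pos.2 hη)
      rw [zero_add]
      refine le_of_tendsto ((Metric.continuous_infEDist.tendsto p).comp hlim) ?_
      filter_upwards [hψ.tendsto_atTop.eventually hR] with u hu
      exact (hu _ (hgap _ R _ (left_mem_Icc.2 (hf.le _)))).le
    refine ⟨φ ∘ ψ, hφ.comp hψ, .degenerate p, ?_, fun h => absurd hpF h⟩
    refine ENNReal.tendsto_nhds_zero.2 fun η hη => ?_
    have hη2 : 0 < η / 2 := ENNReal.half_pos hη.ne'
    obtain ⟨R, hR⟩ := hs.exists_eventually_edist_lt (hf.comp hφ) hmax' (g := 0) le_rfl hη2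
    filter_upwards [hψ.tendsto_atTop.eventually hR, EMetric.tendsto_nhds.1 hlim _ hη2] with u hu hp
    have hA := left_mem_Icc.2 (hf.le (φ (ψ u)))
    have key : ∀ t ∈ Icc (A (φ (ψ u))) (B (φ (ψ u))), edist (f (φ (ψ u)) t) p ≤ η := by
      intro t ht
      calc edist (f (φ (ψ u)) t) p ≤ _ := edist_triangle _ (f (φ (ψ u)) (A (φ (ψ u)))) _
        _ ≤ η / 2 + η / 2 := add_le_add (hu t (hgap _ R t ht) _ (hgap _ R _ hA)).le hp.le
        _ = η := ENNReal.add_halves η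
    refine Metric.hausdorffEDist_le_of_mem_edist ?_ ?_
    · rintro _ ⟨t, ht, rfl⟩
      exact ⟨p, rfl, key t ht⟩
    · rintro _ rfl
      exact ⟨_, ⟨_, hA, rfl⟩, by rw [edist_comm]; exact key _ hA⟩
  -- Compactness of a countable product of copies of `[0, ∞]²` lets all distances to the ends
  -- converge along one subsequence.
  · obtain ⟨αβ, -, ψ, hψ, hlim⟩ := isCompact_univ.tendsto_subseq
      (x := fun u => fun j : ℕ => (ENNReal.ofReal (s u j - A (φ u)),
        ENNReal.ofReal (B (φ u) - s u j))) (fun n => mem_univ _)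
    have hlim' := tendsto_pi_nhds.1 hlim
    have hc : M.IsCompleteMarking (fun u => f (φ (ψ u))) (fun u => A (φ (ψ u)))
        (fun u => B (φ (ψ u))) k (fun u => s (ψ u)) x (fun j => (αβ j).1) (fun j => (αβ j).2) :=
      { hs.comp hψ with
        line := hf.comp (hφ.comp hψ)
        pos := hk
        maximal := fun χ hχ => hmax' (ψ ∘ χ) (hψ.comp hχ)
        tendsto_left := fun j _ => (continuous_fst.tendsto _).comp (hlim' j)
        tendsto_right := fun j _ => (continuous_snd.tendsto _).comp (hlim' j) }
    obtain ⟨T, hT⟩ := hc.exists_converges hε (fun u => hAB _)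
    exact ⟨φ ∘ ψ, hφ.comp hψ, T, hT⟩

end ChainConvergence

end HamiltonianCircleData

/-! ### Rescaling time and the main theorem -/

theorem exp_neg_mul_infDist_frontier_Icc_le {a b σ τ : ℝ} (hab : a < b) (hσ : 0 ≤ σ) :
    Real.exp (-σ * Metric.infDist τ (frontier (Icc a b))) ≤
      Real.exp (-σ * (τ - a)) + Real.exp (-σ * (b - τ)) := by
  rw [frontier_Icc hab.le]
  obtain ⟨y, hy, h⟩ := (Set.toFinite {a, b}).isCompact.exists_infDist_eq_dist ⟨a, by simp⟩ τ
  rw [h, Real.dist_eq]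
  have h1 := Real.exp_pos (-σ * (τ - a))
  have h2 := Real.exp_pos (-σ * (b - τ))
  rcases hy with rfl | rfl
  · have : Real.exp (-σ * |τ - y|) ≤ Real.exp (-σ * (τ - y)) :=
      Real.exp_le_exp.2 (mul_le_mul_of_nonpos_left (le_abs_self _) (by linarith))
    linarith
  · have : Real.exp (-σ * |τ - y|) ≤ Real.exp (-σ * (y - τ)) :=
      Real.exp_le_exp.2 (mul_le_mul_of_nonpos_left (by rw [abs_sub_comm]; exact le_abs_self _)
        (by linarith))
    linarith

theorem smul_Icc_eq_Icc_min_max {a b l : ℝ} (hab : a ≤ b) (hl : l ≠ 0) :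
    l • Icc a b = Icc (min (l * a) (l * b)) (max (l * a) (l * b)) := by
  ext t
  rw [mem_smul_set_iff_inv_smul_mem₀ hl, smul_eq_mul, mem_Icc, mem_Icc, inv_mul_eq_div]
  rcases lt_or_gt_of_ne hl with h | h
  · have := mul_le_mul_of_nonpos_left hab h.le
    rw [min_eq_right this, max_eq_left this, le_div_iff_of_neg h, div_le_iff_of_neg h, mul_comm a,
      mul_comm b, and_comm]
  · have := mul_le_mul_of_nonneg_left hab h.le
    rw [min_eq_left this, max_eq_right this, le_div_iff₀ h, div_le_iff₀ h, mul_comm a, mul_comm b]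

theorem max_sub_min_mul (a b l : ℝ) :
    max (l * a) (l * b) - min (l * a) (l * b) = |l * (b - a)| := by
  rw [max_sub_min_eq_abs, ← mul_sub]

theorem exp_neg_add_exp_neg_rescale {a b l σ t : ℝ} (hab : a ≤ b) (hl : l ≠ 0) :
    Real.exp (-(σ / |l|) * (t - min (l * a) (l * b))) +
      Real.exp (-(σ / |l|) * (max (l * a) (l * b) - t)) =
      Real.exp (-σ * (t / l - a)) + Real.exp (-σ * (b - t / l)) := by
  rcases lt_or_gt_of_ne hl with h | h
  · have := mul_le_mul_of_nonpos_left hab h.le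
    rw [min_eq_right this, max_eq_left this, abs_of_neg h, add_comm]
    congr 2 <;> field_simp <;> ring
  · have := mul_le_mul_of_nonneg_left hab h.le
    rw [min_eq_left this, max_eq_right this, abs_of_pos h]
    congr 2 <;> field_simp

namespace HamiltonianCircleData

section Rescaling

variable {E X : Type*} [NormedAddCommGroup E] [NormedSpace ℝ E] [FiniteDimensional ℝ E]
  [EMetricSpace X] [CompactSpace X] [ChartedSpace E X] [IsManifold 𝓘(ℝ, E) ∞ X]
  [RiemannianBundle (fun x : X => TangentSpace 𝓘(ℝ, E) x)]
  [MulAction Circle X] (M : HamiltonianCircleData E X)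

/-- Rescaling time in a solution of a slow perturbed gradient equation gives an approximate gradient
line. -/
theorem isApproxLine_rescale {ψ : ℝ → X} {a b l G σ : ℝ} (hab : a < b) (hl : l ≠ 0) (hσ : 0 < σ)
    (hG : 0 ≤ G) (hψ : ContMDiffOn 𝓘(ℝ, ℝ) 𝓘(ℝ, E) ∞ ψ (Icc a b))
    (hgrad : ∀ t ∈ Icc a b,
      ‖mfderivWithin 𝓘(ℝ, ℝ) 𝓘(ℝ, E) ψ (Icc a b) t (1 : ℝ) - l • M.V (ψ t)‖
        ≤ G * Real.exp (-σ * Metric.infDist t (frontier (Icc a b)))) :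
    M.IsApproxLine (fun t => ψ (t / l)) (min (l * a) (l * b)) (max (l * a) (l * b)) (G / σ)
      (σ / |l|) := by
  have hmaps : MapsTo (fun t : ℝ => t / l)
      (Icc (min (l * a) (l * b)) (max (l * a) (l * b))) (Icc a b) := by
    intro t ht
    rw [← smul_Icc_eq_Icc_min_max hab.le hl, mem_smul_set_iff_inv_smul_mem₀ hl, smul_eq_mul,
      inv_mul_eq_div] at ht
    exact ht
  intro t ht
  have hτ := hmaps ht
  set w : TangentSpace 𝓘(ℝ, E) (ψ (t / l)) :=
    mfderivWithin 𝓘(ℝ, ℝ) 𝓘(ℝ, E) ψ (Icc a b) (t / l) (1 : ℝ) with hw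
  refine ⟨l⁻¹ • w, ?_, ?_⟩
  · have h1 := (hψ.mdifferentiableOn (by simp) _ hτ).hasMFDerivWithinAt
    have h2 : HasMFDerivWithinAt 𝓘(ℝ, ℝ) 𝓘(ℝ, ℝ) (fun t : ℝ => t / l)
        (Icc (min (l * a) (l * b)) (max (l * a) (l * b))) t
        (ContinuousLinearMap.toSpanSingleton ℝ (1 / l)) :=
      (((hasDerivAt_id t).div_const l).hasDerivWithinAt).hasFDerivWithinAt.hasMFDerivWithinAt
    refine (HasMFDerivWithinAt.comp t h1 h2 hmaps.subset_preimage).congr_mfderiv ?_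
    refine ContinuousLinearMap.ext fun r : ℝ => ?_
    have h3 : (r • (1 / l) : ℝ) = (r * l⁻¹) • (1 : ℝ) := by simp
    have h4 : mfderivWithin 𝓘(ℝ, ℝ) 𝓘(ℝ, E) ψ (Icc a b) (t / l) ((r * l⁻¹) • (1 : ℝ)) =
        (r * l⁻¹) • w := map_smul _ _ _
    refine (congrArg (mfderivWithin 𝓘(ℝ, ℝ) 𝓘(ℝ, E) ψ (Icc a b) (t / l)) h3).trans (h4.trans ?_)
    exact mul_smul r l⁻¹ w
  · have h1 : l⁻¹ • w - M.V (ψ (t / l)) = l⁻¹ • (w - l • M.V (ψ (t / l))) := by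
      rw [smul_sub, inv_smul_smul₀ hl]
    have hl0 : 0 < |l| := abs_pos.2 hl
    rw [h1, norm_smul, norm_inv, Real.norm_eq_abs]
    -- The exponential of the distance to the boundary is at most the sum of the exponentials for
    -- the two endpoints. Dividing by `|l|` and writing `G / |l| = (G / σ)(σ / |l|)` produces the
    -- normalized kernel of rate `σ / |l|`.
    have h2 := (hgrad _ hτ).trans (mul_le_mul_of_nonneg_left
      (exp_neg_mul_infDist_frontier_Icc_le hab hσ.le) hG)
    rw [edgeRate, exp_neg_add_exp_neg_rescale hab.le hl]
    refine (mul_le_mul_of_nonneg_left h2 (inv_nonneg.2 hl0.le)).trans (le_of_eq ?_)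
    field_simp

variable [ContMDiffSMul (𝓡 1) 𝓘(ℝ, E) ∞ Circle X]
  [h : IsContMDiffRiemannianBundle 𝓘(ℝ, E) ∞ E (fun x : X => TangentSpace 𝓘(ℝ, E) x)]

/-- Approximate gradient lines on intervals of length tending to zero shrink to points. -/
theorem tendsto_ediam_of_isApproxLine {f : ℕ → ℝ → X} {A B g c : ℕ → ℝ}
    (hf : ∀ u, M.IsApproxLine (f u) (A u) (B u) (g u) (c u))
    (hg : ∀ u, 0 ≤ g u) (hg0 : Tendsto g atTop (𝓝 0)) (hc : ∀ᶠ u in atTop, 1 ≤ c u)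
    (hAB : Tendsto (fun u => B u - A u) atTop (𝓝 0)) :
    Tendsto (fun u => Metric.ediam (f u '' Icc (A u) (B u))) atTop (𝓝 0) := by
  obtain ⟨n, e, L, C, he, hinj, hL, hC, hLip, hbd⟩ := M.exists_embedding
  obtain ⟨D, hD, m, hm, hen⟩ := M.exists_energy_estimate he hC hbd
  refine ENNReal.tendsto_nhds_zero.2 fun η hη => ?_
  obtain ⟨ρ, hρ, hρη⟩ := exists_edist_lt_of_dist_lt he.continuous hinj hη
  have hlim : Tendsto (fun u => D * ((B u - A u) + g u)) atTop (𝓝 (D * (0 + 0))) :=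
    (hAB.add hg0).const_mul D
  rw [add_zero, mul_zero] at hlim
  filter_upwards [hc, hlim.eventually (gt_mem_nhds hρ)] with u hcu hu
  have key : ∀ s ∈ Icc (A u) (B u), ∀ t ∈ Icc (A u) (B u), s ≤ t →
      edist (f u t) (f u s) ≤ η := by
    intro s hs t ht hst
    refine (hρη _ _ ?_).le
    rw [dist_eq_norm]
    refine ((hen (hg u) hcu (hf u) s hs t ht hst).2.2.trans ?_).trans_lt hu
    gcongr
    · exact ht.2
    · exact hs.1
  refine Metric.ediam_le ?_
  rintro _ ⟨s, hs, rfl⟩ _ ⟨t, ht, rfl⟩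
  rcases le_total s t with h | h
  · rw [edist_comm]; exact key s hs t ht h
  · exact key t ht s hs h

end Rescaling

end HamiltonianCircleData

theorem mainTheorem5 {E X : Type*} [NormedAddCommGroup E] [NormedSpace ℝ E]
    [FiniteDimensional ℝ E] [EMetricSpace X] [CompactSpace X] [ChartedSpace E X]
    [IsManifold 𝓘(ℝ, E) ∞ X]
    [RiemannianBundle (fun x : X => TangentSpace 𝓘(ℝ, E) x)]
    [IsContMDiffRiemannianBundle 𝓘(ℝ, E) ∞ E (fun x : X => TangentSpace 𝓘(ℝ, E) x)]
    [IsRiemannianManifold 𝓘(ℝ, E) X]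
    [MulAction Circle X] [ContMDiffSMul (𝓡 1) 𝓘(ℝ, E) ∞ Circle X]
    (M : HamiltonianCircleData E X)
    (σ : ℝ) (hσ : 0 < σ)
    (a b : ℕ → ℝ) (hab : ∀ u, a u < b u)
    (ψ : ℕ → ℝ → X)
    (hψ : ∀ u, ContMDiffOn 𝓘(ℝ, ℝ) 𝓘(ℝ, E) ∞ (ψ u) (Icc (a u) (b u)))
    (l G : ℕ → ℝ) (hl : ∀ u, l u ≠ 0) (hG : ∀ u, 0 < G u)
    (hgrad : ∀ u, ∀ t ∈ Icc (a u) (b u),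
      ‖mfderivWithin 𝓘(ℝ, ℝ) 𝓘(ℝ, E) (ψ u) (Icc (a u) (b u)) t (1 : ℝ) - l u • M.V (ψ u t)‖
        ≤ G u * Real.exp (-σ * Metric.infDist t (frontier (Icc (a u) (b u)))))
    (hG0 : Tendsto G atTop (𝓝 0)) (hl0 : Tendsto l atTop (𝓝 0)) :
    (∃ φ : ℕ → ℕ, StrictMono φ ∧ ∃ L : EReal,
      Tendsto (fun u => ((l (φ u) * (b (φ u) - a (φ u)) : ℝ) : EReal)) atTop (𝓝 L)) ∧
    (Tendsto (fun u => l u * (b u - a u)) atTop (𝓝 0) →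
      Tendsto (fun u => Metric.ediam (ψ u '' Icc (a u) (b u))) atTop (𝓝 0)) ∧
    (¬ Tendsto (fun u => l u * (b u - a u)) atTop (𝓝 0) →
      ∃ φ : ℕ → ℕ, StrictMono φ ∧ ∃ T : M.Chain,
        M.Converges (fun u t => ψ (φ u) (t / l (φ u)))
          (fun u => l (φ u) • Icc (a (φ u)) (b (φ u))) T) := by
  have hf : ∀ u, M.IsApproxLine (fun t => ψ u (t / l u)) (min (l u * a u) (l u * b u))
      (max (l u * a u) (l u * b u)) (G u / σ) (σ / |l u|) := fun u =>
    M.isApproxLine_rescale (hab u) (hl u) hσ (hG u).le (hψ u) (hgrad u)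
  have hg : ∀ u, 0 ≤ G u / σ := fun u => div_nonneg (hG u).le hσ.le
  have hg0 : Tendsto (fun u => G u / σ) atTop (𝓝 0) := by
    simpa using hG0.div_const σ
  -- Here `l_u → 0` is used: the decay rate in the rescaled time becomes large.
  have hc : ∀ᶠ u in atTop, 1 ≤ σ / |l u| := by
    have hl0' : Tendsto (fun u => |l u|) atTop (𝓝 0) := by simpa using hl0.abs
    filter_upwards [hl0'.eventually (gt_mem_nhds hσ)] with u hu
    rw [le_div_iff₀ (abs_pos.2 (hl u)), one_mul]
    exact hu.le
  refine ⟨?_, fun h => ?_, fun h => ?_⟩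
  · obtain ⟨L, -, φ, hφ, hlim⟩ := isCompact_univ.tendsto_subseq
      (x := fun u => ((l u * (b u - a u) : ℝ) : EReal)) (fun u => mem_univ _)
    exact ⟨φ, hφ, L, hlim⟩
  · have hlen : Tendsto (fun u => max (l u * a u) (l u * b u) - min (l u * a u) (l u * b u)) atTop
        (𝓝 0) := by
      have : Tendsto (fun u => |l u * (b u - a u)|) atTop (𝓝 0) := by simpa using h.abs
      exact this.congr fun u => (max_sub_min_mul (a u) (b u) (l u)).symm
    refine (M.tendsto_ediam_of_isApproxLine hf hg hg0 hc hlen).congr fun u => ?_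
    congr 1
    rw [← smul_Icc_eq_Icc_min_max (hab u).le (hl u), ← image_smul, image_image]
    refine image_congr fun t _ => ?_
    rw [smul_eq_mul, mul_div_cancel_left₀ _ (hl u)]
  -- Failure of convergence to `0` bounds the rescaled lengths below along a subsequence, which
  -- makes the limiting segments have positive length.
  · obtain ⟨ε, hε, hfreq⟩ : ∃ ε > 0, ∃ᶠ u in atTop, ε ≤ |l u * (b u - a u)| := by
      by_contra! hcon
      refine h (Metric.tendsto_nhds.2 fun ε hε => ?_)
      filter_upwards [hcon ε hε] with u hu
      rwa [Real.dist_eq, sub_zero]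
    obtain ⟨χ, hχ, hlarge⟩ := extraction_of_frequently_atTop hfreq
    have hline := M.isAsymptoticLine_of_isApproxLine (fun u => min_le_max) (fun u => hf (χ u))
      (fun u => hg (χ u)) (hg0.comp hχ.tendsto_atTop) (hχ.tendsto_atTop.eventually hc)
    obtain ⟨φ, hφ, T, hT⟩ := hline.exists_subseq_converges hε fun u => by
      rw [max_sub_min_mul]
      exact hlarge u
    refine ⟨χ ∘ φ, hχ.comp hφ, T, ?_⟩
    have hS : (fun u => l ((χ ∘ φ) u) • Icc (a ((χ ∘ φ) u)) (b ((χ ∘ φ) u))) =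
        fun u => Icc (min (l (χ (φ u)) * a (χ (φ u))) (l (χ (φ u)) * b (χ (φ u))))
          (max (l (χ (φ u)) * a (χ (φ u))) (l (χ (φ u)) * b (χ (φ u)))) :=
      funext fun u => smul_Icc_eq_Icc_min_max (hab _).le (hl _)
    rw [hS]
    exact hT
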